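/- Let $m\ge 3$. There exist constants $a,b\ge 0$, depending only on $m$, with the following property. For every non-decreasing function $G\colon\mathbb R_{\ge0}\to\mathbb R_{\ge0}$ with $G(r)\to\infty$ as $r\to\infty$ there exists a smooth complete Riemannian metric $g$ on $\mathbb R^m$ with bounded geometry (i.e. there is $\varepsilon>0$ such that for every $x$ the exponential map $\exp_x$ is a diffeomorphism from the ball of radius $\varepsilon$ in the tangent space at $x$ onto an open set, and the curvature tensor is uniformly bounded) such that, with balls $B(x,r)$ taken with respect to the Riemannian distance of $g$: (a) $(\mathbb R^m,g)$ is uniformly contractible: there is a non-decreasing function $\mathfrak R\colon\mathbb R_{\ge0}\to\mathbb R_{\ge0}$ with $\mathfrak R(r)\ge r$ such that for all $x\in\mathbb R^m$ and $r\ge0$ there is a continuous map $H\colon B(x,r)\times[0,1]\to B(x,\mathfrak R(r))$ with $H(y,0)=y$ and $H(y,1)=x$ for all $y\in B(x,r)$; (b) $(\mathbb R^m,g)$ has asymptotic dimension $\le m$ with the diameter control $\mathfrak D(r)=ar+b$, which is independent of $G$ and satisfies $\mathfrak D(r)\ge r$: for every $r>0$ there is a cover of $\mathbb R^m$ by sets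 of diameter at most $\mathfrak D(r)$ such that every ball of radius $r$ meets at most $m+1$ members of the cover; (c) the scalar curvature $k$ of $g$ is positive everywhere, and for every $x_0\in\mathbb R^m$ $$\lim_{r\to+\infty}\Big(G(r)\cdot\inf_{x\in B(x_0,r)}k(x)\Big)=+\infty .$$ -/

import Mathlib

open Set Filter Topology Manifold Bundle
open scoped NNReal ContDiff

noncomputable section

namespace ScalarDecay

/-- The manifold `ℝ^m`, with its standard smooth structure. -/
abbrev Euc (m : ℕ) : Type := EuclideanSpace ℝ (Fin m)

/-- A smooth (`C^∞`) Riemannian metric on the manifold `ℝ^m`. -/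
abbrev SmoothMetric (m : ℕ) : Type :=
  ContMDiffRiemannianMetric 𝓘(ℝ, Euc m) ∞ (Euc m)
    (fun x : Euc m ↦ TangentSpace 𝓘(ℝ, Euc m) x)

section Distance

/-- In a connected extended metric space all distances are finite. -/
theorem edist_ne_top_of_preconnected {X : Type*} [EMetricSpace X] [PreconnectedSpace X]
    (x y : X) : edist x y ≠ ⊤ := by
  have hclopen : IsClopen (Metric.eball x ⊤) := by
    refine ⟨?_, Metric.isOpen_eball⟩
    rw [← isOpen_compl_iff, EMetric.isOpen_iff]
    intro z hz
    refine ⟨1, one_pos, fun w hw hwx ↦ hz ?_⟩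
    rw [Metric.mem_eball] at hw hwx ⊢
    calc edist z x ≤ edist z w + edist w x := edist_triangle _ _ _
      _ < ⊤ := ENNReal.add_lt_top.2
        ⟨by rw [edist_comm]; exact hw.trans ENNReal.one_lt_top, hwx⟩
  have huniv := hclopen.eq_univ ⟨x, by simp [Metric.mem_eball]⟩
  have hy : y ∈ Metric.eball x ⊤ := huniv ▸ mem_univ y
  rw [Metric.mem_eball, edist_comm] at hy
  exact hy.ne

/-- The Riemannian distance of `g`, i.e. the infimum of the `g`-lengths of the `C^1` paths
between two points, as a metric on `ℝ^m`. -/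
abbrev metricSpaceOf {m : ℕ} (g : SmoothMetric m) : MetricSpace (Euc m) :=
  letI : RiemannianBundle (fun x : Euc m ↦ TangentSpace 𝓘(ℝ, Euc m) x) :=
    ⟨g.toRiemannianMetric⟩
  haveI : IsContinuousRiemannianBundle (Euc m)
      (fun x : Euc m ↦ TangentSpace 𝓘(ℝ, Euc m) x) :=
    ⟨⟨g.inner, g.contMDiff.continuous, fun _ _ _ ↦ rfl⟩⟩
  letI M : EMetricSpace (Euc m) := EMetricSpace.ofRiemannianMetric 𝓘(ℝ, Euc m) (Euc m)
  @EMetricSpace.toMetricSpace (Euc m) M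
    (fun x y ↦ @edist_ne_top_of_preconnected (Euc m) M inferInstance x y)

/-- `ℝ^m` as a metric space with the Riemannian distance of `g`. -/
def RiemannianSpace {m : ℕ} (_g : SmoothMetric m) : Type := Euc m

instance {m : ℕ} (g : SmoothMetric m) : MetricSpace (RiemannianSpace g) := metricSpaceOf g

end Distance

section Curvature

variable {m : ℕ} (g : SmoothMetric m)

/-- The inner product `g_x(v, w)` of two tangent vectors at `x`. -/
def metricInner (x v w : Euc m) : ℝ := g.inner x v w

/-- The length of a tangent vector `v` at `x` with respect to `g`. -/
def metricNorm (x v : Euc m) : ℝ := Real.sqrt (metricInner g x v v)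

/-- The matrix `g_{ij}(x)` of the metric in the standard coordinates. -/
def gram (x : Euc m) : Matrix (Fin m) (Fin m) ℝ :=
  Matrix.of fun i j ↦ metricInner g x (EuclideanSpace.single i 1) (EuclideanSpace.single j 1)

/-- The partial derivative `∂_i f` at `x`. -/
def partialDeriv (i : Fin m) (f : Euc m → ℝ) (x : Euc m) : ℝ :=
  fderiv ℝ f x (EuclideanSpace.single i 1)

/-- The Christoffel symbol
`Γ^k_{ij} = 1/2 ∑_l g^{kl} (∂_i g_{jl} + ∂_j g_{il} - ∂_l g_{ij})` at `x`. -/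
def christoffel (k i j : Fin m) (x : Euc m) : ℝ :=
  (1 / 2) * ∑ l, (gram g x)⁻¹ k l *
    (partialDeriv i (fun y ↦ gram g y j l) x + partialDeriv j (fun y ↦ gram g y i l) x
      - partialDeriv l (fun y ↦ gram g y i j) x)

/-- The components of the curvature tensor of the Levi-Civita connection,
`R(∂_i, ∂_j) ∂_k = ∑_l (riemannCoeff l k i j) ∂_l`, where
`R(X, Y) Z = ∇_X ∇_Y Z - ∇_Y ∇_X Z - ∇_{[X, Y]} Z`. -/
def riemannCoeff (l k i j : Fin m) (x : Euc m) : ℝ :=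
  partialDeriv i (christoffel g l j k) x - partialDeriv j (christoffel g l i k) x
    + ∑ p, (christoffel g l i p x * christoffel g p j k x
      - christoffel g l j p x * christoffel g p i k x)

/-- The curvature tensor `R(u, v) w` at `x`. -/
def curvature (x u v w : Euc m) : Euc m :=
  WithLp.toLp 2 fun l ↦ ∑ i, ∑ j, ∑ k, riemannCoeff g l k i j x * u i * v j * w k

/-- The Ricci curvature `Ric(∂_j, ∂_k)` at `x`, the trace of `X ↦ R(X, ∂_j) ∂_k`. -/
def ricci (j k : Fin m) (x : Euc m) : ℝ := ∑ i, riemannCoeff g i k i j x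

/-- The scalar curvature `k(x)` of `g` at `x`, the `g`-trace of the Ricci curvature. -/
def scalarCurvature (x : Euc m) : ℝ := ∑ j, ∑ k, (gram g x)⁻¹ j k * ricci g j k x

/-- The curve `γ` is a geodesic of `g` on the open set of times `s`, i.e.
`γ''^k + ∑_{i,j} Γ^k_{ij}(γ) γ'^i γ'^j = 0` there. -/
def IsGeodesicOn (γ : ℝ → Euc m) (s : Set ℝ) : Prop :=
  ∀ t ∈ s, DifferentiableAt ℝ γ t ∧
    HasDerivAt (deriv γ)
      (WithLp.toLp 2 fun k ↦
        -∑ i, ∑ j, christoffel g k i j (γ t) * deriv γ t i * deriv γ t j) t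

/-- `exp_x(v)` is defined and equal to `y`: the geodesic with initial point `x` and initial
velocity `v` exists up to time `1` and is then at `y`. -/
def IsExp (x v y : Euc m) : Prop :=
  ∃ (γ : ℝ → Euc m) (δ : ℝ), 0 < δ ∧ IsGeodesicOn g γ (Ioo (-δ) (1 + δ)) ∧
    γ 0 = x ∧ deriv γ 0 = v ∧ γ 1 = y

/-- The exponential map at `x` is defined on the open ball of radius `ε` about `0` in the tangent
space with the norm of `g`, and is a diffeomorphism from this ball onto an open set. -/
def ExpIsDiffeoOnBall (x : Euc m) (ε : ℝ) : Prop :=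
  ∃ Φ : OpenPartialHomeomorph (Euc m) (Euc m),
    Φ.source = {v | metricNorm g x v < ε} ∧
    ContDiffOn ℝ ∞ Φ Φ.source ∧ ContDiffOn ℝ ∞ Φ.symm Φ.target ∧
    ∀ v ∈ Φ.source, IsExp g x v (Φ v)

/-- Bounded geometry: the injectivity radius is bounded below by a positive number, and the
curvature tensor is bounded. -/
def HasBoundedGeometry : Prop :=
  (∃ ε : ℝ, 0 < ε ∧ ∀ x, ExpIsDiffeoOnBall g x ε) ∧
  ∃ C : ℝ, ∀ x u v w z : Euc m,
    |metricInner g x (curvature g x u v w) z|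
      ≤ C * metricNorm g x u * metricNorm g x v * metricNorm g x w * metricNorm g x z

end Curvature

section Coarse

/-- A control function: non-decreasing and tending to infinity. -/
def IsControlFunction (F : ℝ≥0 → ℝ≥0) : Prop :=
  Monotone F ∧ Tendsto F atTop atTop

/-- `X` is uniformly contractible with contractibility radius `R`. -/
def UniformlyContractibleWith (X : Type*) [MetricSpace X] (R : ℝ≥0 → ℝ≥0) : Prop :=
  Monotone R ∧ (∀ r, r ≤ R r) ∧
  ∀ (x : X) (r : ℝ≥0),
    ∃ H : C(Metric.closedBall x (r : ℝ) × unitInterval, Metric.closedBall x (R r : ℝ)),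
      ∀ y : Metric.closedBall x (r : ℝ), (H (y, 0) : X) = y ∧ (H (y, 1) : X) = x

/-- `X` is uniformly contractible. -/
def UniformlyContractible (X : Type*) [MetricSpace X] : Prop :=
  ∃ R : ℝ≥0 → ℝ≥0, UniformlyContractibleWith X R

/-- `X` has asymptotic dimension at most `n` with diameter control `D`: for each `r > 0` there is
a cover by sets of diameter at most `D r` such that each ball of radius `r` meets at most `n + 1`
members of the cover. -/
def AsdimLEWith (X : Type*) [MetricSpace X] (n : ℕ) (D : ℝ≥0 → ℝ≥0) : Prop :=
  Monotone D ∧ (∀ r, r ≤ D r) ∧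
  ∀ r : ℝ≥0, 0 < r → ∃ 𝒞 : Set (Set X), ⋃₀ 𝒞 = univ ∧
    (∀ U ∈ 𝒞, ∀ y ∈ U, ∀ z ∈ U, dist y z ≤ D r) ∧
    ∀ x : X, {U ∈ 𝒞 | (U ∩ Metric.closedBall x (r : ℝ)).Nonempty}.encard ≤ n + 1

end Coarse

end ScalarDecay

end

/-!
The metric is `e^{2ψ}` times the Euclidean one, where `ψ = h (log (1 + |x|²)) - ½ log (1 + |x|²)`.
Outside a compact set it looks like a cylinder whose cross sections are round spheres, the radius
`e^h` of which varies slowly. The scalar curvature is at least `e^{-2h}`, so it decays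
as slowly as desired if `h` tends to infinity slowly compared with `log G`.

Up to an additive constant independent of `h`, the distance is comparable with the one read off two
coordinates: the distance travelled along the axis, and the direction `x / √(1 + |x|²)` scaled by
the radius of the cross section. Balls of radius `r` centred where the cross sections are much
larger than `r` are almost flat, and the remaining ones lie in a compact set, so balls can be
contracted along straight segments of `ℝ^m`. The asymptotic dimension is bounded by colouring the
line periodically with gaps: with `m + 1` colours, each point has a colour for which all of its `m`
real coordinates are away from the gaps, and the coordinate boxes of one colour are separated. To
describe the cross sections by `m - 1` real coordinates and a sign, the round spheres are replaced
by octahedra.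

Since `ψ` has bounded derivatives at the scale `e^{-ψ}` of the metric, in rescaled coordinates the
geodesic equation is a uniformly small perturbation of `y'' = 0`. The exponential maps are therefore
uniformly small perturbations of the identity, hence injective on balls of a fixed radius.
-/

noncomputable section

namespace ScalarDecay

/-! ### Conformally flat metrics and their distance -/

section ConformallyFlat

variable {m : ℕ}

/-- The conformally flat metric `e^{2ψ} δ` on `ℝ^m`. -/
def conformalMetric (ψ : Euc m → ℝ) (hψ : ContDiff ℝ ∞ ψ) : SmoothMetric m where
  inner x := Real.exp (2 * ψ x) • (riemannianMetricVectorSpace (Euc m)).inner x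
  symm x v w :=
    congrArg (Real.exp (2 * ψ x) * ·) ((riemannianMetricVectorSpace (Euc m)).symm x v w)
  pos x v hv := mul_pos (Real.exp_pos _) ((riemannianMetricVectorSpace (Euc m)).pos x v hv)
  isVonNBounded x := by
    change Bornology.IsVonNBounded ℝ {v : Euc m | Real.exp (2 * ψ x) * inner ℝ v v < 1}
    refine (NormedSpace.isVonNBounded_ball ℝ (Euc m) (Real.exp (-ψ x))).subset fun v hv ↦ ?_
    have hv : (Real.exp (ψ x) * ‖v‖) ^ 2 < 1 := by
      rwa [mul_pow, ← Real.exp_nat_mul, ← real_inner_self_eq_norm_sq]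
    rw [mem_ball_zero_iff, Real.exp_neg, ← one_div, lt_div_iff₀' (Real.exp_pos _)]
    exact lt_of_pow_lt_pow_left₀ 2 zero_le_one (by rwa [one_pow])
  contMDiff := by
    have h : ContMDiff 𝓘(ℝ, Euc m) 𝓘(ℝ, ℝ) ∞ fun x ↦ Real.exp (2 * ψ x) := by
      rw [contMDiff_iff_contDiff]
      fun_prop
    have (x : Euc m) : ContinuousAdd (TangentSpace 𝓘(ℝ, Euc m) x →L[ℝ] ℝ) :=
      inferInstanceAs (ContinuousAdd (Euc m →L[ℝ] ℝ))
    exact h.smul_section ((riemannianMetricVectorSpace (Euc m)).contMDiff.of_le le_top)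

section Distance

open MeasureTheory

/-- The length of a path on `[a, b]` for a smooth metric. -/
def pathLength (g : SmoothMetric m) (γ : ℝ → Euc m) (a b : ℝ) : ENNReal :=
  ∫⁻ t in Icc a b, ENNReal.ofReal (metricNorm g (γ t) (deriv γ t))

theorem pathELength_eq_pathLength (g : SmoothMetric m) (γ : ℝ → Euc m) (a b : ℝ) :
    (letI : RiemannianBundle (fun x : Euc m ↦ TangentSpace 𝓘(ℝ, Euc m) x) :=
      ⟨g.toRiemannianMetric⟩
    Manifold.pathELength 𝓘(ℝ, Euc m) γ a b) = pathLength g γ a b := by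
  let : RiemannianBundle (fun x : Euc m ↦ TangentSpace 𝓘(ℝ, Euc m) x) :=
    ⟨g.toRiemannianMetric⟩
  have enorm_eq (x : Euc m) (v : TangentSpace 𝓘(ℝ, Euc m) x) :
      ‖v‖ₑ = ENNReal.ofReal (metricNorm g x v) := by
    rw [← ofReal_norm, norm_eq_sqrt_real_inner]
    rfl
  rw [Manifold.pathELength_eq_lintegral_mfderiv_Icc, pathLength]
  simp_rw [enorm_eq, mfderiv_eq_fderiv]
  rfl

/-- The Riemannian distance of `g`, as a function on `ℝ^m`. -/
def rdist (g : SmoothMetric m) (x y : Euc m) : ℝ := dist (α := RiemannianSpace g) x y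

theorem rdist_nonneg (g : SmoothMetric m) (x y : Euc m) : 0 ≤ rdist g x y :=
  dist_nonneg (α := RiemannianSpace g)

theorem rdist_comm (g : SmoothMetric m) (x y : Euc m) : rdist g x y = rdist g y x :=
  dist_comm (α := RiemannianSpace g) x y

theorem rdist_self (g : SmoothMetric m) (x : Euc m) : rdist g x x = 0 :=
  dist_self (α := RiemannianSpace g) x

theorem rdist_triangle (g : SmoothMetric m) (x y z : Euc m) :
    rdist g x z ≤ rdist g x y + rdist g y z :=
  dist_triangle (α := RiemannianSpace g) x y z

theorem ofReal_rdist (g : SmoothMetric m) (x y : Euc m) :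
    ENNReal.ofReal (rdist g x y) = edist (α := RiemannianSpace g) x y :=
  (edist_dist (α := RiemannianSpace g) x y).symm

theorem rdist_le_pathLength (g : SmoothMetric m) {γ : ℝ → Euc m} {a b : ℝ} (hab : a ≤ b)
    (hγ : ContDiffOn ℝ 1 γ (Icc a b)) :
    ENNReal.ofReal (rdist g (γ a) (γ b)) ≤ pathLength g γ a b := by
  rw [ofReal_rdist, ← pathELength_eq_pathLength]
  let : RiemannianBundle (fun x : Euc m ↦ TangentSpace 𝓘(ℝ, Euc m) x) :=
    ⟨g.toRiemannianMetric⟩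
  exact Manifold.riemannianEDist_le_pathELength (contMDiffOn_iff_contDiffOn.2 hγ) rfl rfl hab

theorem exists_pathLength_lt (g : SmoothMetric m) {x y : Euc m} {r : ENNReal}
    (hr : ENNReal.ofReal (rdist g x y) < r) :
    ∃ γ : ℝ → Euc m, γ 0 = x ∧ γ 1 = y ∧ ContDiff ℝ 1 γ ∧ pathLength g γ 0 1 < r := by
  let : RiemannianBundle (fun x : Euc m ↦ TangentSpace 𝓘(ℝ, Euc m) x) :=
    ⟨g.toRiemannianMetric⟩
  have hr' : Manifold.riemannianEDist 𝓘(ℝ, Euc m) x y < r := (ofReal_rdist g x y).symm.trans_lt hr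
  obtain ⟨γ, hγ0, hγ1, hγ, hlt, -, -⟩ :=
    Manifold.exists_lt_locally_constant_of_riemannianEDist_lt hr' zero_lt_one
  exact ⟨γ, hγ0, hγ1, contMDiff_iff_contDiff.1 hγ, by rwa [← pathELength_eq_pathLength]⟩

theorem rdist_le_sub_of_speed_le (g : SmoothMetric m) {γ : ℝ → Euc m} {σ σ' : ℝ → ℝ} {a b : ℝ}
    (hab : a ≤ b) (hγ : ContDiffOn ℝ 1 γ (Icc a b))
    (hσ : ∀ t ∈ Icc a b, HasDerivAt σ (σ' t) t) (hσ' : ContinuousOn σ' (Icc a b))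
    (hspeed : ∀ t ∈ Icc a b, metricNorm g (γ t) (deriv γ t) ≤ σ' t) :
    rdist g (γ a) (γ b) ≤ σ b - σ a := by
  have hσ'_nonneg : ∀ t ∈ Icc a b, 0 ≤ σ' t := fun t ht ↦ (Real.sqrt_nonneg _).trans (hspeed t ht)
  have hintegral : ∫ t in Icc a b, σ' t = σ b - σ a := by
    rw [integral_Icc_eq_integral_Ioc, ← intervalIntegral.integral_of_le hab]
    rw [← uIcc_of_le hab] at hσ hσ'
    exact intervalIntegral.integral_eq_sub_of_hasDerivAt hσ hσ'.intervalIntegrable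
  rw [← hintegral, ← ENNReal.ofReal_le_ofReal_iff (setIntegral_nonneg measurableSet_Icc hσ'_nonneg)]
  calc ENNReal.ofReal (rdist g (γ a) (γ b)) ≤ pathLength g γ a b := rdist_le_pathLength g hab hγ
    _ ≤ ∫⁻ t in Icc a b, ENNReal.ofReal (σ' t) :=
      setLIntegral_mono' measurableSet_Icc fun t ht ↦ ENNReal.ofReal_le_ofReal (hspeed t ht)
    _ = ENNReal.ofReal (∫ t in Icc a b, σ' t) :=
      (ofReal_integral_eq_lintegral_ofReal hσ'.integrableOn_Icc
        ((ae_restrict_iff' measurableSet_Icc).2 (Eventually.of_forall hσ'_nonneg))).symm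

section Lipschitz

variable {E : Type*} [NormedAddCommGroup E] [NormedSpace ℝ E] {p : Euc m → E} {K : ℝ}
  {g : SmoothMetric m}

theorem enorm_sub_le_mul_pathLength (hp : ContDiff ℝ 1 p) (hK : 0 ≤ K)
    (h : ∀ x v, ‖fderiv ℝ p x v‖ ≤ K * metricNorm g x v) {γ : ℝ → Euc m} (hγ : ContDiff ℝ 1 γ) :
    ‖p (γ 1) - p (γ 0)‖ₑ ≤ ENNReal.ofReal K * pathLength g γ 0 1 := by
  refine (enorm_sub_le_lintegral_deriv_of_contDiffOn_Icc (f := p ∘ γ)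
    (hp.comp hγ).contDiffOn zero_le_one).trans ?_
  rw [pathLength, ← lintegral_const_mul' _ _ ENNReal.ofReal_ne_top]
  refine lintegral_mono fun t ↦ ?_
  rw [← ENNReal.ofReal_mul hK, ← ofReal_norm, fderiv_comp_deriv _
    (hp.differentiable one_ne_zero _) (hγ.differentiable one_ne_zero _)]
  exact ENNReal.ofReal_le_ofReal (h _ _)

theorem norm_sub_le_mul_rdist (hp : ContDiff ℝ 1 p) (hK : 0 ≤ K)
    (h : ∀ x v, ‖fderiv ℝ p x v‖ ≤ K * metricNorm g x v) (x y : Euc m) :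
    ‖p x - p y‖ ≤ K * rdist g x y := by
  have le_mul_of_gt : ∀ r > rdist g x y, ‖p x - p y‖ ≤ K * r := by
    intro r hr
    have hr0 : 0 < r := (rdist_nonneg g x y).trans_lt hr
    obtain ⟨γ, rfl, rfl, hγ, hlt⟩ :=
      exists_pathLength_lt g ((ENNReal.ofReal_lt_ofReal_iff hr0).2 hr)
    rw [norm_sub_rev, ← ENNReal.ofReal_le_ofReal_iff (mul_nonneg hK hr0.le), ofReal_norm,
      ENNReal.ofReal_mul hK]
    exact (enorm_sub_le_mul_pathLength hp hK h hγ).trans (mul_le_mul_right hlt.le _)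
  have hlim : Tendsto (fun r ↦ K * r) (𝓝[>] rdist g x y) (𝓝 (K * rdist g x y)) :=
    ((continuous_const_mul K).tendsto _).mono_left nhdsWithin_le_nhds
  exact ge_of_tendsto hlim (eventually_nhdsWithin_of_forall le_mul_of_gt)

end Lipschitz

end Distance

section Conformal

variable {ψ : Euc m → ℝ} {hψ : ContDiff ℝ ∞ ψ}

theorem metricInner_conformal (x v w : Euc m) :
    metricInner (conformalMetric ψ hψ) x v w = Real.exp (2 * ψ x) * inner ℝ v w := rfl

theorem metricNorm_conformal (x v : Euc m) :
    metricNorm (conformalMetric ψ hψ) x v = Real.exp (ψ x) * ‖v‖ := by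
  rw [metricNorm, metricInner_conformal, real_inner_self_eq_norm_sq, ← Nat.cast_ofNat,
    Real.exp_nat_mul, ← mul_pow, Real.sqrt_sq (by positivity)]

theorem norm_sub_le_rdist_conformal {E : Type*} [NormedAddCommGroup E] [NormedSpace ℝ E]
    {p : Euc m → E} (hp : ContDiff ℝ 1 p) {K : ℝ} (hK : 0 ≤ K)
    (h : ∀ x, ‖fderiv ℝ p x‖ ≤ K * Real.exp (ψ x)) (x y : Euc m) :
    ‖p x - p y‖ ≤ K * rdist (conformalMetric ψ hψ) x y := by
  refine norm_sub_le_mul_rdist hp hK (fun z v ↦ ?_) x y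
  rw [metricNorm_conformal, ← mul_assoc]
  exact (fderiv ℝ p z).le_of_opNorm_le (h z) v

end Conformal

end ConformallyFlat

/-! ### Curvature of conformally flat metrics -/

section Curvature

variable {m : ℕ} {ψ : Euc m → ℝ} {hψ : ContDiff ℝ ∞ ψ}

/-- The Kronecker symbol `δ_{ij}`. -/
def kronecker (i j : Fin m) : ℝ := if i = j then 1 else 0

theorem abs_kronecker_le (i j : Fin m) : |kronecker i j| ≤ 1 := by
  unfold kronecker
  split_ifs <;> simp

theorem kronecker_comm (i j : Fin m) : kronecker i j = kronecker j i := by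
  simp only [kronecker, eq_comm]

theorem kronecker_self (i : Fin m) : kronecker i i = 1 := if_pos rfl

theorem sum_kronecker_mul (i : Fin m) (f : Fin m → ℝ) : ∑ j, kronecker i j * f j = f i := by
  simp [kronecker]

theorem sum_kronecker_self : ∑ i : Fin m, kronecker i i = m := by
  simp [kronecker_self]

theorem gram_conformal (x : Euc m) :
    gram (conformalMetric ψ hψ) x = Real.exp (2 * ψ x) • (1 : Matrix (Fin m) (Fin m) ℝ) := by
  ext i j
  simp [gram, metricInner_conformal, Matrix.one_apply, EuclideanSpace.inner_single_left,
    PiLp.single_apply]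

theorem gram_conformal_apply (x : Euc m) (i j : Fin m) :
    gram (conformalMetric ψ hψ) x i j = Real.exp (2 * ψ x) * kronecker i j := by
  rw [gram_conformal, Matrix.smul_apply, Matrix.one_apply, kronecker, smul_eq_mul]

theorem gram_conformal_inv_apply (x : Euc m) (i j : Fin m) :
    (gram (conformalMetric ψ hψ) x)⁻¹ i j = Real.exp (-(2 * ψ x)) * kronecker i j := by
  have hinv : (gram (conformalMetric ψ hψ) x)⁻¹ =
      Real.exp (-(2 * ψ x)) • (1 : Matrix (Fin m) (Fin m) ℝ) := by
    refine Matrix.inv_eq_left_inv ?_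
    rw [gram_conformal, smul_mul_smul_comm, ← Real.exp_add, neg_add_cancel, Real.exp_zero,
      one_smul, one_mul]
  rw [hinv, Matrix.smul_apply, Matrix.one_apply, kronecker, smul_eq_mul]

theorem contDiff_partialDeriv {f : Euc m → ℝ} (hf : ContDiff ℝ ∞ f) (i : Fin m) :
    ContDiff ℝ ∞ (partialDeriv i f) :=
  (hf.fderiv_right (m := ∞) le_rfl).clm_apply contDiff_const

theorem partialDeriv_partialDeriv {f : Euc m → ℝ} (hf : ContDiff ℝ ∞ f) (x : Euc m)
    (i j : Fin m) :
    partialDeriv i (partialDeriv j f) x = fderiv ℝ (fderiv ℝ f) x (EuclideanSpace.single i 1)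
      (EuclideanSpace.single j 1) := by
  have hd : DifferentiableAt ℝ (fderiv ℝ f) x :=
    (hf.fderiv_right (m := ∞) le_rfl).differentiable (by simp) x
  change fderiv ℝ (fun y ↦ fderiv ℝ f y (EuclideanSpace.single j 1)) x _ = _
  rw [fderiv_clm_apply hd (differentiableAt_const _)]
  simp

theorem partialDeriv_comm {f : Euc m → ℝ} (hf : ContDiff ℝ ∞ f) (x : Euc m) (i j : Fin m) :
    partialDeriv i (partialDeriv j f) x = partialDeriv j (partialDeriv i f) x := by
  rw [partialDeriv_partialDeriv hf, partialDeriv_partialDeriv hf]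
  exact (hf.contDiffAt.isSymmSndFDerivAt (by simp [ENat.LEInfty.out])) _ _

theorem partialDeriv_gram_conformal (x : Euc m) (i j k : Fin m) :
    partialDeriv i (fun y ↦ gram (conformalMetric ψ hψ) y j k) x =
      Real.exp (2 * ψ x) * (2 * partialDeriv i ψ x * kronecker j k) := by
  have hd : HasFDerivAt ψ (fderiv ℝ ψ x) x := (hψ.differentiable (by simp) x).hasFDerivAt
  simp only [gram_conformal_apply, partialDeriv,
    ((hd.const_mul 2).exp.mul_const (kronecker j k)).fderiv, smul_apply, smul_eq_mul]
  ring

theorem christoffel_conformal (k i j : Fin m) (x : Euc m) :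
    christoffel (conformalMetric ψ hψ) k i j x =
      kronecker k j * partialDeriv i ψ x + kronecker k i * partialDeriv j ψ x
        - kronecker i j * partialDeriv k ψ x := by
  have hexp : Real.exp (-(2 * ψ x)) * Real.exp (2 * ψ x) = 1 := by
    rw [← Real.exp_add, neg_add_cancel, Real.exp_zero]
  have hterm (l : Fin m) : Real.exp (-(2 * ψ x)) * kronecker k l *
      (Real.exp (2 * ψ x) * (2 * partialDeriv i ψ x * kronecker j l) +
        Real.exp (2 * ψ x) * (2 * partialDeriv j ψ x * kronecker i l) -
        Real.exp (2 * ψ x) * (2 * partialDeriv l ψ x * kronecker i j)) =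
      kronecker k l * (2 * partialDeriv i ψ x * kronecker j l +
        2 * partialDeriv j ψ x * kronecker i l - 2 * partialDeriv l ψ x * kronecker i j) := by
    linear_combination kronecker k l * (2 * partialDeriv i ψ x * kronecker j l +
        2 * partialDeriv j ψ x * kronecker i l - 2 * partialDeriv l ψ x * kronecker i j) * hexp
  simp only [christoffel, gram_conformal_inv_apply, partialDeriv_gram_conformal, hterm,
    sum_kronecker_mul]
  rw [kronecker_comm j k, kronecker_comm i k]
  ring

theorem partialDeriv_christoffel_conformal (p k i j : Fin m) (x : Euc m) :
    partialDeriv p (christoffel (conformalMetric ψ hψ) k i j) x =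
      kronecker k j * partialDeriv p (partialDeriv i ψ) x
        + kronecker k i * partialDeriv p (partialDeriv j ψ) x
        - kronecker i j * partialDeriv p (partialDeriv k ψ) x := by
  have hd (i : Fin m) : HasFDerivAt (partialDeriv i ψ) (fderiv ℝ (partialDeriv i ψ) x) x :=
    ((contDiff_partialDeriv hψ i).differentiable (by simp) x).hasFDerivAt
  have hchristoffel := (((hd i).const_mul (kronecker k j)).fun_add
    ((hd j).const_mul (kronecker k i))).fun_sub ((hd k).const_mul (kronecker i j))
  rw [funext fun y ↦ christoffel_conformal (hψ := hψ) k i j y, partialDeriv, hchristoffel.fderiv]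
  rfl

/-- The symmetric tensor `∇²ψ - dψ ⊗ dψ`, in coordinates, through which the curvature of `e^{2ψ} δ`
is expressed. -/
def conformalHessian (ψ : Euc m → ℝ) (i j : Fin m) (x : Euc m) : ℝ :=
  partialDeriv i (partialDeriv j ψ) x - partialDeriv i ψ x * partialDeriv j ψ x

/-- The Kulkarni–Nomizu form of the curvature of a conformally flat metric. -/
theorem riemannCoeff_conformal (l k i j : Fin m) (x : Euc m) :
    riemannCoeff (conformalMetric ψ hψ) l k i j x =
      kronecker l j * conformalHessian ψ i k x - kronecker l i * conformalHessian ψ j k x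
        + kronecker k i * conformalHessian ψ j l x - kronecker k j * conformalHessian ψ i l x
        + (kronecker l j * kronecker k i - kronecker l i * kronecker k j)
          * ∑ p, partialDeriv p ψ x ^ 2 := by
  have hprod (i j : Fin m) : ∑ p, christoffel (conformalMetric ψ hψ) l i p x *
        christoffel (conformalMetric ψ hψ) p j k x =
      kronecker k l * partialDeriv i ψ x * partialDeriv j ψ x
        + kronecker l j * partialDeriv i ψ x * partialDeriv k ψ x
        + 2 * kronecker l i * partialDeriv j ψ x * partialDeriv k ψ x
        - kronecker k i * partialDeriv j ψ x * partialDeriv l ψ x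
        - kronecker i j * partialDeriv k ψ x * partialDeriv l ψ x
        - kronecker l i * kronecker k j * ∑ p, partialDeriv p ψ x ^ 2 := by
    have hterm (p : Fin m) : christoffel (conformalMetric ψ hψ) l i p x *
          christoffel (conformalMetric ψ hψ) p j k x =
        kronecker l p * (partialDeriv i ψ x * (kronecker k p * partialDeriv j ψ x
            + kronecker j p * partialDeriv k ψ x - kronecker k j * partialDeriv p ψ x))
          - kronecker i p * (partialDeriv l ψ x * (kronecker k p * partialDeriv j ψ x
            + kronecker j p * partialDeriv k ψ x - kronecker k j * partialDeriv p ψ x))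
          + kronecker k p * (kronecker l i * partialDeriv j ψ x * partialDeriv p ψ x)
          + kronecker j p * (kronecker l i * partialDeriv k ψ x * partialDeriv p ψ x)
          - kronecker l i * kronecker k j * partialDeriv p ψ x ^ 2 := by
      rw [christoffel_conformal, christoffel_conformal, kronecker_comm p k, kronecker_comm p j,
        kronecker_comm j k]
      ring
    simp only [hterm, Finset.sum_add_distrib, Finset.sum_sub_distrib, sum_kronecker_mul,
      ← Finset.mul_sum]
    rw [kronecker_comm j l, kronecker_comm j i]
    ring
  rw [riemannCoeff, Finset.sum_sub_distrib, hprod i j, hprod j i,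
    partialDeriv_christoffel_conformal, partialDeriv_christoffel_conformal,
    partialDeriv_comm hψ x j i]
  simp only [conformalHessian, kronecker_comm j i, kronecker_comm j k, kronecker_comm i k]
  ring

theorem ricci_conformal (j k : Fin m) (x : Euc m) :
    ricci (conformalMetric ψ hψ) j k x = -((m - 2) * conformalHessian ψ j k x) - kronecker k j *
      (∑ i, partialDeriv i (partialDeriv i ψ) x + (m - 2) * ∑ i, partialDeriv i ψ x ^ 2) := by
  have hterm (i : Fin m) : riemannCoeff (conformalMetric ψ hψ) i k i j x =
      kronecker j i * conformalHessian ψ i k x - kronecker i i * conformalHessian ψ j k x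
        + kronecker k i * conformalHessian ψ j i x
        - kronecker k j * (partialDeriv i (partialDeriv i ψ) x - partialDeriv i ψ x ^ 2)
        + (kronecker j i * kronecker k i - kronecker i i * kronecker k j)
          * ∑ p, partialDeriv p ψ x ^ 2 := by
    rw [riemannCoeff_conformal, kronecker_comm i j, conformalHessian.eq_def ψ i i, sq]
  simp only [ricci, hterm, Finset.sum_add_distrib, Finset.sum_sub_distrib, ← Finset.mul_sum,
    ← Finset.sum_mul, sum_kronecker_mul, sum_kronecker_self]
  ring

theorem scalarCurvature_conformal (x : Euc m) :
    scalarCurvature (conformalMetric ψ hψ) x = -Real.exp (-(2 * ψ x)) *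
      (2 * (m - 1) * ∑ i, partialDeriv i (partialDeriv i ψ) x
        + (m - 1) * (m - 2) * ∑ i, partialDeriv i ψ x ^ 2) := by
  have hricci (j : Fin m) : ricci (conformalMetric ψ hψ) j j x =
      -((m - 2) * (partialDeriv j (partialDeriv j ψ) x - partialDeriv j ψ x ^ 2)) -
        (∑ i, partialDeriv i (partialDeriv i ψ) x + (m - 2) * ∑ i, partialDeriv i ψ x ^ 2) := by
    rw [ricci_conformal, kronecker_self, one_mul, conformalHessian, sq]
  simp only [scalarCurvature, gram_conformal_inv_apply, mul_assoc, ← Finset.mul_sum,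
    sum_kronecker_mul, hricci, Finset.sum_sub_distrib, Finset.sum_neg_distrib, Finset.sum_const,
    Finset.card_univ, Fintype.card_fin, nsmul_eq_mul]
  ring

theorem abs_kronecker_mul_le (i j : Fin m) (t : ℝ) : |kronecker i j * t| ≤ |t| := by
  rw [abs_mul]
  exact mul_le_of_le_one_left (abs_nonneg t) (abs_kronecker_le i j)

theorem abs_riemannCoeff_conformal_le {x : Euc m} {β : ℝ}
    (h : ∀ i j, |conformalHessian ψ i j x| ≤ β) (l k i j : Fin m) :
    |riemannCoeff (conformalMetric ψ hψ) l k i j x| ≤ 4 * β + 2 * ∑ p, partialDeriv p ψ x ^ 2 := by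
  have hN : 0 ≤ ∑ p, partialDeriv p ψ x ^ 2 := Finset.sum_nonneg fun _ _ ↦ sq_nonneg _
  have hT (a b i j : Fin m) : |kronecker a b * conformalHessian ψ i j x| ≤ β :=
    (abs_kronecker_mul_le a b _).trans (h i j)
  have hK (a b c d : Fin m) : |kronecker a b * (kronecker c d * ∑ p, partialDeriv p ψ x ^ 2)| ≤
      ∑ p, partialDeriv p ψ x ^ 2 :=
    (abs_kronecker_mul_le a b _).trans ((abs_kronecker_mul_le c d _).trans (abs_of_nonneg hN).le)
  rw [riemannCoeff_conformal, sub_mul, mul_assoc, mul_assoc, abs_le]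
  constructor <;> linarith [abs_le.1 (hT l j i k), abs_le.1 (hT l i j k), abs_le.1 (hT k i j l),
    abs_le.1 (hT k j i l), abs_le.1 (hK l j k i), abs_le.1 (hK l i k j)]

theorem abs_sum_le_mul_of_forall_le {f : Fin m → ℝ} {B : ℝ} (h : ∀ i, |f i| ≤ B) :
    |∑ i, f i| ≤ m * B :=
  (Finset.abs_sum_le_sum_abs _ _).trans
    ((Finset.sum_le_card_nsmul _ _ B fun i _ ↦ h i).trans (by simp))

theorem abs_coord_le_norm (v : Euc m) (i : Fin m) : |v i| ≤ ‖v‖ := PiLp.norm_apply_le v i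

theorem abs_curvature_apply_le {g : SmoothMetric m} {x : Euc m} {M : ℝ}
    (hM : ∀ l k i j, |riemannCoeff g l k i j x| ≤ M) (u v w : Euc m) (l : Fin m) :
    |curvature g x u v w l| ≤ m ^ 3 * (M * ‖u‖ * ‖v‖ * ‖w‖) := by
  have hterm (i j k : Fin m) : |riemannCoeff g l k i j x * u i * v j * w k| ≤
      M * ‖u‖ * ‖v‖ * ‖w‖ := by
    have hM0 : 0 ≤ M := (abs_nonneg _).trans (hM l l l l)
    rw [abs_mul, abs_mul, abs_mul]
    gcongr
    exacts [hM l k i j, abs_coord_le_norm u i, abs_coord_le_norm v j, abs_coord_le_norm w k]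
  refine (abs_sum_le_mul_of_forall_le fun i ↦ abs_sum_le_mul_of_forall_le fun j ↦
    abs_sum_le_mul_of_forall_le fun k ↦ hterm i j k).trans_eq ?_
  ring

theorem abs_metricInner_curvature_conformal_le {x : Euc m} {M : ℝ}
    (hM : ∀ l k i j, |riemannCoeff (conformalMetric ψ hψ) l k i j x| ≤ M) (u v w z : Euc m) :
    |metricInner (conformalMetric ψ hψ) x (curvature (conformalMetric ψ hψ) x u v w) z|
      ≤ (m ^ 4 * (M * Real.exp (-(2 * ψ x)))) * metricNorm (conformalMetric ψ hψ) x u *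
        metricNorm (conformalMetric ψ hψ) x v * metricNorm (conformalMetric ψ hψ) x w *
        metricNorm (conformalMetric ψ hψ) x z := by
  have hinner : |inner ℝ (curvature (conformalMetric ψ hψ) x u v w) z| ≤
      m * (m ^ 3 * (M * ‖u‖ * ‖v‖ * ‖w‖) * ‖z‖) := by
    rw [PiLp.inner_apply]
    refine abs_sum_le_mul_of_forall_le fun l ↦ ?_
    rw [RCLike.inner_apply', conj_trivial, abs_mul]
    gcongr
    exacts [(abs_nonneg _).trans (abs_curvature_apply_le hM u v w l),
      abs_curvature_apply_le hM u v w l, abs_coord_le_norm z l]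
  have hexp : Real.exp (2 * ψ x) = Real.exp (ψ x) ^ 2 := by rw [two_mul, Real.exp_add, sq]
  rw [metricInner_conformal, abs_mul, Real.abs_exp, Real.exp_neg, hexp]
  simp only [metricNorm_conformal]
  refine (mul_le_mul_of_nonneg_left hinner (by positivity)).trans_eq ?_
  field_simp

end Curvature

/-! ### Superposition operators -/

section Superposition

universe u

variable {K : Type*} [TopologicalSpace K] [CompactSpace K]
  {A B : Type u} [NormedAddCommGroup A] [NormedSpace ℝ A] [NormedAddCommGroup B] [NormedSpace ℝ B]

-- A shortcut: the default search for this instance is too slow.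
instance : NormedAddCommGroup C(K, A →L[ℝ] B) := ContinuousMap.instNormedAddCommGroup

variable (K A B) in
/-- The pointwise evaluation `(L, η) ↦ (t ↦ L t (η t))` of a family of linear maps at a family of
vectors; it carries the derivative of a superposition operator. -/
def pointwiseApply : C(K, A →L[ℝ] B) →L[ℝ] C(K, A) →L[ℝ] C(K, B) :=
  LinearMap.mkContinuous₂
    (LinearMap.mk₂ ℝ (fun (L : C(K, A →L[ℝ] B)) (η : C(K, A)) ↦
        (⟨fun t ↦ L t (η t), L.continuous.clm_apply η.continuous⟩ : C(K, B)))
      (fun _ _ _ ↦ by ext; simp) (fun _ _ _ ↦ by ext; simp)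
      (fun _ _ _ ↦ by ext; simp) (fun _ _ _ ↦ by ext; simp)) 1
    (fun L η ↦ by
      rw [ContinuousMap.norm_le _ (by positivity), one_mul]
      exact fun t ↦ (L t).le_of_opNorm_le_of_le (L.norm_coe_le_norm t) (η.norm_coe_le_norm t))

theorem hasFDerivAt_postcomp {f : C(A, B)} {f' : C(A, A →L[ℝ] B)}
    (hf : ∀ x, HasFDerivAt f (f' x) x) (γ : C(K, A)) :
    HasFDerivAt (f.comp : C(K, A) → C(K, B)) (pointwiseApply K A B (f'.comp γ)) γ := by
  refine HasFDerivAt.of_isLittleO (Asymptotics.isLittleO_iff.2 fun c hc ↦ ?_)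
  obtain ⟨δ, hδ, hf'γ⟩ := Metric.continuousAt_iff.1 (f'.continuous_postcomp.continuousAt (x := γ))
    c hc
  filter_upwards [Metric.ball_mem_nhds γ hδ] with γ' hγ'
  rw [ContinuousMap.norm_le _ (by positivity)]
  intro t
  have hγt : ‖γ' t - γ t‖ ≤ ‖γ' - γ‖ := (γ' - γ).norm_coe_le_norm t
  -- Translating `γ` by a constant turns continuity of `f'.comp` into a bound on a ball of `A`.
  have hball : ∀ z ∈ Metric.closedBall (γ t) ‖γ' - γ‖, ‖f' z - f' (γ t)‖ ≤ c := by
    intro z hz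
    have hshift : dist (γ + ContinuousMap.const K (z - γ t)) γ < δ := by
      rw [dist_eq_norm, add_sub_cancel_left]
      refine ((ContinuousMap.norm_le _ (norm_nonneg _)).2 fun _ ↦ ?_).trans_lt
        (mem_ball_iff_norm.1 hγ')
      exact mem_closedBall_iff_norm.1 hz
    have ht := (ContinuousMap.dist_apply_le_dist t).trans (hf'γ hshift).le
    simpa [dist_eq_norm] using ht
  refine LE.le.trans ?_ (mul_le_mul_of_nonneg_left hγt hc.le)
  exact (convex_closedBall _ _).norm_image_sub_le_of_norm_hasFDerivWithin_le'
    (fun z _ ↦ (hf z).hasFDerivWithinAt) hball (Metric.mem_closedBall_self (norm_nonneg _))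
    (mem_closedBall_iff_norm.2 hγt)

theorem contDiff_postcomp {n : ℕ∞} {f : C(A, B)} (hf : ContDiff ℝ n f) :
    ContDiff ℝ n (f.comp : C(K, A) → C(K, B)) := by
  rw [contDiff_iff_forall_nat_le]
  intro k hk
  replace hf := hf.of_le (mod_cast hk : (k : WithTop ℕ∞) ≤ n)
  clear hk
  induction k generalizing B with
  | zero => exact contDiff_zero.2 f.continuous_postcomp
  | succ k ih =>
    obtain ⟨f', hf', hff'⟩ := contDiff_succ_iff_hasFDerivAt.1 hf
    exact contDiff_succ_iff_hasFDerivAt.2 ⟨_, (pointwiseApply K A B).contDiff.comp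
      (ih (f := ⟨f', hf'.continuous⟩) hf'), hasFDerivAt_postcomp hff'⟩

end Superposition

theorem lipschitzWith_postcomp {K : Type*} [TopologicalSpace K] [CompactSpace K]
    {X Y : Type*} [PseudoMetricSpace X] [PseudoMetricSpace Y] {f : C(X, Y)} {q : ℝ≥0}
    (hf : LipschitzWith q f) :
    LipschitzWith q (f.comp : C(K, X) → C(K, Y)) :=
  LipschitzWith.of_dist_le_mul fun γ γ' ↦ (ContinuousMap.dist_le (by positivity)).2 fun t ↦
    (hf.dist_le_mul _ _).trans (by gcongr; exact ContinuousMap.dist_apply_le_dist t)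

theorem exists_homeomorph_id_add {V : Type*} [NormedAddCommGroup V] [NormedSpace ℝ V]
    [CompleteSpace V] {P : V → V} (hP : ContDiff ℝ ∞ P) {c : ℝ≥0} (hc : c < 1)
    (hL : LipschitzWith c P) :
    ∃ e : V ≃ₜ V, (∀ x, e x = x + P x) ∧ ContDiff ℝ ∞ e.symm := by
  have happrox : ApproximatesLinearOn (fun x ↦ x + P x)
      (ContinuousLinearEquiv.refl ℝ V : V →L[ℝ] V) univ c := by
    refine LipschitzOnWith.approximatesLinearOn (lipschitzOnWith_univ.2 ?_)
    convert hL using 1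
    ext x
    simp
  have hsmall : Subsingleton V ∨
      c < ‖((ContinuousLinearEquiv.refl ℝ V).symm : V →L[ℝ] V)‖₊⁻¹ := by
    refine (subsingleton_or_nontrivial V).imp_right fun hV ↦ ?_
    have := EMetric.nontrivial_iff_nontrivialTopology.1 hV
    have hid : ‖ContinuousLinearMap.id ℝ V‖₊ = 1 := NNReal.eq ContinuousLinearMap.norm_id
    simpa [hid] using hc
  have hderiv (a : V) : ∃ L : V ≃L[ℝ] V,
      HasFDerivAt (fun x ↦ x + P x) (L : V →L[ℝ] V) a := by
    have hn : ‖-fderiv ℝ P a‖ < 1 := by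
      rw [norm_neg]
      exact (norm_fderiv_le_of_lipschitz ℝ hL).trans_lt (by exact_mod_cast hc)
    refine ⟨ContinuousLinearEquiv.ofUnit (Units.oneSub _ hn), ?_⟩
    have hcoe : (ContinuousLinearEquiv.ofUnit (Units.oneSub _ hn) : V →L[ℝ] V) =
        ContinuousLinearMap.id ℝ V + fderiv ℝ P a := sub_neg_eq_add _ _
    rw [hcoe]
    exact (hasFDerivAt_id a).add (hP.differentiable (by simp) a).hasFDerivAt
  choose L hL' using hderiv
  let e : V ≃ₜ V := happrox.toHomeomorph _ hsmall
  exact ⟨e, fun _ ↦ rfl, e.contDiff_symm hL' (contDiff_id.add hP)⟩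

/-! ### Second order equations over a fixed time interval -/

section Integration

universe u

variable {E : Type u} [NormedAddCommGroup E]

/-- The time interval `[-1, 2]`, a compact neighbourhood of the interval `[0, 1]` on which the
geodesics defining the exponential map are followed. -/
abbrev TimeInterval : Type := Icc (-1 : ℝ) 2

/-- The extension of a function on `[-1, 2]` that is constant on the two sides. -/
def extendTime (u : C(TimeInterval, E)) (t : ℝ) : E := u (projIcc (-1) 2 (by norm_num) t)

theorem extendTime_of_mem (u : C(TimeInterval, E)) {t : ℝ} (ht : t ∈ Icc (-1 : ℝ) 2) :
    extendTime u t = u ⟨t, ht⟩ := by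
  rw [extendTime, projIcc_of_mem _ ht]

theorem continuous_extendTime (u : C(TimeInterval, E)) : Continuous (extendTime u) :=
  u.continuous.comp continuous_projIcc

theorem norm_extendTime_le (u : C(TimeInterval, E)) (t : ℝ) : ‖extendTime u t‖ ≤ ‖u‖ :=
  u.norm_coe_le_norm _

variable [NormedSpace ℝ E]

theorem norm_integral_extendTime_le (u : C(TimeInterval, E)) (t : TimeInterval) :
    ‖∫ s in (0 : ℝ)..t, extendTime u s‖ ≤ 2 * ‖u‖ := by
  refine (intervalIntegral.norm_integral_le_of_norm_le_const
    (fun s _ ↦ norm_extendTime_le u s)).trans ?_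
  have ht : |(t : ℝ) - 0| ≤ 2 := abs_le.2 ⟨by linarith [t.2.1], by linarith [t.2.2]⟩
  rw [mul_comm]
  gcongr

variable [CompleteSpace E]

theorem hasDerivAt_integral_extendTime (u : C(TimeInterval, E)) (t : ℝ) :
    HasDerivAt (fun t ↦ ∫ s in (0 : ℝ)..t, extendTime u s) (extendTime u t) t :=
  ((continuous_extendTime u).integral_hasStrictDerivAt 0 t).hasDerivAt

variable (E) in
/-- The operator `u ↦ (t ↦ ∫₀ᵗ u)` on `C([-1, 2], E)`. -/
def integrateTime : C(TimeInterval, E) →L[ℝ] C(TimeInterval, E) :=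
  LinearMap.mkContinuous
    { toFun := fun u ↦ ⟨fun t ↦ ∫ s in (0 : ℝ)..t, extendTime u s,
        (continuous_iff_continuousAt.2 fun t ↦
          (hasDerivAt_integral_extendTime u t).continuousAt).comp continuous_subtype_val⟩
      map_add' := fun u v ↦ by
        ext t
        exact intervalIntegral.integral_add ((continuous_extendTime u).intervalIntegrable _ _)
          ((continuous_extendTime v).intervalIntegrable _ _)
      map_smul' := fun c u ↦ by
        ext t
        exact intervalIntegral.integral_smul c (extendTime u) } 2
    (fun u ↦ (ContinuousMap.norm_le _ (by positivity)).2 (norm_integral_extendTime_le u))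

theorem integrateTime_apply (u : C(TimeInterval, E)) (t : TimeInterval) :
    integrateTime E u t = ∫ s in (0 : ℝ)..t, extendTime u s := rfl

theorem norm_integrateTime_le (u : C(TimeInterval, E)) : ‖integrateTime E u‖ ≤ 2 * ‖u‖ :=
  (ContinuousMap.norm_le _ (by positivity)).2 (norm_integral_extendTime_le u)

theorem lipschitzWith_integrateTime : LipschitzWith 2 (integrateTime E) :=
  AddMonoidHomClass.lipschitz_of_bound_nnnorm (integrateTime E) 2 norm_integrateTime_le

theorem norm_integrateTime_prodMk_le (u : C(TimeInterval, E)) :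
    ‖(integrateTime E u).prodMk u‖ ≤ 2 * ‖u‖ :=
  (ContinuousMap.norm_le _ (by positivity)).2 fun t ↦
    max_le (norm_integral_extendTime_le u t)
      ((u.norm_coe_le_norm t).trans (by linarith [norm_nonneg u]))

variable (E) in
/-- The map sending a velocity curve to the pair of its position and velocity curves. -/
def phaseCurve : C(TimeInterval, E) →L[ℝ] C(TimeInterval, E × E) :=
  LinearMap.mkContinuous
    { toFun := fun u ↦ (integrateTime E u).prodMk u
      map_add' := fun u v ↦ by ext t <;> simp
      map_smul' := fun c u ↦ by ext t <;> simp } 2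
    norm_integrateTime_prodMk_le

theorem lipschitzWith_phaseCurve : LipschitzWith 2 (phaseCurve E) :=
  AddMonoidHomClass.lipschitz_of_bound_nnnorm (phaseCurve E) 2 norm_integrateTime_prodMk_le

/-- The impulse `t ↦ ∫₀ᵗ Q(y, u)` of the force `Q` along the curve with velocity `u` and position
`y = ∫₀ u`. The velocities of the solutions of `y'' = -Q(y, y')`, `y(0) = 0`, `y'(0) = ν` are the
solutions of `u + impulse Q u = ν`. -/
def impulse (Q : C(E × E, E)) (u : C(TimeInterval, E)) : C(TimeInterval, E) :=
  integrateTime E (Q.comp (phaseCurve E u))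

variable {Q : C(E × E, E)} {u : C(TimeInterval, E)} {ν : E} {M : ℝ}

theorem contDiff_impulse (hQ : ContDiff ℝ ∞ Q) : ContDiff ℝ ∞ (impulse Q) :=
  (integrateTime E).contDiff.comp ((contDiff_postcomp hQ).comp (phaseCurve E).contDiff)

theorem lipschitzWith_impulse {q : ℝ≥0} (hQ : LipschitzWith q Q) :
    LipschitzWith (2 * (q * 2)) (impulse Q) :=
  lipschitzWith_integrateTime.comp ((lipschitzWith_postcomp hQ).comp lipschitzWith_phaseCurve)

theorem norm_impulse_le (hM : ∀ z, ‖Q z‖ ≤ M) (u : C(TimeInterval, E)) :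
    ‖impulse Q u‖ ≤ 2 * M := by
  refine (norm_integrateTime_le _).trans (mul_le_mul_of_nonneg_left ?_ zero_le_two)
  exact (ContinuousMap.norm_le _ ((norm_nonneg _).trans (hM 0))).2 fun t ↦ hM _

theorem norm_le_of_add_impulse_eq (hM : ∀ z, ‖Q z‖ ≤ M)
    (hu : u + impulse Q u = ContinuousMap.const _ ν) : ‖u‖ ≤ ‖ν‖ + 2 * M := by
  have hν : ‖ContinuousMap.const TimeInterval ν‖ ≤ ‖ν‖ :=
    (ContinuousMap.norm_le _ (norm_nonneg _)).2 fun _ ↦ le_rfl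
  rw [eq_sub_of_add_eq hu]
  exact (norm_sub_le _ _).trans (add_le_add hν (norm_impulse_le hM u))

theorem extendTime_zero_of_add_impulse_eq (hu : u + impulse Q u = ContinuousMap.const _ ν) :
    extendTime u 0 = ν := by
  have hmem : (0 : ℝ) ∈ Icc (-1 : ℝ) 2 := by norm_num
  have h0 := DFunLike.congr_fun hu ⟨0, hmem⟩
  rwa [ContinuousMap.add_apply, impulse, integrateTime_apply, intervalIntegral.integral_same,
    add_zero, ← extendTime_of_mem u hmem, ContinuousMap.const_apply] at h0

theorem hasDerivAt_extendTime_of_add_impulse_eq (hu : u + impulse Q u = ContinuousMap.const _ ν)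
    {t : ℝ} (ht : t ∈ Ioo (-1 : ℝ) 2) :
    HasDerivAt (extendTime u) (-Q (∫ s in (0 : ℝ)..t, extendTime u s, extendTime u t)) t := by
  have hQ : extendTime (Q.comp (phaseCurve E u)) t =
      Q (∫ s in (0 : ℝ)..t, extendTime u s, extendTime u t) := by
    rw [extendTime_of_mem _ (Ioo_subset_Icc_self ht), extendTime_of_mem _ (Ioo_subset_Icc_self ht)]
    rfl
  rw [← hQ]
  refine ((hasDerivAt_integral_extendTime (Q.comp (phaseCurve E u)) t).const_sub
    ν).congr_of_eventuallyEq ?_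
  filter_upwards [Ioo_mem_nhds ht.1 ht.2] with s hs
  rw [extendTime_of_mem _ (Ioo_subset_Icc_self hs)]
  exact eq_sub_of_add_eq (DFunLike.congr_fun hu ⟨s, Ioo_subset_Icc_self hs⟩)

theorem exists_velocity_operator (hQ : ContDiff ℝ ∞ Q) (hL : LipschitzWith (1 / 16) Q) :
    ∃ U : E → C(TimeInterval, E), ContDiff ℝ ∞ U ∧ LipschitzWith (4 / 3) U ∧
      ∀ ν, U ν + impulse Q (U ν) = ContinuousMap.const _ ν := by
  have hP : LipschitzWith (1 / 4) (impulse Q) := by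
    convert lipschitzWith_impulse hL using 1
    rw [← NNReal.coe_inj]
    norm_num
  obtain ⟨e, he, hsymm⟩ := exists_homeomorph_id_add (contDiff_impulse hQ)
    (by rw [← NNReal.coe_lt_coe]; norm_num) hP
  let U : E → C(TimeInterval, E) := fun ν ↦ e.symm (ContinuousLinearMap.const ℝ TimeInterval ν)
  have hU (ν : E) : U ν + impulse Q (U ν) = ContinuousMap.const _ ν :=
    (he (U ν)).symm.trans (e.apply_symm_apply _)
  refine ⟨U, hsymm.comp (ContinuousLinearMap.contDiff _), LipschitzWith.of_dist_le_mul
    fun ν ν' ↦ ?_, hU⟩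
  have hconst : dist (U ν + impulse Q (U ν)) (U ν' + impulse Q (U ν')) ≤ dist ν ν' := by
    rw [hU, hU]
    exact (ContinuousMap.dist_le dist_nonneg).2 fun _ ↦ le_rfl
  have hPU := hP.dist_le_mul (U ν) (U ν')
  have htri := norm_sub_le (U ν + impulse Q (U ν) - (U ν' + impulse Q (U ν')))
    (impulse Q (U ν) - impulse Q (U ν'))
  rw [add_sub_add_comm, add_sub_cancel_right, ← add_sub_add_comm] at htri
  simp only [dist_eq_norm, NNReal.coe_div, NNReal.coe_ofNat, NNReal.coe_one] at hconst hPU ⊢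
  linarith

theorem integral_extendTime_of_add_impulse_eq (hu : u + impulse Q u = ContinuousMap.const _ ν) :
    ∫ s in (0 : ℝ)..1, extendTime u s =
      ν + -integrateTime E (impulse Q u) ⟨1, by norm_num, by norm_num⟩ := by
  have hint : integrateTime E u ⟨1, by norm_num, by norm_num⟩ =
      (∫ _ in (0 : ℝ)..1, ν) - integrateTime E (impulse Q u) ⟨1, by norm_num, by norm_num⟩ := by
    nth_rewrite 1 [eq_sub_of_add_eq hu]
    rw [map_sub, ContinuousMap.sub_apply]
    rfl
  rw [intervalIntegral.integral_const, sub_zero, one_smul] at hint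
  rw [← sub_eq_add_neg, ← hint, integrateTime_apply]

theorem exists_diffeo_time_one (hQ : ContDiff ℝ ∞ Q) (hL : LipschitzWith (1 / 16) Q)
    (hM : ∀ z, ‖Q z‖ ≤ M) :
    ∃ e : E ≃ₜ E, ContDiff ℝ ∞ e ∧ ContDiff ℝ ∞ e.symm ∧ ∀ ν, ∃ y u : ℝ → E,
      y 0 = 0 ∧ u 0 = ν ∧ y 1 = e ν ∧ (∀ t, HasDerivAt y (u t) t) ∧
      (∀ t ∈ Ioo (-1 : ℝ) 2, HasDerivAt u (-Q (y t, u t)) t) ∧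
      ∀ t ∈ Ioo (-1 : ℝ) 2, ‖u t‖ ≤ ‖ν‖ + 2 * M ∧ ‖y t‖ ≤ 2 * (‖ν‖ + 2 * M) := by
  obtain ⟨U, hUdiff, hUlip, hU⟩ := exists_velocity_operator hQ hL
  let one : TimeInterval := ⟨1, by norm_num, by norm_num⟩
  let R : E → E := fun ν ↦ -integrateTime E (impulse Q (U ν)) one
  have hRdiff : ContDiff ℝ ∞ R :=
    (((ContinuousMap.evalCLM ℝ one).comp (integrateTime E)).contDiff.comp
      ((contDiff_impulse hQ).comp hUdiff)).neg
  have hRlip : LipschitzWith (2 / 3) R := by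
    have hcomp := lipschitzWith_integrateTime.comp ((lipschitzWith_impulse hL).comp hUlip)
    refine LipschitzWith.of_dist_le_mul fun ν ν' ↦ ?_
    rw [dist_neg_neg]
    refine (ContinuousMap.dist_apply_le_dist one).trans ((hcomp.dist_le_mul ν ν').trans_eq ?_)
    push_cast
    ring
  obtain ⟨e, he, hsymm⟩ := exists_homeomorph_id_add hRdiff
    (by rw [← NNReal.coe_lt_coe]; norm_num) hRlip
  refine ⟨e, funext he ▸ contDiff_id.add hRdiff, hsymm, fun ν ↦
    ⟨fun t ↦ ∫ s in (0 : ℝ)..t, extendTime (U ν) s, extendTime (U ν),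
      intervalIntegral.integral_same, extendTime_zero_of_add_impulse_eq (hU ν),
      (integral_extendTime_of_add_impulse_eq (hU ν)).trans (he ν).symm,
      hasDerivAt_integral_extendTime _,
      fun t ht ↦ hasDerivAt_extendTime_of_add_impulse_eq (hU ν) ht, fun t ht ↦ ?_⟩⟩
  have hUν := norm_le_of_add_impulse_eq hM (hU ν)
  exact ⟨(norm_extendTime_le _ _).trans hUν,
    (norm_integral_extendTime_le (U ν) ⟨t, Ioo_subset_Icc_self ht⟩).trans (by gcongr)⟩

end Integration

section Cutoff

variable {V W : Type*} [NormedAddCommGroup V] [NormedAddCommGroup W] [NormedSpace ℝ W]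

theorem lipschitzOnWith_smul {χ : V → ℝ} {q : V → W} {s : Set V} {k l S : ℝ≥0}
    (hk : LipschitzOnWith k χ s) (hχ : ∀ z ∈ s, ‖χ z‖ ≤ 1) (hl : LipschitzOnWith l q s)
    (hS : ∀ z ∈ s, ‖q z‖ ≤ S) : LipschitzOnWith (k * S + l) (fun z ↦ χ z • q z) s := by
  refine LipschitzOnWith.of_dist_le_mul fun z hz z' hz' ↦ ?_
  have hsplit : χ z • q z - χ z' • q z' = (χ z - χ z') • q z + χ z' • (q z - q z') := by module
  rw [dist_eq_norm, hsplit]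
  calc ‖(χ z - χ z') • q z + χ z' • (q z - q z')‖
      ≤ ‖χ z - χ z'‖ * ‖q z‖ + ‖χ z'‖ * ‖q z - q z'‖ := by
        rw [← norm_smul, ← norm_smul]
        exact norm_add_le _ _
    _ ≤ k * dist z z' * S + 1 * (l * dist z z') := by
        rw [← dist_eq_norm, ← dist_eq_norm]
        gcongr
        exacts [hk.dist_le_mul z hz z' hz', hS z hz, hχ z' hz', hl.dist_le_mul z hz z' hz']
    _ = (k * S + l : ℝ≥0) * dist z z' := by push_cast; ring

theorem norm_smul_le_of_tsupport_subset {χ : V → ℝ} {q : V → W} {s : Set V} {S : ℝ} (hS : 0 ≤ S)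
    (hs : tsupport (fun z ↦ χ z • q z) ⊆ s) (hχ : ∀ z ∈ s, ‖χ z‖ ≤ 1) (hq : ∀ z ∈ s, ‖q z‖ ≤ S)
    (z : V) : ‖χ z • q z‖ ≤ S := by
  by_cases hz : z ∈ s
  · exact (norm_smul_le _ _).trans
      ((mul_le_of_le_one_left (norm_nonneg _) (hχ z hz)).trans (hq z hz))
  · rwa [image_eq_zero_of_notMem_tsupport fun h ↦ hz (hs h), norm_zero]

theorem lipschitzWith_of_tsupport_subset [NormedSpace ℝ V] {f : V → W} (hf : Differentiable ℝ f)
    {C : ℝ≥0} {s : Set V} (hs : IsOpen s) (hfs : tsupport f ⊆ s) (hC : LipschitzOnWith C f s) :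
    LipschitzWith C f := by
  refine lipschitzWith_of_nnnorm_fderiv_le (𝕜 := ℝ) hf fun z ↦ ?_
  by_cases hz : z ∈ s
  · exact norm_fderiv_le_of_lipschitzOn ℝ (hs.mem_nhds hz) hC
  · have hzero : fderiv ℝ f z = 0 := by
      by_contra h
      exact hz (hfs (support_fderiv_subset ℝ h))
    simp [hzero]

end Cutoff

theorem exists_diffeo_time_one_of_small (E : Type*) [NormedAddCommGroup E] [NormedSpace ℝ E]
    [FiniteDimensional ℝ E] [HasContDiffBump (E × E)] :
    ∃ c : ℝ≥0, 0 < c ∧ ∀ q : E × E → E, ContDiff ℝ ∞ q →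
      (∀ z ∈ Metric.ball (0 : E × E) 4, ‖q z‖ ≤ c) →
      LipschitzOnWith c q (Metric.ball (0 : E × E) 4) →
      ∃ e : E ≃ₜ E, ContDiff ℝ ∞ e ∧ ContDiff ℝ ∞ e.symm ∧
        ∀ ν : E, ‖ν‖ ≤ 1 / 2 → ∃ y u : ℝ → E, y 0 = 0 ∧ u 0 = ν ∧ y 1 = e ν ∧
          (∀ t, HasDerivAt y (u t) t) ∧
          ∀ t ∈ Ioo (-1 : ℝ) 2, HasDerivAt u (-q (y t, u t)) t := by
  have := FiniteDimensional.complete ℝ E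
  -- Velocities stay below `1/2 + 2/16` and positions below twice that, where `χ = 1`.
  let χ : ContDiffBump (0 : E × E) := ⟨2, 3, by norm_num, by norm_num⟩
  obtain ⟨k, hk⟩ := (χ.contDiff (n := ⊤)).lipschitzWith_of_hasCompactSupport χ.hasCompactSupport
    (by simp)
  have hχ1 (z : E × E) : ‖χ z‖ ≤ 1 := (Real.norm_of_nonneg χ.nonneg).trans_le χ.le_one
  have htsupport (q : E × E → E) : tsupport (fun z ↦ χ z • q z) ⊆ Metric.ball 0 4 :=
    (tsupport_smul_subset_left χ q).trans
      (χ.tsupport_eq.trans_subset (Metric.closedBall_subset_ball (by norm_num)))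
  refine ⟨1 / (16 * (k + 1)), by positivity, fun q hq hqc hqL ↦ ?_⟩
  have hsmooth : ContDiff ℝ ∞ (fun z ↦ χ z • q z) := χ.contDiff.smul hq
  have hL : LipschitzWith (1 / 16) (fun z ↦ χ z • q z) := by
    refine (lipschitzWith_of_tsupport_subset (hsmooth.differentiable (by simp))
      Metric.isOpen_ball (htsupport q) (lipschitzOnWith_smul hk.lipschitzOnWith
        (fun z _ ↦ hχ1 z) hqL hqc)).weaken (le_of_eq ?_)
    field_simp
  have hc : ((1 / (16 * (k + 1)) : ℝ≥0) : ℝ) ≤ 1 / 16 := by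
    push_cast
    gcongr
    linarith [k.coe_nonneg]
  have hM := norm_smul_le_of_tsupport_subset (by norm_num) (htsupport q) (fun z _ ↦ hχ1 z)
    fun z hz ↦ (hqc z hz).trans hc
  obtain ⟨e, he, hsymm, hsol⟩ := exists_diffeo_time_one (Q := ⟨_, hsmooth.continuous⟩) hsmooth hL hM
  refine ⟨e, he, hsymm, fun ν hν ↦ ?_⟩
  obtain ⟨y, u, hy0, hu0, hy1, hy, hu, hbound⟩ := hsol ν
  refine ⟨y, u, hy0, hu0, hy1, hy, fun t ht ↦ ?_⟩
  have hχ : χ (y t, u t) = 1 := by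
    refine χ.one_of_mem_closedBall (mem_closedBall_zero_iff.2 (max_le ?_ ?_))
    · exact (hbound t ht).2.trans (by linarith)
    · exact (hbound t ht).1.trans (by linarith)
  simpa [hχ] using hu t ht

/-! ### The exponential map of a conformally flat metric -/

section GeodesicForm

variable {V : Type*} [NormedAddCommGroup V] [InnerProductSpace ℝ V]

/-- The quadratic expression of the geodesic equation `u' = -geodesicForm (∇ψ) u` of the conformally
flat metric `e^{2ψ} δ`. -/
def geodesicForm (a u : V) : V := (2 * inner ℝ a u) • u - ‖u‖ ^ 2 • a

theorem contDiff_geodesicForm {X : Type*} [NormedAddCommGroup X] [NormedSpace ℝ X]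
    {f g : X → V} (hf : ContDiff ℝ ∞ f) (hg : ContDiff ℝ ∞ g) :
    ContDiff ℝ ∞ (fun z ↦ geodesicForm (f z) (g z)) :=
  ((contDiff_const.mul (hf.inner ℝ hg)).smul hg).sub ((hg.norm_sq ℝ).smul hf)

theorem norm_two_mul_inner_smul_le (a u w : V) :
    ‖(2 * inner ℝ a u) • w‖ ≤ 2 * ‖a‖ * ‖u‖ * ‖w‖ := by
  rw [norm_smul, norm_mul, Real.norm_ofNat, mul_assoc 2 ‖a‖]
  exact mul_le_mul_of_nonneg_right
    (mul_le_mul_of_nonneg_left (norm_inner_le_norm (𝕜 := ℝ) a u) zero_le_two) (norm_nonneg w)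

theorem norm_geodesicForm_le (a u : V) : ‖geodesicForm a u‖ ≤ 3 * ‖a‖ * ‖u‖ ^ 2 := by
  have hsq : ‖‖u‖ ^ 2 • a‖ = ‖u‖ ^ 2 * ‖a‖ := by
    rw [norm_smul, Real.norm_of_nonneg (sq_nonneg _)]
  refine (norm_sub_le _ _).trans ?_
  rw [hsq]
  linarith [norm_two_mul_inner_smul_le a u u]

theorem norm_geodesicForm_sub_right_le (a : V) {u u' : V} {ρ : ℝ} (hu : ‖u‖ ≤ ρ)
    (hu' : ‖u'‖ ≤ ρ) : ‖geodesicForm a u - geodesicForm a u'‖ ≤ 6 * ρ * ‖a‖ * ‖u - u'‖ := by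
  have hsplit : geodesicForm a u - geodesicForm a u' = (2 * inner ℝ a (u - u')) • u
      + (2 * inner ℝ a u') • (u - u') + (‖u'‖ ^ 2 - ‖u‖ ^ 2) • a := by
    simp only [geodesicForm, inner_sub_right]
    module
  have hsq : |‖u'‖ ^ 2 - ‖u‖ ^ 2| ≤ (ρ + ρ) * ‖u - u'‖ := by
    rw [sq_sub_sq, abs_mul, abs_of_nonneg (by positivity), norm_sub_rev u u']
    exact mul_le_mul (add_le_add hu' hu) (abs_norm_sub_norm_le u' u) (abs_nonneg _)
      (add_nonneg ((norm_nonneg _).trans hu') ((norm_nonneg _).trans hu))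
  rw [hsplit]
  refine (norm_add_le_of_le (norm_add_le_of_le (norm_two_mul_inner_smul_le a (u - u') u)
    (norm_two_mul_inner_smul_le a u' (u - u'))) (norm_smul_le (‖u'‖ ^ 2 - ‖u‖ ^ 2) a)).trans ?_
  calc _ ≤ 2 * ‖a‖ * ‖u - u'‖ * ρ + 2 * ‖a‖ * ρ * ‖u - u'‖ + (ρ + ρ) * ‖u - u'‖ * ‖a‖ := by
        gcongr; exact hsq
    _ = 6 * ρ * ‖a‖ * ‖u - u'‖ := by ring

theorem norm_geodesicForm_sub_le {a a' u u' : V} {ρ : ℝ} (hu : ‖u‖ ≤ ρ) (hu' : ‖u'‖ ≤ ρ) :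
    ‖geodesicForm a u - geodesicForm a' u'‖ ≤
      3 * ρ ^ 2 * ‖a - a'‖ + 6 * ρ * ‖a'‖ * ‖u - u'‖ := by
  have hsplit : geodesicForm a u - geodesicForm a' u' =
      geodesicForm (a - a') u + (geodesicForm a' u - geodesicForm a' u') := by
    simp only [geodesicForm, inner_sub_left]
    module
  rw [hsplit]
  refine (norm_add_le _ _).trans (add_le_add ?_ (norm_geodesicForm_sub_right_le a' hu hu'))
  refine (norm_geodesicForm_le _ _).trans ?_
  rw [mul_right_comm]
  gcongr

theorem exists_diffeo_time_one_geodesicForm (V : Type*) [NormedAddCommGroup V]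
    [InnerProductSpace ℝ V] [FiniteDimensional ℝ V] :
    ∃ c : ℝ≥0, 0 < c ∧ ∀ a : V → V, ContDiff ℝ ∞ a →
      (∀ y ∈ Metric.ball (0 : V) 4, ‖a y‖ ≤ c) → LipschitzOnWith c a (Metric.ball (0 : V) 4) →
      ∃ e : V ≃ₜ V, ContDiff ℝ ∞ e ∧ ContDiff ℝ ∞ e.symm ∧
        ∀ ν : V, ‖ν‖ ≤ 1 / 2 → ∃ y u : ℝ → V, y 0 = 0 ∧ u 0 = ν ∧ y 1 = e ν ∧
          (∀ t, HasDerivAt y (u t) t) ∧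
          ∀ t ∈ Ioo (-1 : ℝ) 2, HasDerivAt u (-geodesicForm (a (y t)) (u t)) t := by
  obtain ⟨c, hc, hsol⟩ := exists_diffeo_time_one_of_small V
  have hball {z : V × V} (hz : z ∈ Metric.ball 0 4) :
      z.1 ∈ Metric.ball 0 4 ∧ ‖z.2‖ ≤ 4 := by
    rw [mem_ball_zero_iff] at hz ⊢
    exact ⟨(norm_fst_le z).trans_lt hz, ((norm_snd_le z).trans_lt hz).le⟩
  refine ⟨c / 72, by positivity, fun a ha hac haL ↦ hsol (fun z ↦ geodesicForm (a z.1) z.2)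
    (contDiff_geodesicForm ha.fst' contDiff_snd) (fun z hz ↦ ?_)
    (LipschitzOnWith.of_dist_le_mul fun z hz z' hz' ↦ ?_)⟩ <;>
  simp only [NNReal.coe_div, NNReal.coe_ofNat, dist_eq_norm] at hac ⊢
  · calc _ ≤ 3 * ‖a z.1‖ * ‖z.2‖ ^ 2 := norm_geodesicForm_le _ _
      _ ≤ 3 * (c / 72) * 4 ^ 2 := by
          gcongr
          exacts [hac _ (hball hz).1, (hball hz).2]
      _ ≤ c := by linarith [c.coe_nonneg]
  · have hfst : ‖a z.1 - a z'.1‖ ≤ c / 72 * ‖z - z'‖ :=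
      (haL.norm_sub_le (hball hz).1 (hball hz').1).trans
        (by push_cast; gcongr; exact norm_fst_le (z - z'))
    calc _ ≤ 3 * 4 ^ 2 * ‖a z.1 - a z'.1‖ + 6 * 4 * ‖a z'.1‖ * ‖z.2 - z'.2‖ :=
          norm_geodesicForm_sub_le (hball hz).2 (hball hz').2
      _ ≤ 3 * 4 ^ 2 * (c / 72 * ‖z - z'‖) + 6 * 4 * (c / 72) * ‖z - z'‖ := by
          gcongr
          exacts [hac _ (hball hz').1, norm_snd_le (z - z')]
      _ = c * ‖z - z'‖ := by ring

end GeodesicForm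

section Exponential

variable {m : ℕ} {ψ : Euc m → ℝ}

theorem gradient_apply (ψ : Euc m → ℝ) (x : Euc m) (i : Fin m) :
    gradient ψ x i = partialDeriv i ψ x := by
  rw [partialDeriv, ← InnerProductSpace.toDual_symm_apply (𝕜 := ℝ), ← gradient,
    EuclideanSpace.inner_single_right, one_mul, conj_trivial]

theorem contDiff_gradient (hψ : ContDiff ℝ ∞ ψ) : ContDiff ℝ ∞ (gradient ψ) :=
  (InnerProductSpace.toDual ℝ (Euc m)).symm.contDiff.comp (hψ.fderiv_right (m := ∞) le_rfl)

theorem partialDeriv_partialDeriv_eq_fderiv_gradient (hψ : ContDiff ℝ ∞ ψ) (x : Euc m)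
    (i j : Fin m) : partialDeriv i (partialDeriv j ψ) x =
      fderiv ℝ (gradient ψ) x (EuclideanSpace.single i 1) j := by
  have hgradient : HasFDerivAt (gradient ψ) (fderiv ℝ (gradient ψ) x) x :=
    ((contDiff_gradient hψ).differentiable (by simp) x).hasFDerivAt
  have hcoord := ((EuclideanSpace.proj j : Euc m →L[ℝ] ℝ).hasFDerivAt).comp x hgradient
  have hj : partialDeriv j ψ = (EuclideanSpace.proj j : Euc m →L[ℝ] ℝ) ∘ gradient ψ :=
    funext fun y ↦ (gradient_apply ψ y j).symm
  rw [hj, partialDeriv, hcoord.fderiv]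
  rfl

theorem geodesicForm_gradient_apply {hψ : ContDiff ℝ ∞ ψ} (x u : Euc m) (k : Fin m) :
    geodesicForm (gradient ψ x) u k =
      ∑ i, ∑ j, christoffel (conformalMetric ψ hψ) k i j x * u i * u j := by
  have hterm (i j : Fin m) : christoffel (conformalMetric ψ hψ) k i j x * u i * u j =
      kronecker k j * (partialDeriv i ψ x * u i * u j)
        + kronecker k i * (u i * (partialDeriv j ψ x * u j))
        - kronecker i j * (partialDeriv k ψ x * (u i * u j)) := by
    rw [christoffel_conformal]
    ring
  have hinner : (inner ℝ (gradient ψ x) u : ℝ) = ∑ i, partialDeriv i ψ x * u i := by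
    simp only [PiLp.inner_apply, gradient_apply, RCLike.inner_apply', conj_trivial]
  have hnorm : ‖u‖ ^ 2 = ∑ i, u i * u i := by
    rw [EuclideanSpace.norm_sq_eq]
    exact Finset.sum_congr rfl fun i _ ↦ by rw [Real.norm_eq_abs, sq_abs, sq]
  simp only [hterm, Finset.sum_add_distrib, Finset.sum_sub_distrib, sum_kronecker_mul,
    ← Finset.mul_sum, ← Finset.sum_mul, geodesicForm, PiLp.sub_apply, PiLp.smul_apply,
    smul_eq_mul, gradient_apply, hinner, hnorm]
  ring

/-- Uniform control of the conformal factor `e^{2ψ}` at the scale of the metric: on the Euclidean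
ball of radius `τ e^{-ψ x}` about `x`, which has radius about `τ` in the metric, the first two
derivatives of `ψ` are bounded in units of `e^{ψ x}`. -/
def IsTame (ψ : Euc m → ℝ) (τ C : ℝ) : Prop :=
  ∀ x y : Euc m, ‖y - x‖ ≤ τ * Real.exp (-ψ x) →
    ‖gradient ψ y‖ ≤ C * Real.exp (ψ x) ∧
      ‖fderiv ℝ (gradient ψ) y‖ ≤ C * Real.exp (ψ x) ^ 2

/-- The gradient of `ψ` in the coordinates `y` in which the point is `x + κ y`. -/
def rescaledGradient (ψ : Euc m → ℝ) (x : Euc m) (κ : ℝ) (y : Euc m) : Euc m :=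
  κ • gradient ψ (x + κ • y)

theorem contDiff_rescaledGradient (hψ : ContDiff ℝ ∞ ψ) (x : Euc m) (κ : ℝ) :
    ContDiff ℝ ∞ (rescaledGradient ψ x κ) := by
  have hgradient := contDiff_gradient hψ
  unfold rescaledGradient
  fun_prop

theorem hasFDerivAt_rescaledGradient (hψ : ContDiff ℝ ∞ ψ) (x : Euc m) (κ : ℝ) (y : Euc m) :
    HasFDerivAt (rescaledGradient ψ x κ) (κ ^ 2 • fderiv ℝ (gradient ψ) (x + κ • y)) y := by
  have hgradient : HasFDerivAt (gradient ψ) (fderiv ℝ (gradient ψ) (x + κ • y)) (x + κ • y) :=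
    ((contDiff_gradient hψ).differentiable (by simp) _).hasFDerivAt
  have haffine : HasFDerivAt (fun y : Euc m ↦ x + κ • y) (κ • ContinuousLinearMap.id ℝ (Euc m)) y :=
    ((hasFDerivAt_id y).const_smul κ).const_add x
  have hcomp : κ ^ 2 • fderiv ℝ (gradient ψ) (x + κ • y) =
      κ • (fderiv ℝ (gradient ψ) (x + κ • y)).comp (κ • ContinuousLinearMap.id ℝ (Euc m)) := by
    rw [ContinuousLinearMap.comp_smul, ContinuousLinearMap.comp_id, smul_smul, sq]
  rw [hcomp]
  exact (hgradient.comp y haffine).const_smul κ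

section Tame

variable {τ C η κ : ℝ} {x : Euc m}

theorem IsTame.bounds_of_mem_ball (h : IsTame ψ τ C) (hητ : 4 * η ≤ τ) (hκ : 0 < κ)
    (hκη : κ * Real.exp (ψ x) = η) {y : Euc m} (hy : y ∈ Metric.ball 0 4) :
    ‖gradient ψ (x + κ • y)‖ ≤ C * Real.exp (ψ x) ∧
      ‖fderiv ℝ (gradient ψ) (x + κ • y)‖ ≤ C * Real.exp (ψ x) ^ 2 := by
  refine h x _ ?_
  rw [mem_ball_zero_iff] at hy
  rw [add_sub_cancel_left, norm_smul, Real.norm_of_nonneg hκ.le, Real.exp_neg,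
    le_mul_inv_iff₀ (Real.exp_pos _), mul_right_comm, hκη]
  have hη : 0 < η := hκη ▸ by positivity
  nlinarith

theorem IsTame.norm_rescaledGradient_le (h : IsTame ψ τ C) (hητ : 4 * η ≤ τ) (hκ : 0 < κ)
    (hκη : κ * Real.exp (ψ x) = η) {y : Euc m} (hy : y ∈ Metric.ball 0 4) :
    ‖rescaledGradient ψ x κ y‖ ≤ η * C := by
  rw [rescaledGradient, norm_smul, Real.norm_of_nonneg hκ.le, ← hκη, mul_assoc, mul_comm _ C]
  gcongr
  exact (h.bounds_of_mem_ball hητ hκ hκη hy).1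

theorem IsTame.lipschitzOnWith_rescaledGradient (h : IsTame ψ τ C) (hψ : ContDiff ℝ ∞ ψ)
    (hητ : 4 * η ≤ τ) (hη : η ≤ 1) (hC : 0 ≤ C) (hκ : 0 < κ) (hκη : κ * Real.exp (ψ x) = η)
    {c : ℝ≥0} (hc : η * C ≤ c) :
    LipschitzOnWith c (rescaledGradient ψ x κ) (Metric.ball 0 4) := by
  refine (convex_ball (0 : Euc m) 4).lipschitzOnWith_of_nnnorm_hasFDerivWithin_le
    (fun y _ ↦ (hasFDerivAt_rescaledGradient hψ x κ y).hasFDerivWithinAt) fun y hy ↦ ?_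
  have hη0 : 0 ≤ η := hκη ▸ by positivity
  rw [← NNReal.coe_le_coe, coe_nnnorm, norm_smul, Real.norm_of_nonneg (sq_nonneg κ)]
  calc κ ^ 2 * ‖fderiv ℝ (gradient ψ) (x + κ • y)‖ ≤ κ ^ 2 * (C * Real.exp (ψ x) ^ 2) := by
        gcongr
        exact (h.bounds_of_mem_ball hητ hκ hκη hy).2
    _ = η * (η * C) := by rw [← hκη]; ring
    _ ≤ η * C := mul_le_of_le_one_left (by positivity) hη
    _ ≤ c := hc

end Tame

theorem isGeodesicOn_conformal {hψ : ContDiff ℝ ∞ ψ} {x : Euc m} {κ : ℝ} {y u : ℝ → Euc m}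
    {s : Set ℝ} (hy : ∀ t, HasDerivAt y (u t) t)
    (hu : ∀ t ∈ s, HasDerivAt u (-geodesicForm (rescaledGradient ψ x κ (y t)) (u t)) t) :
    IsGeodesicOn (conformalMetric ψ hψ) (fun t ↦ x + κ • y t) s := by
  have hγ (t : ℝ) : HasDerivAt (fun t ↦ x + κ • y t) (κ • u t) t :=
    ((hy t).const_smul κ).const_add x
  have hderiv : deriv (fun t ↦ x + κ • y t) = fun t ↦ κ • u t := funext fun t ↦ (hγ t).deriv
  have hform (t : ℝ) : κ • geodesicForm (rescaledGradient ψ x κ (y t)) (u t) =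
      geodesicForm (gradient ψ (x + κ • y t)) (κ • u t) := by
    simp only [geodesicForm, rescaledGradient, inner_smul_left, inner_smul_right, norm_smul,
      mul_pow, Real.norm_eq_abs, sq_abs, conj_trivial]
    module
  refine fun t ht ↦ ⟨(hγ t).differentiableAt, ?_⟩
  rw [hderiv]
  refine ((hu t ht).const_smul κ).congr_deriv ?_
  ext k
  rw [smul_neg, hform, PiLp.neg_apply, geodesicForm_gradient_apply (hψ := hψ)]

theorem expIsDiffeoOnBall_conformal_of_diffeo {hψ : ContDiff ℝ ∞ ψ} {x : Euc m} {κ : ℝ}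
    (hκ : 0 < κ) {e : Euc m ≃ₜ Euc m} (he : ContDiff ℝ ∞ e) (hsymm : ContDiff ℝ ∞ e.symm)
    (hsol : ∀ ν : Euc m, ‖ν‖ ≤ 1 / 2 → ∃ y u : ℝ → Euc m, y 0 = 0 ∧ u 0 = ν ∧ y 1 = e ν ∧
      (∀ t, HasDerivAt y (u t) t) ∧
      ∀ t ∈ Ioo (-1 : ℝ) 2, HasDerivAt u (-geodesicForm (rescaledGradient ψ x κ (y t)) (u t)) t) :
    ExpIsDiffeoOnBall (conformalMetric ψ hψ) x (κ * Real.exp (ψ x) / 2) := by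
  let H : Euc m ≃ₜ Euc m := (Homeomorph.smulOfNeZero κ⁻¹ (inv_ne_zero hκ.ne')).trans
    (e.trans ((Homeomorph.smulOfNeZero κ hκ.ne').trans (Homeomorph.addLeft x)))
  have hH : ContDiff ℝ ∞ H := by
    change ContDiff ℝ ∞ fun v ↦ x + κ • e (κ⁻¹ • v)
    fun_prop
  have hHsymm : ContDiff ℝ ∞ H.symm := by
    change ContDiff ℝ ∞ fun y ↦ κ⁻¹⁻¹ • e.symm (κ⁻¹ • (-x + y))
    fun_prop
  have hopen : IsOpen {v : Euc m |
      metricNorm (conformalMetric ψ hψ) x v < κ * Real.exp (ψ x) / 2} := by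
    simp only [metricNorm_conformal]
    exact isOpen_lt (by fun_prop) continuous_const
  refine ⟨H.toOpenPartialHomeomorph.restrOpen _ hopen, by simp, hH.contDiffOn,
    hHsymm.contDiffOn, fun v hv ↦ ?_⟩
  have hv' : Real.exp (ψ x) * ‖v‖ < κ * Real.exp (ψ x) / 2 := by
    simpa [metricNorm_conformal] using hv
  have hν : ‖κ⁻¹ • v‖ ≤ 1 / 2 := by
    rw [norm_smul, Real.norm_of_nonneg (by positivity), inv_mul_le_iff₀ hκ]
    refine le_of_mul_le_mul_left (hv'.le.trans_eq ?_) (Real.exp_pos (ψ x))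
    ring
  obtain ⟨y, u, hy0, hu0, hy1, hy, hu⟩ := hsol (κ⁻¹ • v) hν
  refine ⟨fun t ↦ x + κ • y t, 1, one_pos, isGeodesicOn_conformal hy fun t ht ↦
    hu t ⟨ht.1, ht.2.trans_eq one_add_one_eq_two⟩, ?_, ?_, ?_⟩
  · simp only [hy0, smul_zero, add_zero]
  · exact (((hy 0).const_smul κ).const_add x).deriv.trans (by rw [hu0, smul_inv_smul₀ hκ.ne'])
  · exact congrArg (x + κ • ·) hy1

theorem exists_expIsDiffeoOnBall_conformal {hψ : ContDiff ℝ ∞ ψ} {τ C : ℝ} (hτ : 0 < τ)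
    (hC : 0 < C) (h : IsTame ψ τ C) :
    ∃ ε : ℝ, 0 < ε ∧ ∀ x, ExpIsDiffeoOnBall (conformalMetric ψ hψ) x ε := by
  obtain ⟨c, hc, hsol⟩ := exists_diffeo_time_one_geodesicForm (Euc m)
  obtain ⟨η, hη0, hη1, hητ, hηC⟩ : ∃ η : ℝ, 0 < η ∧ η ≤ 1 ∧ 4 * η ≤ τ ∧ η * C ≤ c := by
    refine ⟨min 1 (min (τ / 4) (c / C)), by positivity, min_le_left _ _, ?_, ?_⟩
    · rw [← le_div_iff₀' four_pos]
      exact (min_le_right _ _).trans (min_le_left _ _)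
    · rw [← le_div_iff₀ hC]
      exact (min_le_right _ _).trans (min_le_right _ _)
  refine ⟨η / 2, by positivity, fun x ↦ ?_⟩
  obtain ⟨κ, hκ0, hκη⟩ : ∃ κ : ℝ, 0 < κ ∧ κ * Real.exp (ψ x) = η :=
    ⟨η / Real.exp (ψ x), by positivity, div_mul_cancel₀ η (Real.exp_ne_zero _)⟩
  obtain ⟨e, he, hsymm, hexp⟩ := hsol (rescaledGradient ψ x κ) (contDiff_rescaledGradient hψ x κ)
    (fun y hy ↦ (h.norm_rescaledGradient_le hητ hκ0 hκη hy).trans hηC)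
    (h.lipschitzOnWith_rescaledGradient hψ hητ hη1 hC.le hκ0 hκη hηC)
  exact hκη ▸ expIsDiffeoOnBall_conformal_of_diffeo hκ0 he hsymm hexp

end Exponential

/-! ### The metrics with slowly growing cross sections -/

/-- The logarithms of the radius of the spherical cross sections, as a function of twice the
logarithmic distance to the origin: smooth functions that tend to infinity slowly. -/
structure IsProfile (h : ℝ → ℝ) : Prop where
  contDiff : ContDiff ℝ ∞ h
  eq_zero : ∀ t ≤ 0, h t = 0
  deriv_nonneg : ∀ t, 0 ≤ deriv h t
  deriv_le : ∀ t, deriv h t ≤ 1 / 32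
  abs_deriv_deriv_le : ∀ t, |deriv (deriv h) t| ≤ 1 / 32
  tendsto : Tendsto h atTop atTop

namespace IsProfile

variable {h : ℝ → ℝ}

theorem differentiable (hh : IsProfile h) : Differentiable ℝ h :=
  hh.contDiff.differentiable (by simp)

theorem hasDerivAt (hh : IsProfile h) (t : ℝ) : HasDerivAt h (deriv h t) t :=
  (hh.differentiable t).hasDerivAt

theorem hasDerivAt_deriv (hh : IsProfile h) (t : ℝ) :
    HasDerivAt (deriv h) (deriv (deriv h) t) t :=
  ((hh.contDiff.iterate_deriv 1).differentiable (by simp) t).hasDerivAt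

theorem monotone (hh : IsProfile h) : Monotone h :=
  monotone_of_deriv_nonneg hh.differentiable hh.deriv_nonneg

theorem nonneg (hh : IsProfile h) (t : ℝ) : 0 ≤ h t := by
  rcases le_total t 0 with ht | ht
  · exact (hh.eq_zero t ht).ge
  · exact (hh.eq_zero 0 le_rfl).ge.trans (hh.monotone ht)

theorem le_div (hh : IsProfile h) {t : ℝ} (ht : 0 ≤ t) : h t ≤ t / 32 := by
  have hanti : Antitone fun t ↦ h t - t / 32 :=
    antitone_of_hasDerivAt_nonpos
      (fun t ↦ (hh.hasDerivAt t).sub ((hasDerivAt_id t).div_const 32))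
      fun t ↦ sub_nonpos.2 (hh.deriv_le t)
  have hle := hanti ht
  simp only [hh.eq_zero 0 le_rfl] at hle
  linarith

theorem abs_two_mul_deriv_sub_one_le (hh : IsProfile h) (t : ℝ) : |2 * deriv h t - 1| ≤ 1 := by
  rw [abs_le]
  constructor <;> linarith [hh.deriv_nonneg t, hh.deriv_le t]

end IsProfile

section LogBracket

variable {V : Type*} [NormedAddCommGroup V]

/-- The function `√(1 + |x|²)`. -/
def bracket (x : V) : ℝ := Real.sqrt (1 + ‖x‖ ^ 2)

/-- The function `log (1 + |x|²)`. -/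
def logBracket (x : V) : ℝ := Real.log (1 + ‖x‖ ^ 2)

theorem bracket_sq (x : V) : bracket x ^ 2 = 1 + ‖x‖ ^ 2 := Real.sq_sqrt (by positivity)

theorem bracket_pos (x : V) : 0 < bracket x := Real.sqrt_pos.2 (by positivity)

theorem norm_le_bracket (x : V) : ‖x‖ ≤ bracket x := Real.le_sqrt_of_sq_le (by linarith)

theorem bracket_le_add (x y : V) : bracket x ≤ bracket y + ‖x - y‖ := by
  have hx : ‖x‖ ≤ ‖y‖ + ‖x - y‖ := norm_le_norm_add_norm_sub' x y
  have hy := norm_le_bracket y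
  have hsq := bracket_sq y
  refine Real.sqrt_le_iff.2 ⟨add_nonneg (bracket_pos y).le (norm_nonneg _), ?_⟩
  nlinarith [norm_nonneg x, norm_nonneg y, norm_nonneg (x - y)]

theorem logBracket_nonneg (x : V) : 0 ≤ logBracket x :=
  Real.log_nonneg (le_add_of_nonneg_right (sq_nonneg _))

theorem exp_logBracket (x : V) : Real.exp (logBracket x) = bracket x ^ 2 := by
  rw [logBracket, Real.exp_log (by positivity), bracket_sq]

theorem exp_half_logBracket (x : V) : Real.exp (logBracket x / 2) = bracket x := by
  rw [Real.exp_half, exp_logBracket, Real.sqrt_sq (bracket_pos x).le]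

theorem logBracket_le_of_norm_le {x y : V} (h : ‖x‖ ≤ ‖y‖) : logBracket x ≤ logBracket y :=
  Real.log_le_log (by positivity) (by gcongr)

theorem norm_le_of_logBracket_le {x : V} {T : ℝ} (h : logBracket x ≤ T) :
    ‖x‖ ≤ Real.exp (T / 2) := by
  refine (norm_le_bracket x).trans ?_
  rw [← exp_half_logBracket]
  gcongr

variable [InnerProductSpace ℝ V]

theorem contDiff_logBracket : ContDiff ℝ ∞ (logBracket (V := V)) :=
  (contDiff_const.add (contDiff_norm_sq ℝ)).log fun x ↦ by positivity

theorem hasFDerivAt_logBracket (x : V) :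
    HasFDerivAt logBracket ((2 / bracket x ^ 2) • innerSL ℝ x) x := by
  have hsq : HasFDerivAt (fun x : V ↦ 1 + ‖x‖ ^ 2) (2 • innerSL ℝ x) x :=
    (hasStrictFDerivAt_norm_sq x).hasFDerivAt.const_add 1
  refine (hsq.log (by positivity)).congr_fderiv ?_
  rw [bracket_sq]
  module

end LogBracket

section LogFactor

variable {m : ℕ} {h : ℝ → ℝ}

/-- The radius of the spherical cross section through `x`. -/
def radius (h : ℝ → ℝ) (x : Euc m) : ℝ := Real.exp (h (logBracket x))

/-- The logarithm `ψ` of the conformal factor, such that `e^ψ` is the quotient of the radius of the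
cross section and its Euclidean radius, the latter replaced by `√(1 + |x|²)`. -/
def logFactor (h : ℝ → ℝ) (x : Euc m) : ℝ := h (logBracket x) - logBracket x / 2

theorem radius_pos (h : ℝ → ℝ) (x : Euc m) : 0 < radius h x := Real.exp_pos _

theorem one_le_radius (hh : IsProfile h) (x : Euc m) : 1 ≤ radius h x :=
  Real.one_le_exp (hh.nonneg _)

theorem exp_logFactor (h : ℝ → ℝ) (x : Euc m) :
    Real.exp (logFactor h x) = radius h x / bracket x := by
  rw [logFactor, Real.exp_sub, exp_half_logBracket, radius]

theorem exp_neg_two_mul_logFactor (h : ℝ → ℝ) (x : Euc m) :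
    Real.exp (-(2 * logFactor h x)) = Real.exp (-(2 * h (logBracket x))) * bracket x ^ 2 := by
  rw [← exp_logBracket, ← Real.exp_add, logFactor]
  ring_nf

theorem one_div_bracket_le_exp_logFactor (hh : IsProfile h) (x : Euc m) :
    1 / bracket x ≤ Real.exp (logFactor h x) := by
  rw [exp_logFactor]
  exact div_le_div_of_nonneg_right (one_le_radius hh x) (bracket_pos x).le

theorem exp_neg_logFactor_le (hh : IsProfile h) (x : Euc m) :
    Real.exp (-logFactor h x) ≤ bracket x := by
  rw [Real.exp_neg, inv_le_comm₀ (Real.exp_pos _) (bracket_pos x), ← one_div]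
  exact one_div_bracket_le_exp_logFactor hh x

theorem contDiff_logFactor (hh : IsProfile h) : ContDiff ℝ ∞ (logFactor (m := m) h) :=
  (hh.contDiff.comp contDiff_logBracket).sub (contDiff_logBracket.div_const 2)

theorem gradient_logFactor (hh : IsProfile h) (x : Euc m) :
    gradient (logFactor h) x = ((2 * deriv h (logBracket x) - 1) / bracket x ^ 2) • x := by
  have hlog := hasFDerivAt_logBracket x
  have hfderiv := ((hh.hasDerivAt (logBracket x)).comp_hasFDerivAt x hlog).sub
    (hlog.mul_const (2⁻¹ : ℝ))
  refine HasGradientAt.gradient (hasGradientAt_iff_hasFDerivAt.2 (hfderiv.congr_fderiv ?_))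
  rw [map_smul, smul_smul, smul_smul, ← sub_smul]
  change _ = _ • innerSL ℝ x
  ring_nf

theorem hasFDerivAt_gradient_logFactor (hh : IsProfile h) (x : Euc m) :
    HasFDerivAt (gradient (logFactor h))
      (((2 * deriv h (logBracket x) - 1) / bracket x ^ 2) • ContinuousLinearMap.id ℝ (Euc m) +
        ((2 * (2 * deriv (deriv h) (logBracket x) - (2 * deriv h (logBracket x) - 1)) /
          bracket x ^ 4) • innerSL ℝ x).smulRight x) x := by
  have hgradient : gradient (logFactor (m := m) h) =
      fun x ↦ ((2 * deriv h (logBracket x) - 1) * Real.exp (-logBracket x)) • x := by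
    ext1 x
    rw [gradient_logFactor hh, Real.exp_neg, exp_logBracket, div_eq_mul_inv]
  have hlog := hasFDerivAt_logBracket x
  have hslope := (((hh.hasDerivAt_deriv (logBracket x)).comp_hasFDerivAt x hlog).const_mul
    2).sub_const 1
  rw [hgradient]
  refine ((hslope.fun_mul hlog.fun_neg.exp).smul (hasFDerivAt_id x)).congr_fderiv ?_
  ext v
  have hb := (bracket_pos x).ne'
  simp only [add_apply, smul_apply, ContinuousLinearMap.smulRight_apply, neg_apply,
    ContinuousLinearMap.id_apply, PiLp.add_apply, PiLp.smul_apply, smul_eq_mul, id_eq,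
    innerSL_apply_apply, Function.comp_apply, Real.exp_neg, exp_logBracket, mul_neg]
  field_simp
  ring

theorem norm_gradient_logFactor_le (hh : IsProfile h) (x : Euc m) :
    ‖gradient (logFactor h) x‖ ≤ 1 / bracket x := by
  have hb := bracket_pos x
  rw [gradient_logFactor hh, norm_smul, Real.norm_eq_abs, abs_div, abs_of_pos (pow_pos hb 2)]
  calc _ ≤ 1 / bracket x ^ 2 * bracket x := by
        gcongr
        exacts [hh.abs_two_mul_deriv_sub_one_le _, norm_le_bracket x]
    _ = 1 / bracket x := by field_simp

theorem norm_fderiv_gradient_logFactor_le (hh : IsProfile h) (x : Euc m) :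
    ‖fderiv ℝ (gradient (logFactor h)) x‖ ≤ 4 / bracket x ^ 2 := by
  have hb := bracket_pos x
  have hslope := hh.abs_two_mul_deriv_sub_one_le (logBracket x)
  have hid : ‖((2 * deriv h (logBracket x) - 1) / bracket x ^ 2) •
      ContinuousLinearMap.id ℝ (Euc m)‖ ≤ 1 / bracket x ^ 2 * 1 := by
    rw [norm_smul, Real.norm_eq_abs, abs_div, abs_of_pos (pow_pos hb 2)]
    gcongr
    exact ContinuousLinearMap.norm_id_le
  have hrank : ‖((2 * (2 * deriv (deriv h) (logBracket x) - (2 * deriv h (logBracket x) - 1)) /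
      bracket x ^ 4) • innerSL ℝ x).smulRight x‖ ≤ 3 / bracket x ^ 4 * bracket x * bracket x := by
    rw [ContinuousLinearMap.norm_smulRight_apply, norm_smul, innerSL_apply_norm, Real.norm_eq_abs,
      abs_div, abs_of_pos (pow_pos hb 4)]
    have hcoeff :
        |2 * (2 * deriv (deriv h) (logBracket x) - (2 * deriv h (logBracket x) - 1))| ≤ 3 := by
      have hsecond := abs_le.1 (hh.abs_deriv_deriv_le (logBracket x))
      rw [abs_le] at hslope ⊢
      constructor <;> linarith
    gcongr <;> exact norm_le_bracket x
  rw [(hasFDerivAt_gradient_logFactor hh x).fderiv]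
  refine (norm_add_le_of_le hid hrank).trans_eq ?_
  field_simp
  norm_num

theorem isTame_logFactor (hh : IsProfile h) : IsTame (logFactor (m := m) h) (1 / 2) 16 := by
  intro x y hxy
  have hx := bracket_pos x
  have hy := bracket_pos y
  have hexp := one_div_bracket_le_exp_logFactor hh x
  have hbracket : bracket x ≤ 2 * bracket y := by
    have hadd := bracket_le_add x y
    rw [norm_sub_rev] at hadd
    linarith [exp_neg_logFactor_le hh x]
  have hinv : 1 / bracket y ≤ 2 * Real.exp (logFactor h x) := by
    refine le_trans ?_ (mul_le_mul_of_nonneg_left hexp zero_le_two)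
    rw [mul_one_div, div_le_div_iff₀ hy hx]
    linarith
  constructor
  · refine (norm_gradient_logFactor_le hh y).trans ?_
    linarith [Real.exp_pos (logFactor h x)]
  · calc ‖fderiv ℝ (gradient (logFactor h)) y‖ ≤ 4 / bracket y ^ 2 :=
          norm_fderiv_gradient_logFactor_le hh y
      _ = 4 * (1 / bracket y) ^ 2 := by ring
      _ ≤ 4 * (2 * Real.exp (logFactor h x)) ^ 2 := by gcongr
      _ = 16 * Real.exp (logFactor h x) ^ 2 := by ring

theorem abs_conformalHessian_logFactor_le (hh : IsProfile h) (x : Euc m) (i j : Fin m) :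
    |conformalHessian (logFactor h) i j x| ≤ 5 / bracket x ^ 2 := by
  have hb := bracket_pos x
  have hfirst (i : Fin m) : |partialDeriv i (logFactor h) x| ≤ 1 / bracket x := by
    rw [← gradient_apply]
    exact (abs_coord_le_norm _ i).trans (norm_gradient_logFactor_le hh x)
  have hsecond : |partialDeriv i (partialDeriv j (logFactor h)) x| ≤ 4 / bracket x ^ 2 := by
    rw [partialDeriv_partialDeriv_eq_fderiv_gradient (contDiff_logFactor hh)]
    refine (abs_coord_le_norm _ j).trans ((ContinuousLinearMap.unit_le_opNorm _ _ ?_).trans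
      (norm_fderiv_gradient_logFactor_le hh x))
    rw [PiLp.norm_single, norm_one]
  calc _ ≤ 4 / bracket x ^ 2 + 1 / bracket x * (1 / bracket x) := by
        refine (abs_sub _ _).trans ?_
        rw [abs_mul]
        gcongr <;> exact hfirst _
    _ = 5 / bracket x ^ 2 := by
        field_simp
        norm_num

theorem sum_partialDeriv_sq (ψ : Euc m → ℝ) (x : Euc m) :
    ∑ i, partialDeriv i ψ x ^ 2 = ‖gradient ψ x‖ ^ 2 := by
  simp only [EuclideanSpace.norm_sq_eq, gradient_apply, Real.norm_eq_abs, sq_abs]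

theorem sum_partialDeriv_logFactor_sq (hh : IsProfile h) (x : Euc m) :
    ∑ i, partialDeriv i (logFactor h) x ^ 2 =
      ((2 * deriv h (logBracket x) - 1) / (1 + ‖x‖ ^ 2)) ^ 2 * ‖x‖ ^ 2 := by
  rw [sum_partialDeriv_sq, gradient_logFactor hh, norm_smul, mul_pow, Real.norm_eq_abs, sq_abs,
    bracket_sq]

theorem sum_partialDeriv_partialDeriv_logFactor (hh : IsProfile h) (x : Euc m) :
    ∑ i, partialDeriv i (partialDeriv i (logFactor h)) x =
      m * ((2 * deriv h (logBracket x) - 1) / (1 + ‖x‖ ^ 2)) +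
        2 * (2 * deriv (deriv h) (logBracket x) - (2 * deriv h (logBracket x) - 1)) /
          (1 + ‖x‖ ^ 2) ^ 2 * ‖x‖ ^ 2 := by
  have hsecond (i : Fin m) : partialDeriv i (partialDeriv i (logFactor h)) x =
      (2 * deriv h (logBracket x) - 1) / (1 + ‖x‖ ^ 2) +
        2 * (2 * deriv (deriv h) (logBracket x) - (2 * deriv h (logBracket x) - 1)) /
          (1 + ‖x‖ ^ 2) ^ 2 * ‖x i‖ ^ 2 := by
    have hb : bracket x ^ 4 = (1 + ‖x‖ ^ 2) ^ 2 := by rw [← bracket_sq]; ring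
    rw [partialDeriv_partialDeriv_eq_fderiv_gradient (contDiff_logFactor hh),
      (hasFDerivAt_gradient_logFactor hh x).fderiv]
    simp only [add_apply, smul_apply, ContinuousLinearMap.smulRight_apply,
      ContinuousLinearMap.id_apply, PiLp.add_apply, PiLp.smul_apply, smul_eq_mul,
      innerSL_apply_apply, EuclideanSpace.inner_single_right, PiLp.single_apply, ↓reduceIte,
      conj_trivial, bracket_sq, hb, Real.norm_eq_abs, sq_abs]
    ring
  simp only [hsecond, Finset.sum_add_distrib, ← Finset.mul_sum, ← EuclideanSpace.norm_sq_eq,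
    Finset.sum_const, Finset.card_univ, Fintype.card_fin, nsmul_eq_mul]

/-- The metric `e^{2ψ} δ` whose spherical cross sections grow according to the profile `h`. -/
def profileMetric (m : ℕ) {h : ℝ → ℝ} (hh : IsProfile h) : SmoothMetric m :=
  conformalMetric (logFactor h) (contDiff_logFactor hh)

theorem hasBoundedGeometry_profileMetric (hh : IsProfile h) :
    HasBoundedGeometry (profileMetric m hh) := by
  refine ⟨exists_expIsDiffeoOnBall_conformal (by norm_num) (by norm_num) (isTame_logFactor hh),
    m ^ 4 * 22, fun x u v w z ↦ ?_⟩
  have hb := bracket_pos x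
  have hcoeff (l k i j : Fin m) :
      |riemannCoeff (conformalMetric (logFactor h) (contDiff_logFactor hh)) l k i j x| ≤
        22 / bracket x ^ 2 := by
    refine (abs_riemannCoeff_conformal_le (abs_conformalHessian_logFactor_le hh x) l k i j).trans ?_
    rw [sum_partialDeriv_sq]
    calc _ ≤ 4 * (5 / bracket x ^ 2) + 2 * (1 / bracket x) ^ 2 := by
          gcongr
          exact norm_gradient_logFactor_le hh x
      _ = 22 / bracket x ^ 2 := by
          field_simp
          norm_num
  have hexp : Real.exp (-(2 * logFactor h x)) ≤ bracket x ^ 2 := by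
    rw [← mul_neg, two_mul, Real.exp_add, sq]
    gcongr <;> exact exp_neg_logFactor_le hh x
  have hscale : 22 / bracket x ^ 2 * Real.exp (-(2 * logFactor h x)) ≤ 22 := by
    rw [div_mul_eq_mul_div, div_le_iff₀ (pow_pos hb 2)]
    gcongr
  refine (abs_metricInner_curvature_conformal_le hcoeff u v w z).trans ?_
  unfold profileMetric
  gcongr <;> exact Real.sqrt_nonneg _

theorem scalarCurvature_profileMetric (hh : IsProfile h) (x : Euc m) :
    scalarCurvature (profileMetric m hh) x =
      Real.exp (-(2 * h (logBracket x))) * ((m - 1) * (2 * m * (1 - 2 * deriv h (logBracket x)) +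
        ‖x‖ ^ 2 * ((m - 2) * (1 - 2 * deriv h (logBracket x)) * (1 + 2 * deriv h (logBracket x))
          - 8 * deriv (deriv h) (logBracket x))) / (1 + ‖x‖ ^ 2)) := by
  have hpos : 1 + ‖x‖ ^ 2 ≠ 0 := by positivity
  rw [profileMetric, scalarCurvature_conformal, sum_partialDeriv_logFactor_sq hh,
    sum_partialDeriv_partialDeriv_logFactor hh, exp_neg_two_mul_logFactor, bracket_sq]
  field_simp
  ring

theorem exp_neg_le_scalarCurvature (hh : IsProfile h) (hm : 3 ≤ m) (x : Euc m) :
    Real.exp (-(2 * h (logBracket x))) ≤ scalarCurvature (profileMetric m hh) x := by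
  rw [scalarCurvature_profileMetric]
  refine le_mul_of_one_le_right (Real.exp_pos _).le ?_
  rw [one_le_div (by positivity)]
  have hm' : (3 : ℝ) ≤ m := by exact_mod_cast hm
  obtain ⟨d, hd⟩ : ∃ d, deriv h (logBracket x) = d := ⟨_, rfl⟩
  have hd0 : 0 ≤ d := hd ▸ hh.deriv_nonneg _
  have hd1 : d ≤ 1 / 32 := hd ▸ hh.deriv_le _
  have hd2 := abs_le.1 (hh.abs_deriv_deriv_le (logBracket x))
  rw [hd]
  have hradial : (1 : ℝ) / 2 ≤
      (m - 2) * (1 - 2 * d) * (1 + 2 * d) - 8 * deriv (deriv h) (logBracket x) := by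
    have hsq : (3 : ℝ) / 4 ≤ (1 - 2 * d) * (1 + 2 * d) := by nlinarith
    nlinarith
  have hcentre : (1 : ℝ) ≤ 2 * m * (1 - 2 * d) := by nlinarith
  have hsum : (1 + ‖x‖ ^ 2) / 2 ≤ 2 * m * (1 - 2 * d) + ‖x‖ ^ 2 *
      ((m - 2) * (1 - 2 * d) * (1 + 2 * d) - 8 * deriv (deriv h) (logBracket x)) := by
    nlinarith [sq_nonneg ‖x‖]
  nlinarith

end LogFactor

/-! ### The radial and the spherical coordinate -/

section Squash

variable {V : Type*} [NormedAddCommGroup V] {A : ℝ}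

theorem sqrt_add_norm_sq_pos (hA : 0 < A) (v : V) : 0 < Real.sqrt (A + ‖v‖ ^ 2) :=
  Real.sqrt_pos.2 (by positivity)

theorem norm_le_sqrt_add_norm_sq (hA : 0 < A) (v : V) : ‖v‖ ≤ Real.sqrt (A + ‖v‖ ^ 2) :=
  Real.le_sqrt_of_sq_le (by linarith)

theorem inv_sqrt_add_norm_sub_sq_le (c x : V) :
    (Real.sqrt (1 + ‖c‖ ^ 2 + ‖x - c‖ ^ 2))⁻¹ ≤ 3 / 2 / bracket x := by
  have hpos := sqrt_add_norm_sq_pos (A := 1 + ‖c‖ ^ 2) (by positivity) (x - c)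
  rw [inv_eq_one_div, div_le_div_iff₀ hpos (bracket_pos x), one_mul]
  refine Real.sqrt_le_iff.2 ⟨by positivity, ?_⟩
  rw [mul_pow, Real.sq_sqrt (by positivity)]
  have htri : ‖x‖ ≤ ‖c‖ + ‖x - c‖ := norm_le_norm_add_norm_sub' x c
  nlinarith [sq_nonneg (‖c‖ - ‖x - c‖), norm_nonneg x, norm_nonneg c, norm_nonneg (x - c)]

variable [InnerProductSpace ℝ V]

/-- The vector `v / √(A + |v|²)`. -/
def squash (A : ℝ) (v : V) : V := (Real.sqrt (A + ‖v‖ ^ 2))⁻¹ • v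

theorem contDiff_squash (hA : 0 < A) : ContDiff ℝ ∞ (squash (V := V) A) :=
  (((contDiff_const.add (contDiff_norm_sq ℝ)).sqrt fun v ↦ by positivity).inv
    fun v ↦ (sqrt_add_norm_sq_pos hA v).ne').smul contDiff_id

theorem hasFDerivAt_squash (hA : 0 < A) (v : V) :
    HasFDerivAt (squash A) ((Real.sqrt (A + ‖v‖ ^ 2))⁻¹ • ContinuousLinearMap.id ℝ V
      - (((Real.sqrt (A + ‖v‖ ^ 2))⁻¹ ^ 3) • innerSL ℝ v).smulRight v) v := by
  have hsq : HasFDerivAt (fun v : V ↦ A + ‖v‖ ^ 2) (2 • innerSL ℝ v) v :=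
    (hasStrictFDerivAt_norm_sq v).hasFDerivAt.const_add A
  have hpos := sqrt_add_norm_sq_pos hA v
  refine (((hasDerivAt_inv hpos.ne').comp_hasFDerivAt v
    (hsq.sqrt (by positivity))).smul (hasFDerivAt_id v)).congr_fderiv ?_
  ext w
  simp only [add_apply, sub_apply, smul_apply, ContinuousLinearMap.smulRight_apply,
    Function.comp_apply, id_eq, smul_eq_mul, nsmul_eq_mul]
  match_scalars <;> field_simp

theorem norm_squash_le (hA : 0 < A) (v : V) : ‖squash A v‖ ≤ 1 := by
  have hpos := sqrt_add_norm_sq_pos hA v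
  rw [squash, norm_smul, Real.norm_of_nonneg (by positivity), inv_mul_le_iff₀ hpos, mul_one]
  exact norm_le_sqrt_add_norm_sq hA v

theorem norm_fderiv_squash_le (hA : 0 < A) (v : V) :
    ‖fderiv ℝ (squash A) v‖ ≤ 2 * (Real.sqrt (A + ‖v‖ ^ 2))⁻¹ := by
  have hpos := sqrt_add_norm_sq_pos hA v
  have hle := norm_le_sqrt_add_norm_sq hA v
  rw [(hasFDerivAt_squash hA v).fderiv]
  refine (norm_sub_le _ _).trans ?_
  rw [ContinuousLinearMap.norm_smulRight_apply, norm_smul, norm_smul, innerSL_apply_norm,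
    Real.norm_of_nonneg (by positivity), Real.norm_of_nonneg (by positivity)]
  set r := Real.sqrt (A + ‖v‖ ^ 2)
  calc _ ≤ r⁻¹ * 1 + r⁻¹ ^ 3 * r * r := by
        gcongr
        exact ContinuousLinearMap.norm_id_le
    _ = 2 * r⁻¹ := by
        field_simp
        norm_num

theorem norm_smul_innerSL_le (x : V) : ‖(2 / bracket x ^ 2) • innerSL ℝ x‖ ≤ 2 / bracket x := by
  have hb := bracket_pos x
  rw [norm_smul, innerSL_apply_norm, Real.norm_of_nonneg (by positivity)]
  calc _ ≤ 2 / bracket x ^ 2 * bracket x := by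
        gcongr
        exact norm_le_bracket x
    _ = 2 / bracket x := by field_simp

end Squash

section Coordinates

variable {m : ℕ} {h : ℝ → ℝ}

/-- The radial coordinate `½ ∫₀ᵗ e^h` as a function of `t = log (1 + |x|²)`. -/
def radialPrimitive (h : ℝ → ℝ) (t : ℝ) : ℝ := ∫ τ in (0 : ℝ)..t, Real.exp (h τ) / 2

/-- The radial coordinate, which up to a bounded error is the distance to the origin. -/
def radialCoord (h : ℝ → ℝ) (x : Euc m) : ℝ := radialPrimitive h (logBracket x)

/-- The position relative to `c`, normalized by the radius of the cross sections. -/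
def sphereCoord (h : ℝ → ℝ) (c x : Euc m) : Euc m :=
  radius h x • squash (1 + ‖c‖ ^ 2) (x - c)

theorem hasDerivAt_radialPrimitive (hh : Continuous h) (t : ℝ) :
    HasDerivAt (radialPrimitive h) (Real.exp (h t) / 2) t := by
  have hc : Continuous fun τ ↦ Real.exp (h τ) / 2 := by fun_prop
  exact (hc.integral_hasStrictDerivAt 0 t).hasDerivAt

theorem contDiff_radialPrimitive (hh : Continuous h) : ContDiff ℝ 1 (radialPrimitive h) := by
  refine contDiff_one_iff_deriv.2
    ⟨fun t ↦ (hasDerivAt_radialPrimitive hh t).differentiableAt, ?_⟩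
  rw [funext fun t ↦ (hasDerivAt_radialPrimitive hh t).deriv]
  fun_prop

theorem hasFDerivAt_radialCoord (hh : Continuous h) (x : Euc m) : HasFDerivAt (radialCoord h)
    ((radius h x / 2) • (2 / bracket x ^ 2) • innerSL ℝ x) x :=
  (hasDerivAt_radialPrimitive hh (logBracket x)).comp_hasFDerivAt x (hasFDerivAt_logBracket x)

theorem contDiff_radius (hh : IsProfile h) : ContDiff ℝ ∞ (radius (m := m) h) :=
  (hh.contDiff.comp contDiff_logBracket).exp

theorem norm_fderiv_radius_le (hh : IsProfile h) (x : Euc m) :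
    ‖fderiv ℝ (radius h) x‖ ≤ 1 / 16 * (radius h x / bracket x) := by
  have hradius : HasFDerivAt (radius h)
      (radius h x • deriv h (logBracket x) • (2 / bracket x ^ 2) • innerSL ℝ x) x :=
    ((hh.hasDerivAt (logBracket x)).comp_hasFDerivAt x (hasFDerivAt_logBracket x)).exp
  have hr := radius_pos h x
  have hd := hh.deriv_nonneg (logBracket x)
  rw [hradius.fderiv, norm_smul, norm_smul, Real.norm_of_nonneg hr.le, Real.norm_of_nonneg hd]
  calc _ ≤ radius h x * (1 / 32 * (2 / bracket x)) := by
        gcongr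
        exacts [hh.deriv_le _, norm_smul_innerSL_le x]
    _ = 1 / 16 * (radius h x / bracket x) := by ring

theorem abs_logBracket_sub_le (hh : IsProfile h) (x y : Euc m) :
    |logBracket x - logBracket y| ≤ 2 * rdist (profileMetric m hh) x y := by
  refine norm_sub_le_rdist_conformal (contDiff_logBracket.of_le (by simp)) zero_le_two
    (fun x ↦ ?_) x y
  rw [(hasFDerivAt_logBracket x).fderiv]
  refine (norm_smul_innerSL_le x).trans ?_
  rw [← mul_one_div]
  gcongr
  exact one_div_bracket_le_exp_logFactor hh x

theorem abs_radius_sub_le (hh : IsProfile h) (x y : Euc m) :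
    |radius h x - radius h y| ≤ 1 / 16 * rdist (profileMetric m hh) x y := by
  refine norm_sub_le_rdist_conformal ((contDiff_radius hh).of_le (by simp)) (by norm_num)
    (fun x ↦ ?_) x y
  rw [exp_logFactor]
  exact norm_fderiv_radius_le hh x

theorem abs_radialCoord_sub_le (hh : IsProfile h) (x y : Euc m) :
    |radialCoord h x - radialCoord h y| ≤ rdist (profileMetric m hh) x y := by
  have hc : ContDiff ℝ 1 (radialCoord (m := m) h) :=
    (contDiff_radialPrimitive hh.contDiff.continuous).comp (contDiff_logBracket.of_le (by simp))
  rw [← one_mul (rdist _ _ _)]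
  refine norm_sub_le_rdist_conformal hc zero_le_one (fun x ↦ ?_) x y
  have hr := radius_pos h x
  rw [(hasFDerivAt_radialCoord hh.contDiff.continuous x).fderiv, norm_smul, one_mul, exp_logFactor,
    Real.norm_of_nonneg (by positivity)]
  calc _ ≤ radius h x / 2 * (2 / bracket x) := by
        gcongr
        exact norm_smul_innerSL_le x
    _ = radius h x / bracket x := by ring

theorem norm_sphereCoord_sub_le (hh : IsProfile h) (c x y : Euc m) :
    ‖sphereCoord h c x - sphereCoord h c y‖ ≤ 4 * rdist (profileMetric m hh) x y := by
  have hA : 0 < 1 + ‖c‖ ^ 2 := by positivity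
  have hsquash : ContDiff ℝ ∞ (fun x ↦ squash (1 + ‖c‖ ^ 2) (x - c)) :=
    (contDiff_squash hA).comp (contDiff_id.sub contDiff_const)
  refine norm_sub_le_rdist_conformal (((contDiff_radius hh).smul hsquash).of_le (by simp))
    (by norm_num) (fun x ↦ ?_) x y
  have hfderiv := ((contDiff_radius hh).differentiable (by simp) x).hasFDerivAt.smul
    (hsquash.differentiable (by simp) x).hasFDerivAt
  have hb := bracket_pos x
  have hr := radius_pos h x
  refine (hfderiv.fderiv ▸ norm_add_le _ _).trans ?_
  rw [fderiv_comp_sub, norm_smul, ContinuousLinearMap.norm_smulRight_apply,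
    Real.norm_of_nonneg hr.le, exp_logFactor]
  calc _ ≤ radius h x * (2 * (3 / 2 / bracket x)) + 1 / 16 * (radius h x / bracket x) * 1 := by
        gcongr
        · exact (norm_fderiv_squash_le hA _).trans
            (mul_le_mul_of_nonneg_left (inv_sqrt_add_norm_sub_sq_le c x) zero_le_two)
        · exact norm_fderiv_radius_le hh x
        · exact norm_squash_le hA _
    _ = (3 + 1 / 16) * (radius h x / bracket x) := by ring
    _ ≤ 4 * (radius h x / bracket x) := by
        gcongr
        norm_num

end Coordinates

section UpperBounds

theorem bracket_le_of_half_norm_sq_le {V : Type*} [NormedAddCommGroup V] {x y : V}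
    (hxy : ‖x‖ ^ 2 / 2 ≤ ‖y‖ ^ 2) : bracket x ≤ 3 / 2 * bracket y := by
  have := bracket_pos y
  refine le_of_sq_le_sq ?_ (by positivity)
  rw [mul_pow, bracket_sq, bracket_sq]
  linarith [sq_nonneg ‖x‖]

theorem norm_norm_smul_sub_le {V : Type*} [NormedAddCommGroup V] [NormedSpace ℝ V] {e : V}
    (he : ‖e‖ = 1) {s : ℝ} (hs : 0 ≤ s) (v : V) : ‖‖v‖ • e - v‖ ≤ 2 * ‖s • e - v‖ := by
  have hradial : ‖‖v‖ • e - s • e‖ ≤ ‖s • e - v‖ := by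
    rw [← sub_smul, norm_smul, he, mul_one, Real.norm_eq_abs, abs_sub_comm]
    calc |s - ‖v‖| = |‖s • e‖ - ‖v‖| := by rw [norm_smul, he, mul_one, Real.norm_of_nonneg hs]
      _ ≤ ‖s • e - v‖ := abs_norm_sub_norm_le _ _
  linarith [norm_sub_le_norm_sub_add_norm_sub (‖v‖ • e) (s • e) v]

section InnerProduct

variable {V : Type*} [NormedAddCommGroup V] [InnerProductSpace ℝ V]

theorem half_norm_sq_le_of_inner_nonneg {x y : V} (hxy : ‖x‖ = ‖y‖) (hinner : 0 ≤ inner ℝ x y)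
    {t : ℝ} (ht : t ∈ Icc (0 : ℝ) 1) : ‖y‖ ^ 2 / 2 ≤ ‖x + t • (y - x)‖ ^ 2 := by
  have hcomb : x + t • (y - x) = (1 - t) • x + t • y := by module
  rw [hcomb, norm_add_sq_real, norm_smul, norm_smul, real_inner_smul_left, real_inner_smul_right,
    mul_pow, mul_pow, hxy, Real.norm_eq_abs, Real.norm_eq_abs, sq_abs, sq_abs]
  have : 0 ≤ (1 - t) * (t * inner ℝ x y) :=
    mul_nonneg (by linarith [ht.2]) (mul_nonneg ht.1 hinner)
  nlinarith [mul_nonneg (sq_nonneg (2 * t - 1)) (sq_nonneg ‖y‖)]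

theorem norm_sub_le_norm_sub_of_inner {x y z : V} (hzx : ‖z‖ = ‖x‖) (hyz : inner ℝ y z = 0)
    (hyx : inner ℝ y x ≤ 0) : ‖y - z‖ ≤ ‖y - x‖ := by
  rw [← sq_le_sq₀ (norm_nonneg _) (norm_nonneg _), norm_sub_sq_real, norm_sub_sq_real, hyz, hzx]
  linarith

theorem exists_norm_eq_inner_eq_zero [FiniteDimensional ℝ V] (hV : 3 ≤ Module.finrank ℝ V)
    (x y : V) {r : ℝ} (hr : 0 ≤ r) : ∃ z : V, ‖z‖ = r ∧ inner ℝ x z = 0 ∧ inner ℝ y z = 0 := by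
  classical
  have hspan : Submodule.span ℝ {x, y} ≠ ⊤ := by
    intro htop
    have hrank := finrank_span_finset_le_card (R := ℝ) ({x, y} : Finset V)
    have hcard : ({x, y} : Finset V).card ≤ 2 := Finset.card_le_two
    rw [Finset.coe_pair, Set.finrank, htop, finrank_top] at hrank
    omega
  obtain ⟨v, hv, hv0⟩ := Submodule.exists_mem_ne_zero_of_ne_bot
    (mt (Submodule.orthogonal_eq_bot_iff).1 hspan)
  have horth {w : V} (hw : w ∈ ({x, y} : Set V)) : inner ℝ w ((r / ‖v‖) • v) = 0 := by
    rw [inner_smul_right, (Submodule.mem_orthogonal _ _).1 hv w (Submodule.subset_span hw),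
      mul_zero]
  refine ⟨(r / ‖v‖) • v, ?_, horth (mem_insert x {y}), horth (mem_insert_of_mem x rfl)⟩
  rw [norm_smul, Real.norm_of_nonneg (by positivity), div_mul_cancel₀ _ (norm_ne_zero_iff.2 hv0)]

end InnerProduct

variable {m : ℕ} {h : ℝ → ℝ} {x y : Euc m}

theorem radius_le_of_norm_le (hh : IsProfile h) (hxy : ‖x‖ ≤ ‖y‖) : radius h x ≤ radius h y :=
  Real.exp_le_exp.2 (hh.monotone (logBracket_le_of_norm_le hxy))

theorem bracket_eq_of_norm_eq (hxy : ‖x‖ = ‖y‖) : bracket x = bracket y := by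
  rw [bracket, bracket, hxy]

theorem radius_eq_of_norm_eq (h : ℝ → ℝ) (hxy : ‖x‖ = ‖y‖) : radius h x = radius h y := by
  rw [radius, radius, logBracket, logBracket, hxy]

theorem radialCoord_eq_of_norm_eq (h : ℝ → ℝ) (hxy : ‖x‖ = ‖y‖) :
    radialCoord h x = radialCoord h y := by
  rw [radialCoord, radialCoord, logBracket, logBracket, hxy]

theorem sphereCoord_zero (h : ℝ → ℝ) (x : Euc m) :
    sphereCoord h 0 x = (radius h x / bracket x) • x := by
  rw [sphereCoord, squash, smul_smul, norm_zero, sub_zero, zero_pow two_ne_zero, add_zero,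
    bracket, div_eq_mul_inv]

theorem norm_sphereCoord_zero (h : ℝ → ℝ) (x : Euc m) :
    ‖sphereCoord h 0 x‖ = radius h x / bracket x * ‖x‖ := by
  rw [sphereCoord_zero, norm_smul, Real.norm_of_nonneg
    (div_nonneg (radius_pos h x).le (bracket_pos x).le)]

theorem norm_sphereCoord_zero_sub (h : ℝ → ℝ) (hxy : ‖x‖ = ‖y‖) :
    ‖sphereCoord h 0 x - sphereCoord h 0 y‖ = radius h y / bracket y * ‖y - x‖ := by
  rw [sphereCoord_zero, sphereCoord_zero, radius_eq_of_norm_eq h hxy, bracket_eq_of_norm_eq hxy,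
    ← smul_sub, norm_smul, Real.norm_of_nonneg (div_nonneg (radius_pos h y).le (bracket_pos y).le),
    norm_sub_rev]

theorem metricNorm_profileMetric (hh : IsProfile h) (x v : Euc m) :
    metricNorm (profileMetric m hh) x v = radius h x / bracket x * ‖v‖ := by
  rw [profileMetric, metricNorm_conformal, exp_logFactor]

theorem rdist_le_of_segment (hh : IsProfile h) {M : ℝ}
    (hM : ∀ t ∈ Icc (0 : ℝ) 1, radius h (x + t • (y - x)) / bracket (x + t • (y - x)) ≤ M) :
    rdist (profileMetric m hh) x y ≤ M * ‖y - x‖ := by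
  have hγ (t : ℝ) : HasDerivAt (fun t : ℝ ↦ x + t • (y - x)) (y - x) t := by
    simpa only [id_eq, one_smul] using ((hasDerivAt_id t).smul_const (y - x)).const_add x
  have hσ (t : ℝ) : HasDerivAt (fun t ↦ t * (M * ‖y - x‖)) (M * ‖y - x‖) t :=
    hasDerivAt_mul_const _
  have hdist := rdist_le_sub_of_speed_le (profileMetric m hh) (γ := fun t : ℝ ↦ x + t • (y - x))
    zero_le_one (ContDiff.contDiffOn (by fun_prop)) (fun t _ ↦ hσ t) continuousOn_const
    fun t ht ↦ by
      rw [(hγ t).deriv, metricNorm_profileMetric]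
      gcongr
      exact hM t ht
  simpa only [zero_smul, add_zero, one_smul, add_sub_cancel, one_mul, zero_mul, sub_zero]
    using hdist

theorem hasDerivAt_radialCoord_ray (hh : Continuous h) {e : Euc m} (he : ‖e‖ = 1) (t : ℝ) :
    HasDerivAt (fun t : ℝ ↦ radialCoord h (t • e))
      (radius h (t • e) * (t / bracket (t • e) ^ 2)) t := by
  have hray : HasDerivAt (fun t : ℝ ↦ t • e) e t := by
    simpa only [id_eq, one_smul] using (hasDerivAt_id t).smul_const e
  refine ((hasFDerivAt_radialCoord hh (t • e)).comp_hasDerivAt t hray).congr_deriv ?_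
  rw [smul_apply, smul_apply, innerSL_apply_apply, real_inner_smul_left,
    real_inner_self_eq_norm_sq, he, smul_eq_mul, smul_eq_mul]
  ring

theorem bracket_smul_le (e : Euc m) (he : ‖e‖ = 1) {t : ℝ} (ht : 1 ≤ t) :
    bracket (t • e) ≤ 2 * t := by
  refine Real.sqrt_le_iff.2 ⟨by linarith, ?_⟩
  rw [norm_smul, he, mul_one, Real.norm_eq_abs, sq_abs]
  nlinarith

theorem rdist_radial_le_sub (hh : IsProfile h) {e : Euc m} (he : ‖e‖ = 1) {a b : ℝ} (ha : 1 ≤ a)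
    (hab : a ≤ b) :
    rdist (profileMetric m hh) (a • e) (b • e) ≤
      2 * (radialCoord h (b • e) - radialCoord h (a • e)) := by
  have hray (t : ℝ) : HasDerivAt (fun t : ℝ ↦ t • e) e t := by
    simpa only [id_eq, one_smul] using (hasDerivAt_id t).smul_const e
  have hbracket : Continuous fun t : ℝ ↦ bracket (t • e) := by
    unfold bracket
    fun_prop
  have hradius : Continuous fun t : ℝ ↦ radius h (t • e) :=
    (contDiff_radius hh).continuous.comp (by fun_prop)
  have hspeed : Continuous fun t : ℝ ↦ 2 * (radius h (t • e) * (t / bracket (t • e) ^ 2)) :=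
    continuous_const.mul (hradius.mul (continuous_id.div (hbracket.pow 2)
      fun t ↦ (pow_pos (bracket_pos _) 2).ne'))
  rw [mul_sub]
  refine rdist_le_sub_of_speed_le (profileMetric m hh) (γ := fun t : ℝ ↦ t • e)
    (σ := fun t ↦ 2 * radialCoord h (t • e)) hab (ContDiff.contDiffOn (by fun_prop))
    (fun t _ ↦ (hasDerivAt_radialCoord_ray hh.contDiff.continuous he t).const_mul 2)
    hspeed.continuousOn fun t ht ↦ ?_
  have hb := bracket_pos (t • e)
  have hr := radius_pos h (t • e)
  rw [(hray t).deriv, metricNorm_profileMetric, he, mul_one]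
  calc radius h (t • e) / bracket (t • e)
      = radius h (t • e) * bracket (t • e) / bracket (t • e) ^ 2 := by field_simp
    _ ≤ radius h (t • e) * (2 * t) / bracket (t • e) ^ 2 := by
        gcongr
        exact bracket_smul_le e he (ha.trans ht.1)
    _ = 2 * (radius h (t • e) * (t / bracket (t • e) ^ 2)) := by ring

theorem rdist_radial_le (hh : IsProfile h) {e : Euc m} (he : ‖e‖ = 1) {a b : ℝ} (ha : 1 ≤ a)
    (hb : 1 ≤ b) :
    rdist (profileMetric m hh) (a • e) (b • e) ≤
      2 * |radialCoord h (a • e) - radialCoord h (b • e)| := by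
  wlog hab : a ≤ b generalizing a b
  · rw [rdist_comm, abs_sub_comm]
    exact this hb ha (le_of_not_ge hab)
  refine (rdist_radial_le_sub hh he ha hab).trans ?_
  rw [abs_sub_comm]
  gcongr
  exact le_abs_self _

theorem rdist_le_of_inner_nonneg (hh : IsProfile h) (hxy : ‖x‖ = ‖y‖)
    (hinner : 0 ≤ inner ℝ x y) :
    rdist (profileMetric m hh) x y ≤ 3 / 2 * (radius h y / bracket y) * ‖y - x‖ := by
  refine rdist_le_of_segment hh fun t ht ↦ ?_
  have hnorm := half_norm_sq_le_of_inner_nonneg hxy hinner ht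
  have hmem := (convex_closedBall (0 : Euc m) ‖y‖).add_smul_sub_mem
    (mem_closedBall_zero_iff.2 hxy.le) (mem_closedBall_zero_iff.2 le_rfl) ht
  set z := x + t • (y - x)
  have hz := bracket_pos z
  have hy := bracket_pos y
  have hr := radius_pos h y
  rw [mul_div_assoc', div_le_div_iff₀ hz hy]
  calc radius h z * bracket y ≤ radius h y * (3 / 2 * bracket z) := by
        gcongr
        exacts [radius_le_of_norm_le hh (mem_closedBall_zero_iff.1 hmem),
          bracket_le_of_half_norm_sq_le hnorm]
    _ = 3 / 2 * radius h y * bracket z := by ring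

-- If `x` and `y` form an obtuse angle, go through a point orthogonal to both of them.
theorem rdist_le_of_norm_eq (hh : IsProfile h) (hm : 3 ≤ m) (hxy : ‖x‖ = ‖y‖) :
    rdist (profileMetric m hh) x y ≤ 3 * ‖sphereCoord h 0 x - sphereCoord h 0 y‖ := by
  rw [norm_sphereCoord_zero_sub h hxy]
  have hscale : 0 < radius h y / bracket y := div_pos (radius_pos h y) (bracket_pos y)
  rcases le_or_gt 0 (inner ℝ x y : ℝ) with hinner | hinner
  · have : 0 ≤ radius h y / bracket y * ‖y - x‖ := by positivity
    linarith [rdist_le_of_inner_nonneg hh hxy hinner]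
  obtain ⟨z, hz, hxz, hyz⟩ := exists_norm_eq_inner_eq_zero
    (hm.trans_eq finrank_euclideanSpace_fin.symm) x y (norm_nonneg y)
  have hdist_xz := rdist_le_of_inner_nonneg hh (hxy.trans hz.symm) hxz.ge
  rw [radius_eq_of_norm_eq h hz, bracket_eq_of_norm_eq hz, norm_sub_rev] at hdist_xz
  have hdist_zy := rdist_le_of_inner_nonneg hh hz ((real_inner_comm y z).trans hyz).ge
  have hnorm_xz : ‖x - z‖ ≤ ‖y - x‖ :=
    (norm_sub_le_norm_sub_of_inner hz hxz hinner.le).trans_eq (norm_sub_rev x y)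
  have hnorm_zy : ‖y - z‖ ≤ ‖y - x‖ := norm_sub_le_norm_sub_of_inner (hz.trans hxy.symm) hyz
    ((real_inner_comm x y).trans_le hinner.le)
  calc rdist (profileMetric m hh) x y
      ≤ rdist (profileMetric m hh) x z + rdist (profileMetric m hh) z y := rdist_triangle _ x z y
    _ ≤ 3 / 2 * (radius h y / bracket y) * ‖y - x‖
        + 3 / 2 * (radius h y / bracket y) * ‖y - x‖ := by
        refine add_le_add (hdist_xz.trans ?_) (hdist_zy.trans ?_) <;> gcongr
    _ = 3 * (radius h y / bracket y * ‖y - x‖) := by ring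

theorem rdist_le_of_one_le_norm (hh : IsProfile h) (hm : 3 ≤ m) (hx : 1 ≤ ‖x‖) (hy : 1 ≤ ‖y‖) :
    rdist (profileMetric m hh) x y ≤ 2 * |radialCoord h x - radialCoord h y|
      + 6 * ‖sphereCoord h 0 x - sphereCoord h 0 y‖ := by
  have hx0 : ‖x‖ ≠ 0 := (zero_lt_one.trans_le hx).ne'
  obtain ⟨e, he, hxe⟩ : ∃ e : Euc m, ‖e‖ = 1 ∧ ‖x‖ • e = x :=
    ⟨‖x‖⁻¹ • x, by rw [norm_smul, norm_inv, norm_norm, inv_mul_cancel₀ hx0],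
      by rw [smul_smul, mul_inv_cancel₀ hx0, one_smul]⟩
  have hz : ‖‖y‖ • e‖ = ‖y‖ := by rw [norm_smul, he, mul_one, norm_norm]
  have hradial : rdist (profileMetric m hh) x (‖y‖ • e) ≤
      2 * |radialCoord h x - radialCoord h y| := by
    have hdist := rdist_radial_le hh he hx hy
    rwa [hxe, radialCoord_eq_of_norm_eq h hz] at hdist
  have hsphere : ‖sphereCoord h 0 (‖y‖ • e) - sphereCoord h 0 y‖ ≤
      2 * ‖sphereCoord h 0 x - sphereCoord h 0 y‖ := by
    have hy_ray : sphereCoord h 0 (‖y‖ • e) = ‖sphereCoord h 0 y‖ • e := by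
      rw [sphereCoord_zero, norm_sphereCoord_zero, radius_eq_of_norm_eq h hz,
        bracket_eq_of_norm_eq hz, smul_smul]
    have hx_ray : sphereCoord h 0 x = ‖sphereCoord h 0 x‖ • e := by
      rw [norm_sphereCoord_zero, mul_smul, hxe, sphereCoord_zero]
    rw [hy_ray, hx_ray]
    exact norm_norm_smul_sub_le he (norm_nonneg _) _
  linarith [rdist_triangle (profileMetric m hh) x (‖y‖ • e) y, rdist_le_of_norm_eq hh hm hz]

theorem radius_le_bracket (hh : IsProfile h) (x : Euc m) : radius h x ≤ bracket x := by
  rw [radius, ← exp_half_logBracket]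
  gcongr
  linarith [hh.le_div (logBracket_nonneg x), logBracket_nonneg x]

theorem rdist_le_norm_sub (hh : IsProfile h) (x y : Euc m) :
    rdist (profileMetric m hh) x y ≤ ‖y - x‖ := by
  refine (rdist_le_of_segment hh fun t _ ↦ ?_).trans_eq (one_mul _)
  exact (div_le_one (bracket_pos _)).2 (radius_le_bracket hh _)

theorem exists_one_le_norm_rdist_le (hh : IsProfile h) (hm : 0 < m) (x : Euc m) :
    ∃ x' : Euc m, 1 ≤ ‖x'‖ ∧ rdist (profileMetric m hh) x x' ≤ 4 := by
  rcases le_total 1 ‖x‖ with hx | hx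
  · exact ⟨x, hx, (rdist_self _ x).trans_le (by norm_num)⟩
  · have hnorm : ‖EuclideanSpace.single (𝕜 := ℝ) (⟨0, hm⟩ : Fin m) 1‖ = 1 := by
      rw [PiLp.norm_single, norm_one]
    refine ⟨_, hnorm.ge, (rdist_le_norm_sub hh _ _).trans ?_⟩
    linarith [norm_sub_le (EuclideanSpace.single (𝕜 := ℝ) (⟨0, hm⟩ : Fin m) 1) x]

theorem rdist_le (hh : IsProfile h) (hm : 3 ≤ m) (x y : Euc m) :
    rdist (profileMetric m hh) x y ≤ 2 * |radialCoord h x - radialCoord h y|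
      + 6 * ‖sphereCoord h 0 x - sphereCoord h 0 y‖ + 216 := by
  obtain ⟨x', hx', hxx'⟩ := exists_one_le_norm_rdist_le hh (by omega) x
  obtain ⟨y', hy', hyy'⟩ := exists_one_le_norm_rdist_le hh (by omega) y
  have hx'y' := rdist_le_of_one_le_norm hh hm hx' hy'
  rw [← Real.dist_eq, ← dist_eq_norm] at hx'y' ⊢
  have hradial : dist (radialCoord h x') (radialCoord h y') ≤
      dist (radialCoord h x) (radialCoord h y) + 8 := by
    have hx_near := (abs_radialCoord_sub_le hh x x').trans hxx'
    have hy_near := (abs_radialCoord_sub_le hh y y').trans hyy'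
    rw [← Real.dist_eq] at hx_near hy_near
    have := dist_triangle4_left (radialCoord h x) (radialCoord h y) (radialCoord h x')
      (radialCoord h y')
    linarith
  have hsphere : dist (sphereCoord h 0 x') (sphereCoord h 0 y') ≤
      dist (sphereCoord h 0 x) (sphereCoord h 0 y) + 32 := by
    have hx_near := norm_sphereCoord_sub_le hh 0 x x'
    have hy_near := norm_sphereCoord_sub_le hh 0 y y'
    rw [← dist_eq_norm] at hx_near hy_near
    have := dist_triangle4_left (sphereCoord h 0 x) (sphereCoord h 0 y) (sphereCoord h 0 x')
      (sphereCoord h 0 y')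
    linarith
  have htriangle_x := rdist_triangle (profileMetric m hh) x x' y
  have htriangle_y := rdist_triangle (profileMetric m hh) x' y' y
  rw [rdist_comm _ y' y] at htriangle_y
  linarith

end UpperBounds

/-! ### Completeness, contractibility and curvature decay -/

section Completeness

variable {m : ℕ} {h : ℝ → ℝ}

/-- The identity map: the Riemannian distance induces the topology of `ℝ^m`. -/
def homeomorphEuc (g : SmoothMetric m) : RiemannianSpace g ≃ₜ Euc m where
  toFun x := x
  invFun x := x
  left_inv _ := rfl
  right_inv _ := rfl
  continuous_toFun := continuous_id (X := Euc m)
  continuous_invFun := continuous_id (X := Euc m)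

theorem logBracket_le_of_rdist_le (hh : IsProfile h) {x y : Euc m} {r : ℝ}
    (hr : rdist (profileMetric m hh) x y ≤ r) : logBracket y ≤ logBracket x + 2 * r := by
  linarith [(abs_sub_le_iff.1 (abs_logBracket_sub_le hh x y)).2]

theorem completeSpace_profileMetric (hh : IsProfile h) :
    CompleteSpace (RiemannianSpace (profileMetric m hh)) := by
  refine Metric.complete_of_cauchySeq_tendsto fun u hu ↦ ?_
  let E := homeomorphEuc (profileMetric m hh)
  obtain ⟨R, -, hR⟩ := cauchySeq_bdd hu
  set K := Metric.closedBall (0 : Euc m) (Real.exp ((logBracket (E (u 0)) + 2 * R) / 2))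
  have hmem (n : ℕ) : E (u n) ∈ K :=
    mem_closedBall_zero_iff.2 (norm_le_of_logBracket_le (logBracket_le_of_rdist_le hh (hR 0 n).le))
  have hcomplete : IsComplete (E.symm '' K) :=
    ((isCompact_closedBall _ _).image E.symm.continuous).isComplete
  obtain ⟨x, -, hx⟩ := cauchySeq_tendsto_of_isComplete hcomplete
    (fun n ↦ ⟨E (u n), hmem n, E.symm_apply_apply _⟩) hu
  exact ⟨x, hx⟩

end Completeness

section Contractibility

theorem exists_monotone_forall_le {α : Type*} {P Q : α → ℝ}
    (hPQ : ∀ r : ℝ≥0, ∃ M, ∀ a, P a ≤ r → Q a ≤ M) :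
    ∃ R : ℝ≥0 → ℝ≥0, Monotone R ∧ (∀ r, r ≤ R r) ∧
      ∀ (r : ℝ≥0) a, P a ≤ r → Q a ≤ R r := by
  let S : ℝ≥0 → Set ℝ≥0 := fun r ↦ (fun a ↦ (Q a).toNNReal) '' {a | P a ≤ r}
  have hbdd (r : ℝ≥0) : BddAbove (S r) := by
    obtain ⟨M, hM⟩ := hPQ r
    exact ⟨M.toNNReal, forall_mem_image.2 fun a ha ↦ Real.toNNReal_le_toNNReal (hM a ha)⟩
  have hmono : Monotone S := fun r s hrs ↦
    image_mono fun a ha ↦ le_trans ha (NNReal.coe_le_coe.2 hrs)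
  refine ⟨fun r ↦ r ⊔ sSup (S r),
    fun r s hrs ↦ sup_le_sup hrs (csSup_le_csSup' (hbdd s) (hmono hrs)), fun r ↦ le_sup_left,
    fun r a ha ↦ (Real.le_coe_toNNReal _).trans (NNReal.coe_le_coe.2 ?_)⟩
  exact (le_csSup (hbdd r) (mem_image_of_mem _ ha)).trans le_sup_right

variable {m : ℕ}

theorem uniformlyContractible_of_segment (g : SmoothMetric m)
    (hseg : ∀ r : ℝ≥0, ∃ M, ∀ x y : Euc m, rdist g x y ≤ r → ∀ t ∈ Icc (0 : ℝ) 1,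
      rdist g x (x + t • (y - x)) ≤ M) : UniformlyContractible (RiemannianSpace g) := by
  obtain ⟨R, hR_mono, hR_le, hR⟩ := exists_monotone_forall_le
    (α := Euc m × Euc m × Icc (0 : ℝ) 1) (P := fun p ↦ rdist g p.1 p.2.1)
    (Q := fun p ↦ rdist g p.1 (p.1 + p.2.2.1 • (p.2.1 - p.1))) fun r ↦
      (hseg r).imp fun M hM p hp ↦ hM _ _ hp _ p.2.2.2
  refine ⟨R, hR_mono, hR_le, fun x r ↦ ?_⟩
  let E := homeomorphEuc g
  let f (p : Metric.closedBall x (r : ℝ) × unitInterval) : RiemannianSpace g :=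
    E.symm (E x + (1 - (p.2 : ℝ)) • (E p.1 - E x))
  have hf : Continuous f := by fun_prop
  have hmem (p) : f p ∈ Metric.closedBall x (R r : ℝ) := by
    obtain ⟨⟨y, hy⟩, t⟩ := p
    rw [Metric.mem_closedBall, dist_comm] at hy ⊢
    exact hR r (E x, E y, ⟨1 - t, Set.Icc.mem_iff_one_sub_mem.1 t.2⟩) hy
  refine ⟨⟨fun p ↦ ⟨f p, hmem p⟩, hf.subtype_mk _⟩, fun y ↦ ⟨?_, ?_⟩⟩
  · change E.symm (E x + (1 - (0 : ℝ)) • (E y - E x)) = y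
    rw [sub_zero, one_smul, add_sub_cancel, E.symm_apply_apply]
  · change E.symm (E x + (1 - (1 : ℝ)) • (E y - E x)) = x
    rw [sub_self, zero_smul, add_zero, E.symm_apply_apply]

theorem norm_le_two_mul_norm_squash {V : Type*} [NormedAddCommGroup V] [InnerProductSpace ℝ V]
    {A : ℝ} (hA : 0 < A) {v : V} (hv : ‖squash A v‖ ≤ 1 / 4) :
    ‖v‖ ≤ 2 * ‖squash A v‖ * Real.sqrt A := by
  have hpos := sqrt_add_norm_sq_pos hA v
  have hnorm : ‖v‖ ^ 2 = ‖squash A v‖ ^ 2 * (A + ‖v‖ ^ 2) := by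
    rw [squash, norm_smul, norm_inv, Real.norm_of_nonneg hpos.le, mul_pow, inv_pow,
      Real.sq_sqrt (by positivity)]
    field_simp
  have hsq : ‖squash A v‖ ^ 2 ≤ (1 / 4) ^ 2 := by gcongr
  refine le_of_sq_le_sq ?_ (by positivity)
  rw [mul_pow, Real.sq_sqrt hA.le, mul_pow]
  nlinarith [mul_le_mul_of_nonneg_right hsq (sq_nonneg ‖v‖),
    mul_nonneg (sq_nonneg ‖squash A v‖) hA.le]

variable {h : ℝ → ℝ} {x y : Euc m} {r : ℝ}

theorem sphereCoord_self (h : ℝ → ℝ) (x : Euc m) : sphereCoord h x x = 0 := by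
  rw [sphereCoord, squash, sub_self, smul_zero, smul_zero]

theorem norm_sub_le_of_rdist_le (hh : IsProfile h)
    (hr : rdist (profileMetric m hh) x y ≤ r) (hradius : 32 * r ≤ radius h x) :
    ‖y - x‖ ≤ 16 * r / radius h x * bracket x := by
  have hx := radius_pos h x
  have hb := bracket_pos x
  have hy : radius h x / 2 ≤ radius h y := by
    linarith [(abs_sub_le_iff.1 (abs_radius_sub_le hh x y)).1]
  have hsphere := norm_sphereCoord_sub_le hh x x y
  rw [sphereCoord_self, zero_sub, norm_neg, sphereCoord, norm_smul,
    Real.norm_of_nonneg (radius_pos h y).le] at hsphere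
  have hsquash : ‖squash (1 + ‖x‖ ^ 2) (y - x)‖ ≤ 8 * r / radius h x := by
    rw [le_div_iff₀ hx]
    linarith [mul_le_mul_of_nonneg_right hy (norm_nonneg (squash (1 + ‖x‖ ^ 2) (y - x)))]
  have hquarter : 8 * r / radius h x ≤ 1 / 4 := by
    rw [div_le_iff₀ hx]
    linarith
  calc ‖y - x‖ ≤ 2 * ‖squash (1 + ‖x‖ ^ 2) (y - x)‖ * bracket x :=
        norm_le_two_mul_norm_squash (by positivity) (hsquash.trans hquarter)
    _ ≤ 2 * (8 * r / radius h x) * bracket x := by gcongr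
    _ = 16 * r / radius h x * bracket x := by ring

theorem radius_segment_le_max (hh : IsProfile h) (x y : Euc m) {t : ℝ}
    (ht : t ∈ Icc (0 : ℝ) 1) :
    radius h (x + t • (y - x)) ≤ max (radius h x) (radius h y) := by
  have hmem := (convex_closedBall (0 : Euc m) (max ‖x‖ ‖y‖)).add_smul_sub_mem
    (mem_closedBall_zero_iff.2 (le_max_left _ _)) (mem_closedBall_zero_iff.2 (le_max_right _ _)) ht
  exact le_max_iff.2 ((le_max_iff.1 (mem_closedBall_zero_iff.1 hmem)).imp
    (radius_le_of_norm_le hh) (radius_le_of_norm_le hh))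

theorem norm_smul_le_of_mem_Icc {V : Type*} [NormedAddCommGroup V] [NormedSpace ℝ V] (v : V)
    {t : ℝ} (ht : t ∈ Icc (0 : ℝ) 1) : ‖t • v‖ ≤ ‖v‖ := by
  rw [norm_smul, Real.norm_of_nonneg ht.1]
  exact mul_le_of_le_one_left (norm_nonneg _) ht.2

theorem rdist_segment_le_mul_norm (hh : IsProfile h) (hnorm : ‖y - x‖ ≤ bracket x / 2)
    (hradius : radius h y ≤ 2 * radius h x) {t : ℝ} (ht : t ∈ Icc (0 : ℝ) 1) :
    rdist (profileMetric m hh) x (x + t • (y - x)) ≤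
      4 * radius h x / bracket x * ‖y - x‖ := by
  have hx := radius_pos h x
  have hb := bracket_pos x
  have hscale : ∀ s ∈ Icc (0 : ℝ) 1, radius h (x + s • (x + t • (y - x) - x)) /
      bracket (x + s • (x + t • (y - x) - x)) ≤ 4 * radius h x / bracket x := by
    intro s hs
    have hst : s * t ∈ Icc (0 : ℝ) 1 := ⟨mul_nonneg hs.1 ht.1, mul_le_one₀ hs.2 ht.1 ht.2⟩
    rw [add_sub_cancel_left, smul_smul]
    have hradius_z := (radius_segment_le_max hh x y hst).trans
      (max_le (by linarith) hradius : _ ≤ 2 * radius h x)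
    have hbracket_z := bracket_le_add x (x + (s * t) • (y - x))
    rw [sub_add_cancel_left, norm_neg] at hbracket_z
    have := norm_smul_le_of_mem_Icc (y - x) hst
    rw [div_le_div_iff₀ (bracket_pos _) hb]
    calc _ ≤ (2 * radius h x) * (2 * bracket (x + (s * t) • (y - x))) := by
          gcongr
          linarith
      _ = 4 * radius h x * bracket (x + (s * t) • (y - x)) := by ring
  refine (rdist_le_of_segment hh hscale).trans ?_
  rw [add_sub_cancel_left]
  gcongr
  exact norm_smul_le_of_mem_Icc _ ht

theorem rdist_segment_le_of_radius_ge (hh : IsProfile h)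
    (hr : rdist (profileMetric m hh) x y ≤ r) (hradius : 32 * r ≤ radius h x) {t : ℝ}
    (ht : t ∈ Icc (0 : ℝ) 1) : rdist (profileMetric m hh) x (x + t • (y - x)) ≤ 64 * r := by
  have hx := radius_pos h x
  have hb := bracket_pos x
  have hnorm := norm_sub_le_of_rdist_le hh hr hradius
  have hhalf : 16 * r / radius h x ≤ 1 / 2 := by
    rw [div_le_iff₀ hx]
    linarith
  have hnear : ‖y - x‖ ≤ bracket x / 2 := by
    linarith [mul_le_mul_of_nonneg_right hhalf hb.le]
  have hy : radius h y ≤ 2 * radius h x := by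
    linarith [(abs_sub_le_iff.1 (abs_radius_sub_le hh x y)).2]
  calc _ ≤ 4 * radius h x / bracket x * ‖y - x‖ := rdist_segment_le_mul_norm hh hnear hy ht
    _ ≤ 4 * radius h x / bracket x * (16 * r / radius h x * bracket x) := by gcongr
    _ = 64 * r := by
      field_simp
      ring

-- Where the radius exceeds `32 r` the segments are controlled by the sphere coordinate; the
-- remaining points lie in a compact set.
theorem exists_rdist_segment_le (m : ℕ) (hh : IsProfile h) (r : ℝ≥0) :
    ∃ M, ∀ x y : Euc m, rdist (profileMetric m hh) x y ≤ r → ∀ t ∈ Icc (0 : ℝ) 1,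
      rdist (profileMetric m hh) x (x + t • (y - x)) ≤ M := by
  obtain ⟨T, hT⟩ := (tendsto_atTop.1 (Real.tendsto_exp_atTop.comp hh.tendsto)
    (32 * r)).exists_forall_of_atTop
  refine ⟨max (64 * r) (2 * Real.exp ((T + 2 * r) / 2)), fun x y hxy t ht ↦ ?_⟩
  rcases le_total T (logBracket x) with hx | hx
  · exact (rdist_segment_le_of_radius_ge hh hxy (hT _ hx) ht).trans (le_max_left _ _)
  refine le_max_of_le_right ((rdist_le_norm_sub hh _ _).trans ?_)
  rw [add_sub_cancel_left]
  have hnorm_x : ‖x‖ ≤ Real.exp ((T + 2 * r) / 2) :=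
    norm_le_of_logBracket_le (by linarith [r.coe_nonneg])
  have hnorm_y : ‖y‖ ≤ Real.exp ((T + 2 * r) / 2) :=
    norm_le_of_logBracket_le (by linarith [logBracket_le_of_rdist_le hh hxy])
  linarith [norm_smul_le_of_mem_Icc (y - x) ht, norm_sub_le y x]

theorem uniformlyContractible_profileMetric (hh : IsProfile h) :
    UniformlyContractible (RiemannianSpace (profileMetric m hh)) :=
  uniformlyContractible_of_segment _ (exists_rdist_segment_le m hh)

end Contractibility

section CurvatureDecay

variable {m : ℕ} {h : ℝ → ℝ}

theorem exp_neg_le_iInf_scalarCurvature (hh : IsProfile h) (hm : 3 ≤ m)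
    (x₀ : RiemannianSpace (profileMetric m hh)) {r : ℝ≥0} (hr : logBracket (V := Euc m) x₀ ≤ r) :
    Real.exp (-(2 * h (3 * r))) ≤
      ⨅ x : Metric.closedBall x₀ (r : ℝ), scalarCurvature (profileMetric m hh) x.1 := by
  have : Nonempty (Metric.closedBall x₀ (r : ℝ)) := ⟨x₀, Metric.mem_closedBall_self r.2⟩
  refine le_ciInf fun x ↦ le_trans ?_ (exp_neg_le_scalarCurvature hh hm x.1)
  have hdist : rdist (profileMetric m hh) x₀ x.1 ≤ r := Metric.mem_closedBall'.1 x.2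
  have hlog := logBracket_le_of_rdist_le hh hdist
  gcongr
  exact hh.monotone (by linarith)

theorem tendsto_mul_iInf_scalarCurvature (hh : IsProfile h) (hm : 3 ≤ m) {G : ℝ≥0 → ℝ}
    (hG : Tendsto G atTop atTop) (hhG : ∀ r : ℝ≥0, Real.exp (4 * h (3 * r)) ≤ max 1 (G r))
    (x₀ : RiemannianSpace (profileMetric m hh)) :
    Tendsto (fun r : ℝ≥0 ↦ G r *
      ⨅ x : Metric.closedBall x₀ (r : ℝ), scalarCurvature (profileMetric m hh) x.1)
      atTop atTop := by
  refine tendsto_atTop_mono' atTop ?_ (Real.tendsto_sqrt_atTop.comp hG)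
  filter_upwards [hG.eventually_ge_atTop 1, NNReal.tendsto_coe_atTop.2 tendsto_id
    |>.eventually_ge_atTop (logBracket (V := Euc m) x₀)] with r hGr hr
  have hG0 : 0 ≤ G r := zero_le_one.trans hGr
  have hsqrt : Real.exp (2 * h (3 * r)) ≤ √(G r) := by
    refine Real.le_sqrt_of_sq_le ?_
    rw [← Real.exp_nat_mul]
    convert (hhG r).trans_eq (max_eq_right hGr) using 2
    push_cast
    ring
  calc √(G r) = G r / √(G r) := Real.div_sqrt.symm
    _ ≤ G r / Real.exp (2 * h (3 * r)) := by gcongr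
    _ = G r * Real.exp (-(2 * h (3 * r))) := by rw [Real.exp_neg, div_eq_mul_inv]
    _ ≤ _ := mul_le_mul_of_nonneg_left (exp_neg_le_iInf_scalarCurvature hh hm x₀ hr) hG0

end CurvatureDecay

/-! ### Asymptotic dimension -/

section Colours

theorem add_two_le_of_ediv_lt_ediv {a b N : ℤ} (hN : 0 < N) (hb : ¬N ∣ b) (h : a / N < b / N) :
    a + 2 ≤ b := by
  have ha : a < (a / N + 1) * N := Int.lt_ediv_add_one_mul_self a hN
  have hle : (a / N + 1) * N ≤ b / N * N := Int.mul_le_mul_of_nonneg_right h hN.le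
  have hlt : b / N * N < b :=
    (Int.ediv_mul_le b hN.ne').lt_of_ne fun heq ↦ hb (heq ▸ Int.dvd_mul_left _ _)
  lia

theorem abs_sub_lt_of_ediv_eq_ediv {a b N : ℤ} (hN : 0 < N) (h : a / N = b / N) : |a - b| < N := by
  have ha := Int.mul_ediv_add_emod a N
  have hb := Int.mul_ediv_add_emod b N
  rw [h] at ha
  rw [abs_lt]
  constructor <;> linarith [Int.emod_nonneg a hN.ne', Int.emod_nonneg b hN.ne',
    Int.emod_lt_of_pos a hN, Int.emod_lt_of_pos b hN]

/-- The point `t` lies in a gap between the intervals of colour `c`. The line is cut into segments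
of length `ℓ`; every `(n + 1)`-st segment, starting from the `c`-th, is a gap of colour `c`, and
the `n` segments between two consecutive gaps form an interval. -/
def InGap (n : ℕ) (ℓ : ℝ) (c : Fin (n + 1)) (t : ℝ) : Prop :=
  (n + 1 : ℤ) ∣ ⌊t / ℓ⌋ - (c : ℤ)

/-- The index of the interval of colour `c` that contains `t`. -/
def blockIndex (n : ℕ) (ℓ : ℝ) (c : Fin (n + 1)) (t : ℝ) : ℤ :=
  (⌊t / ℓ⌋ - (c : ℤ)) / (n + 1 : ℤ)

variable {n : ℕ} {ℓ : ℝ} {c : Fin (n + 1)} {s t : ℝ}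

theorem InGap.unique {c' : Fin (n + 1)} (hc : InGap n ℓ c t) (hc' : InGap n ℓ c' t) : c = c' := by
  have hdvd : (n + 1 : ℤ) ∣ c' - c := by simpa only [sub_sub_sub_cancel_left] using dvd_sub hc hc'
  have hlt : |(c' - c : ℤ)| < n + 1 := by
    rw [abs_lt]
    constructor <;> omega
  have heq : (c' - c : ℤ) = 0 := Int.eq_zero_of_abs_lt_dvd hdvd hlt
  ext
  omega

theorem lt_sub_of_blockIndex_lt (hℓ : 0 < ℓ) (ht : ¬InGap n ℓ c t)
    (h : blockIndex n ℓ c s < blockIndex n ℓ c t) : ℓ < t - s := by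
  have hfloor : ⌊s / ℓ⌋ + 2 ≤ ⌊t / ℓ⌋ := by
    linarith [add_two_le_of_ediv_lt_ediv (by positivity) ht h]
  have hfloor' : (⌊s / ℓ⌋ : ℝ) + 2 ≤ ⌊t / ℓ⌋ := by exact_mod_cast hfloor
  have hdiv : s / ℓ + 1 < t / ℓ := by
    linarith [Int.lt_floor_add_one (s / ℓ), Int.floor_le (t / ℓ)]
  rw [div_add_one hℓ.ne', div_lt_div_iff_of_pos_right hℓ] at hdiv
  linarith

theorem blockIndex_eq_of_abs_sub_lt (hℓ : 0 < ℓ) (hs : ¬InGap n ℓ c s) (ht : ¬InGap n ℓ c t)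
    (h : |s - t| < ℓ) : blockIndex n ℓ c s = blockIndex n ℓ c t := by
  rw [abs_lt] at h
  rcases lt_trichotomy (blockIndex n ℓ c s) (blockIndex n ℓ c t) with hlt | heq | hgt
  · linarith [lt_sub_of_blockIndex_lt hℓ ht hlt]
  · exact heq
  · linarith [lt_sub_of_blockIndex_lt hℓ hs hgt]

theorem abs_sub_le_of_blockIndex_eq (hℓ : 0 < ℓ)
    (h : blockIndex n ℓ c s = blockIndex n ℓ c t) : |s - t| ≤ (n + 1) * ℓ := by
  have hfloor := abs_sub_lt_of_ediv_eq_ediv (by positivity) h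
  rw [sub_sub_sub_cancel_right, Int.lt_add_one_iff, abs_le] at hfloor
  have hlower : -(n : ℝ) ≤ ⌊s / ℓ⌋ - ⌊t / ℓ⌋ := by exact_mod_cast hfloor.1
  have hupper : (⌊s / ℓ⌋ : ℝ) - ⌊t / ℓ⌋ ≤ n := by exact_mod_cast hfloor.2
  have hdiv : |s / ℓ - t / ℓ| ≤ n + 1 := by
    rw [abs_le]
    constructor <;> linarith [Int.lt_floor_add_one (s / ℓ), Int.floor_le (s / ℓ),
      Int.lt_floor_add_one (t / ℓ), Int.floor_le (t / ℓ)]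
  rwa [← sub_div, abs_div, abs_of_pos hℓ, div_le_iff₀ hℓ] at hdiv

theorem exists_forall_not_inGap (ℓ : ℝ) (p : Fin n → ℝ) :
    ∃ c : Fin (n + 1), ∀ i, ¬InGap n ℓ c (p i) := by
  by_contra! hgap
  choose f hf using hgap
  have hinj : Function.Injective f := fun c c' hcc' ↦ (hf c).unique (hcc' ▸ hf c')
  simpa using Fintype.card_le_of_injective f hinj

end Colours

section Boxes

variable {X : Type*} [PseudoMetricSpace X] {n : ℕ}

theorem encard_meeting_closedBall_le {ι : Type*} {V : Fin n → ι → Set X} {r : ℝ}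
    (hV : ∀ c i j, ∀ y ∈ V c i, ∀ z ∈ V c j, dist y z ≤ 2 * r → V c i = V c j) (x : X) :
    {U ∈ range fun q : Fin n × ι ↦ V q.1 q.2 |
      (U ∩ Metric.closedBall x r).Nonempty}.encard ≤ n := by
  set S := {U ∈ range fun q : Fin n × ι ↦ V q.1 q.2 | (U ∩ Metric.closedBall x r).Nonempty}
  have hS (U : S) : ∃ c i, U.1 = V c i := by
    obtain ⟨⟨q, hq⟩, -⟩ := U.2
    exact ⟨q.1, q.2, hq.symm⟩
  choose colour i hcolour using hS
  have hinj : Function.Injective colour := fun U U' hUU' ↦ by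
    obtain ⟨y, hyU, hyx⟩ := U.2.2
    obtain ⟨z, hzU, hzx⟩ := U'.2.2
    have hyz : dist y z ≤ 2 * r := by
      linarith [dist_triangle_right y z x, Metric.mem_closedBall.1 hyx, Metric.mem_closedBall.1 hzx]
    rw [hcolour] at hyU hzU
    rw [← hUU'] at hzU
    rw [Subtype.ext_iff, hcolour U, hcolour U', ← hUU']
    exact hV _ _ _ y hyU z hzU hyz
  simpa using ENat.card_le_card_of_injective hinj

/-- The points all of whose coordinates `p i` lie in intervals of colour `c`, the `i`-th one in the
interval of index `k i`. -/
def box (p : Fin n → X → ℝ) (ℓ : ℝ) (c : Fin (n + 1)) (k : Fin n → ℤ) : Set X :=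
  {x | ∀ i, ¬InGap n ℓ c (p i x) ∧ blockIndex n ℓ c (p i x) = k i}

/-- A box if its diameter is at most `D`, and otherwise one of its halves. -/
def boxPiece (p : Fin n → X → ℝ) (half : X → Bool) (ℓ D : ℝ) (c : Fin (n + 1))
    (q : (Fin n → ℤ) × Bool) : Set X :=
  {x ∈ box p ℓ c q.1 | (∀ y ∈ box p ℓ c q.1, ∀ z ∈ box p ℓ c q.1, dist y z ≤ D) ∨ half x = q.2}

variable {p : Fin n → X → ℝ} {half : X → Bool} {ℓ D M : ℝ} {c : Fin (n + 1)} {x y z : X}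

theorem exists_mem_boxPiece (p : Fin n → X → ℝ) (half : X → Bool) (ℓ D : ℝ) (x : X) :
    ∃ c q, x ∈ boxPiece p half ℓ D c q := by
  obtain ⟨c, hc⟩ := exists_forall_not_inGap ℓ fun i ↦ p i x
  exact ⟨c, (fun i ↦ blockIndex n ℓ c (p i x), half x), fun i ↦ ⟨hc i, rfl⟩, Or.inr rfl⟩

theorem dist_le_of_mem_boxPiece {q : (Fin n → ℤ) × Bool} (hMD : M ≤ D)
    (hM : ∀ y ∈ box p ℓ c q.1, ∀ z ∈ box p ℓ c q.1, half y = half z → dist y z ≤ M)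
    (hy : y ∈ boxPiece p half ℓ D c q) (hz : z ∈ boxPiece p half ℓ D c q) : dist y z ≤ D := by
  rcases hy.2 with hsmall | hy_half
  · exact hsmall y hy.1 z hz.1
  rcases hz.2 with hsmall | hz_half
  · exact hsmall y hy.1 z hz.1
  exact (hM y hy.1 z hz.1 (hy_half.trans hz_half.symm)).trans hMD

theorem dist_le_of_close_halves {B : Set X} {s : ℝ}
    (hM : ∀ u ∈ B, ∀ v ∈ B, half u = half v → dist u v ≤ M)
    (hy : y ∈ B) (hz : z ∈ B) (hyz : half y ≠ half z) (hs : dist y z ≤ s) {u v : X}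
    (hu : u ∈ B) (hv : v ∈ B) : dist u v ≤ 2 * M + s := by
  have hs0 : 0 ≤ s := dist_nonneg.trans hs
  have hM0 : 0 ≤ M := dist_nonneg.trans (hM y hy y hy rfl)
  by_cases huv : half u = half v
  · linarith [hM u hu v hv huv]
  by_cases huy : half u = half y
  · have hzv : half z = half v := by rw [Bool.eq_not.2 hyz.symm, Bool.eq_not.2 (Ne.symm huv), huy]
    linarith [dist_triangle4 u y z v, hM u hu y hy huy, hM z hz v hv hzv]
  · have huz : half u = half z := by rw [Bool.eq_not.2 huy, Bool.eq_not.2 hyz.symm]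
    have hyv : half y = half v := by rw [Bool.eq_not.2 (Ne.symm huy), Bool.eq_not.2 (Ne.symm huv)]
    linarith [dist_triangle4 u z y v, hM u hu z hz huz, hM y hy v hv hyv, dist_comm y z]

theorem eq_of_mem_box_of_dist_le {k k' : Fin n → ℤ} {K s : ℝ} (hℓ : 0 < ℓ)
    (hp : ∀ i x y, |p i x - p i y| ≤ K * dist x y) (hs : ∀ d ≤ s, K * d < ℓ)
    (hy : y ∈ box p ℓ c k) (hz : z ∈ box p ℓ c k') (hyz : dist y z ≤ s) : k = k' := by
  funext i
  rw [← (hy i).2, ← (hz i).2]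
  exact blockIndex_eq_of_abs_sub_lt hℓ (hy i).1 (hz i).1 ((hp i y z).trans_lt (hs _ hyz))

theorem boxPiece_eq_of_dist_le {q q' : (Fin n → ℤ) × Bool} {K s : ℝ} (hℓ : 0 < ℓ)
    (hp : ∀ i x y, |p i x - p i y| ≤ K * dist x y) (hs : ∀ d ≤ s, K * d < ℓ)
    (hM : ∀ y ∈ box p ℓ c q.1, ∀ z ∈ box p ℓ c q.1, half y = half z → dist y z ≤ M)
    (hMD : 2 * M + s ≤ D) (hy : y ∈ boxPiece p half ℓ D c q)
    (hz : z ∈ boxPiece p half ℓ D c q') (hyz : dist y z ≤ s) :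
    boxPiece p half ℓ D c q = boxPiece p half ℓ D c q' := by
  obtain ⟨k, e⟩ := q
  obtain ⟨k', e'⟩ := q'
  obtain rfl : k = k' := eq_of_mem_box_of_dist_le hℓ hp hs hy.1 hz.1 hyz
  by_cases hsmall : ∀ u ∈ box p ℓ c k, ∀ v ∈ box p ℓ c k, dist u v ≤ D
  · ext x
    exact and_congr_right fun _ ↦ iff_of_true (Or.inl hsmall) (Or.inl hsmall)
  have hyz_half : half y = half z := by
    by_contra hne
    exact hsmall fun u hu v hv ↦
      (dist_le_of_close_halves hM hy.1 hz.1 hne hyz hu hv).trans hMD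
  obtain rfl : e = e' :=
    (hy.2.resolve_left hsmall).symm.trans (hyz_half.trans (hz.2.resolve_left hsmall))
  rfl

end Boxes

-- A box may have two far apart halves. It is split unless the halves come close to each other, in
-- which case the whole box has controlled diameter.
theorem asdimLEWith_of_coordinates {X : Type*} [MetricSpace X] {n : ℕ} {K a b : ℝ≥0} (hK : 0 < K)
    (p : Fin n → X → ℝ) (hp : ∀ i x y, |p i x - p i y| ≤ K * dist x y) (half : X → Bool)
    (hd : ∀ ℓ : ℝ, 0 < ℓ → ∀ x y, half x = half y → (∀ i, |p i x - p i y| ≤ (n + 1) * ℓ) →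
      dist x y ≤ a * ℓ + b) :
    AsdimLEWith X n (fun r ↦ (6 * K * a + 2) * r + 2 * b) := by
  refine ⟨fun r r' hr ↦ by dsimp only; gcongr, fun r ↦ ?_, fun r hr ↦ ?_⟩
  · calc r ≤ (2 : ℝ≥0) * r := le_mul_of_one_le_left' one_le_two
      _ ≤ (6 * K * a + 2) * r + 2 * b := le_add_right (by gcongr; exact le_add_self)
  set ℓ : ℝ := 3 * K * r
  set M : ℝ := a * ℓ + b
  set D : ℝ := (((6 * K * a + 2) * r + 2 * b : ℝ≥0) : ℝ)
  have hK0 : (0 : ℝ) < K := hK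
  have hr0 : (0 : ℝ) < r := hr
  have hℓ : 0 < ℓ := by positivity
  have hM0 : 0 ≤ M := by positivity
  have hD : 2 * M + 2 * r = D := by
    simp only [M, ℓ, D]
    push_cast
    ring
  have hM (c k) : ∀ y ∈ box p ℓ c k, ∀ z ∈ box p ℓ c k, half y = half z → dist y z ≤ M :=
    fun y hy z hz hyz ↦ hd ℓ hℓ y z hyz fun i ↦
      abs_sub_le_of_blockIndex_eq hℓ ((hy i).2.trans (hz i).2.symm)
  have hshort : ∀ d ≤ 2 * (r : ℝ), K * d < ℓ := fun d hdr ↦ by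
    calc K * d ≤ K * (2 * r) := by gcongr
      _ < ℓ := by simp only [ℓ]; linarith [mul_pos hK0 hr0]
  refine ⟨range fun q : Fin (n + 1) × (Fin n → ℤ) × Bool ↦ boxPiece p half ℓ D q.1 q.2,
    ?_, ?_, fun x ↦ ?_⟩
  · refine eq_univ_of_forall fun x ↦ ?_
    obtain ⟨c, q, hx⟩ := exists_mem_boxPiece p half ℓ D x
    exact ⟨_, ⟨(c, q), rfl⟩, hx⟩
  · rintro _ ⟨⟨c, q⟩, rfl⟩ y hy z hz
    exact dist_le_of_mem_boxPiece (by linarith) (hM c q.1) hy hz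
  · have hpieces (c q q') : ∀ y ∈ boxPiece p half ℓ D c q, ∀ z ∈ boxPiece p half ℓ D c q',
        dist y z ≤ 2 * r → boxPiece p half ℓ D c q = boxPiece p half ℓ D c q' :=
      fun y hy z hz ↦ boxPiece_eq_of_dist_le hℓ hp hshort (hM c q.1) hD.le hy hz
    simpa only [Nat.cast_add, Nat.cast_one] using encard_meeting_closedBall_le hpieces x

section Octahedral

variable {m : ℕ}

/-- The `ℓ¹` norm on `ℝ^m`. -/
def taxicab (x : Euc m) : ℝ := ∑ i, |x i|

theorem taxicab_nonneg (x : Euc m) : 0 ≤ taxicab x := Finset.sum_nonneg fun _ _ ↦ abs_nonneg _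

theorem taxicab_le (x : Euc m) : taxicab x ≤ m * ‖x‖ :=
  (Finset.sum_le_sum fun i _ ↦ abs_coord_le_norm x i).trans_eq <| by
    rw [Finset.sum_const, Finset.card_univ, Fintype.card_fin, nsmul_eq_mul]

theorem norm_le_taxicab (x : Euc m) : ‖x‖ ≤ taxicab x := by
  rw [← sq_le_sq₀ (norm_nonneg _) (taxicab_nonneg _), EuclideanSpace.norm_sq_eq]
  exact Finset.sum_sq_le_sq_sum_of_nonneg fun i _ ↦ norm_nonneg (x i)

theorem abs_taxicab_sub_le (x y : Euc m) : |taxicab x - taxicab y| ≤ m * ‖x - y‖ := by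
  rw [taxicab, taxicab, ← Finset.sum_sub_distrib]
  exact (Finset.abs_sum_le_sum_abs _ _).trans <|
    (Finset.sum_le_sum fun i _ ↦ abs_abs_sub_abs_le _ _).trans (taxicab_le (x - y))

theorem taxicab_smul (c : ℝ) (x : Euc m) : taxicab (c • x) = |c| * taxicab x := by
  simp only [taxicab, PiLp.smul_apply, smul_eq_mul, abs_mul, Finset.mul_sum]

theorem abs_div_sub_div_mul_le {a b c d : ℝ} (ha : 0 ≤ a) (hc : 0 < c) (hd : 0 < d) :
    |a / c - b / d| * d ≤ a / c * |c - d| + |a - b| := by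
  calc |a / c - b / d| * d = |(a / c - b / d) * d| := by rw [abs_mul, abs_of_pos hd]
    _ = |a / c * (d - c) + (a - b)| := by
      congr 1
      field_simp
      ring
    _ ≤ |a / c * (d - c)| + |a - b| := abs_add_le _ _
    _ = a / c * |c - d| + |a - b| := by rw [abs_mul, abs_of_nonneg (by positivity), abs_sub_comm d]

theorem norm_ratio_smul_sub_le {V : Type*} [NormedAddCommGroup V] [NormedSpace ℝ V]
    {N₁ N₂ : V → ℝ} {A L₁ L₂ : ℝ} (hA₀ : 0 ≤ A) (hN₁ : ∀ x, 0 ≤ N₁ x)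
    (hA : ∀ x, N₁ x ≤ A * N₂ x) (hN₂ : ∀ x, ‖x‖ ≤ N₂ x)
    (hL₁ : ∀ x y, |N₁ x - N₁ y| ≤ L₁ * ‖x - y‖) (hL₂ : ∀ x y, |N₂ x - N₂ y| ≤ L₂ * ‖x - y‖)
    (x y : V) :
    ‖(N₁ x / N₂ x) • x - (N₁ y / N₂ y) • y‖ ≤ (A + A * L₂ + L₁) * ‖x - y‖ := by
  have hN₂_nonneg (x) : 0 ≤ N₂ x := (norm_nonneg x).trans (hN₂ x)
  have hratio_nonneg (x) : 0 ≤ N₁ x / N₂ x := div_nonneg (hN₁ x) (hN₂_nonneg x)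
  have hratio (x) : N₁ x / N₂ x ≤ A := div_le_of_le_mul₀ (hN₂_nonneg x) hA₀ (hA x)
  have hsmul (x v : V) : ‖(N₁ x / N₂ x) • v‖ ≤ A * ‖v‖ := by
    rw [norm_smul, Real.norm_of_nonneg (hratio_nonneg x)]
    gcongr
    exact hratio x
  have hL₁_nonneg : 0 ≤ L₁ * ‖x - y‖ := (abs_nonneg _).trans (hL₁ x y)
  have hL₂_nonneg : 0 ≤ A * (L₂ * ‖x - y‖) := mul_nonneg hA₀ ((abs_nonneg _).trans (hL₂ x y))
  rcases eq_or_ne x 0 with rfl | hx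
  · rw [smul_zero, zero_sub, norm_neg]
    rw [zero_sub, norm_neg] at *
    linarith [hsmul y y]
  rcases eq_or_ne y 0 with rfl | hy
  · rw [smul_zero, sub_zero]
    rw [sub_zero] at *
    linarith [hsmul x x]
  have hdiff : ‖(N₁ x / N₂ x - N₁ y / N₂ y) • y‖ ≤ A * (L₂ * ‖x - y‖) + L₁ * ‖x - y‖ := by
    calc _ = |N₁ x / N₂ x - N₁ y / N₂ y| * ‖y‖ := norm_smul _ _
      _ ≤ |N₁ x / N₂ x - N₁ y / N₂ y| * N₂ y := by gcongr; exact hN₂ y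
      _ ≤ N₁ x / N₂ x * |N₂ x - N₂ y| + |N₁ x - N₁ y| :=
        abs_div_sub_div_mul_le (hN₁ x) ((norm_pos_iff.2 hx).trans_le (hN₂ x))
          ((norm_pos_iff.2 hy).trans_le (hN₂ y))
      _ ≤ A * (L₂ * ‖x - y‖) + L₁ * ‖x - y‖ := by
        gcongr
        exacts [hratio x, hL₂ x y, hL₁ x y]
  calc _ = ‖(N₁ x / N₂ x) • (x - y) + (N₁ x / N₂ x - N₁ y / N₂ y) • y‖ := by congr 1; module
    _ ≤ A * ‖x - y‖ + (A * (L₂ * ‖x - y‖) + L₁ * ‖x - y‖) :=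
      norm_add_le_of_le (hsmul x _) hdiff
    _ = (A + A * L₂ + L₁) * ‖x - y‖ := by ring

/-- The radial map of `ℝ^m` that takes Euclidean spheres to octahedra, that is, to spheres of the
`ℓ¹` norm. It is bi-Lipschitz, and a point of an octahedron is determined by all but one of its
coordinates and the sign of the remaining one. -/
def toOctahedral (x : Euc m) : Euc m := (‖x‖ / taxicab x) • x

theorem taxicab_toOctahedral (x : Euc m) : taxicab (toOctahedral x) = ‖x‖ := by
  rw [toOctahedral, taxicab_smul, abs_of_nonneg (div_nonneg (norm_nonneg x) (taxicab_nonneg x))]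
  exact div_mul_cancel_of_imp fun hx ↦ le_antisymm ((norm_le_taxicab x).trans_eq hx) (norm_nonneg x)

theorem norm_toOctahedral_sub_le (x y : Euc m) :
    ‖toOctahedral x - toOctahedral y‖ ≤ (m + 2) * ‖x - y‖ := by
  refine (norm_ratio_smul_sub_le (A := 1) (L₁ := 1) (L₂ := m) zero_le_one norm_nonneg
    (fun x ↦ (norm_le_taxicab x).trans_eq (one_mul _).symm) norm_le_taxicab
    (fun x y ↦ (abs_norm_sub_norm_le x y).trans_eq (one_mul _).symm) abs_taxicab_sub_le
    x y).trans_eq ?_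
  ring

theorem smul_toOctahedral_eq (x : Euc m) :
    (taxicab (toOctahedral x) / ‖toOctahedral x‖) • toOctahedral x = x := by
  rcases eq_or_ne x 0 with rfl | hx
  · rw [toOctahedral, smul_zero, smul_zero]
  have hnorm : ‖x‖ ≠ 0 := norm_ne_zero_iff.2 hx
  have htaxi : 0 < taxicab x := (norm_pos_iff.2 hx).trans_le (norm_le_taxicab x)
  rw [taxicab_toOctahedral, toOctahedral, norm_smul, smul_smul, norm_div, norm_norm,
    Real.norm_of_nonneg htaxi.le]
  convert one_smul ℝ x using 2
  field_simp

theorem norm_sub_le_norm_toOctahedral_sub (x y : Euc m) :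
    ‖x - y‖ ≤ 3 * m * ‖toOctahedral x - toOctahedral y‖ := by
  have hratio := norm_ratio_smul_sub_le (A := m) (L₁ := m) (L₂ := 1) (Nat.cast_nonneg m)
    taxicab_nonneg taxicab_le (fun x ↦ le_rfl) abs_taxicab_sub_le
    (fun x y ↦ (abs_norm_sub_norm_le x y).trans_eq (one_mul _).symm)
    (toOctahedral x) (toOctahedral y)
  rw [smul_toOctahedral_eq, smul_toOctahedral_eq] at hratio
  exact hratio.trans_eq (by ring)

theorem abs_sub_eq_abs_abs_sub_abs {a b : ℝ} (h : 0 ≤ a ↔ 0 ≤ b) : |a - b| = |(|a| - |b|)| := by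
  by_cases ha : 0 ≤ a
  · rw [abs_of_nonneg ha, abs_of_nonneg (h.1 ha)]
  · rw [abs_of_neg (not_le.1 ha), abs_of_neg (not_le.1 (ha ∘ h.2)), neg_sub_neg, abs_sub_comm]

theorem abs_sum_erase_le {i₀ : Fin m} {f : Fin m → ℝ} {t : ℝ} (hf : ∀ i ≠ i₀, |f i| ≤ t) :
    |∑ i ∈ Finset.univ.erase i₀, f i| ≤ (m - 1) * t := by
  refine (Finset.abs_sum_le_sum_abs _ _).trans
    ((Finset.sum_le_card_nsmul _ _ t fun i hi ↦ hf i (Finset.ne_of_mem_erase hi)).trans_eq ?_)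
  rw [Finset.card_erase_of_mem (Finset.mem_univ i₀), Finset.card_univ, Fintype.card_fin,
    nsmul_eq_mul, Nat.cast_pred i₀.pos]

theorem taxicab_sub_le {i₀ : Fin m} {x y : Euc m} {s t : ℝ}
    (hi : ∀ i ≠ i₀, |x i - y i| ≤ t) (hhalf : 0 ≤ x i₀ ↔ 0 ≤ y i₀)
    (hs : |taxicab x - taxicab y| ≤ s) : taxicab (x - y) ≤ s + 2 * ((m - 1) * t) := by
  have hsum (f : Fin m → ℝ) : ∑ i, f i = f i₀ + ∑ i ∈ Finset.univ.erase i₀, f i :=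
    (Finset.add_sum_erase _ f (Finset.mem_univ i₀)).symm
  have habs : |∑ i ∈ Finset.univ.erase i₀, (|x i - y i|)| ≤ (m - 1) * t :=
    abs_sum_erase_le fun i hne ↦ (abs_abs _).trans_le (hi i hne)
  have hdiff : |∑ i ∈ Finset.univ.erase i₀, (|x i| - |y i|)| ≤ (m - 1) * t :=
    abs_sum_erase_le fun i hne ↦ (abs_abs_sub_abs_le _ _).trans (hi i hne)
  have hi₀ : |(|x i₀| - |y i₀|)| ≤ s + (m - 1) * t := by
    rw [taxicab, taxicab, ← Finset.sum_sub_distrib, hsum] at hs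
    rw [abs_le] at hs hdiff ⊢
    constructor <;> linarith
  calc taxicab (x - y) = |x i₀ - y i₀| + ∑ i ∈ Finset.univ.erase i₀, |x i - y i| := hsum _
    _ ≤ s + (m - 1) * t + (m - 1) * t :=
      add_le_add ((abs_sub_eq_abs_abs_sub_abs hhalf).trans_le hi₀) ((le_abs_self _).trans habs)
    _ = s + 2 * ((m - 1) * t) := by ring

end Octahedral

section AsymptoticDimension

variable {m : ℕ} {h : ℝ → ℝ}

theorem abs_norm_sphereCoord_sub_radius_le (hh : IsProfile h) (x : Euc m) :
    |‖sphereCoord h 0 x‖ - radius h x| ≤ 1 := by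
  have hb := bracket_pos x
  have hsub : radius h x - ‖sphereCoord h 0 x‖ = radius h x / bracket x * (bracket x - ‖x‖) := by
    rw [norm_sphereCoord_zero]
    field_simp
  have hgap : 0 ≤ bracket x - ‖x‖ := sub_nonneg.2 (norm_le_bracket x)
  have hgap_le : bracket x - ‖x‖ ≤ 1 := sub_le_iff_le_add.2 (sqrt_one_add_norm_sq_le x)
  have hratio : radius h x / bracket x ≤ 1 := (div_le_one hb).2 (radius_le_bracket hh x)
  have hratio_nonneg : 0 ≤ radius h x / bracket x := div_nonneg (radius_pos h x).le hb.le
  rw [abs_sub_comm, hsub, abs_of_nonneg (mul_nonneg hratio_nonneg hgap)]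
  exact mul_le_one₀ hratio hgap hgap_le

theorem abs_sub_le_abs_sub_of_monotone {f g : ℝ → ℝ} (hf : Monotone f)
    (hgf : Monotone fun t ↦ g t - f t) (s t : ℝ) : |f s - f t| ≤ |g s - g t| := by
  wlog hst : s ≤ t generalizing s t
  · rw [abs_sub_comm, abs_sub_comm (g s)]
    exact this t s (le_of_not_ge hst)
  have hle : f s ≤ f t := hf hst
  have hdiff : g s - f s ≤ g t - f t := hgf hst
  rw [abs_sub_comm, abs_of_nonneg (sub_nonneg.2 hle), abs_sub_comm]
  exact le_trans (by linarith) (le_abs_self _)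

theorem abs_radius_sub_le_abs_radialCoord_sub (hh : IsProfile h) (x y : Euc m) :
    |radius h x - radius h y| ≤ |radialCoord h x - radialCoord h y| := by
  have hderiv (t : ℝ) : HasDerivAt (fun t ↦ radialPrimitive h t - Real.exp (h t))
      (Real.exp (h t) / 2 - Real.exp (h t) * deriv h t) t :=
    (hasDerivAt_radialPrimitive hh.contDiff.continuous t).sub (hh.hasDerivAt t).exp
  refine abs_sub_le_abs_sub_of_monotone (f := fun t ↦ Real.exp (h t)) (g := radialPrimitive h)
    (Real.exp_monotone.comp hh.monotone)
    (monotone_of_hasDerivAt_nonneg hderiv fun t ↦ ?_) (logBracket x) (logBracket y)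
  change 0 ≤ _
  nlinarith [Real.exp_pos (h t), hh.deriv_le t]

/-- The sphere coordinate based at the origin, with spheres replaced by octahedra. -/
def octahedralCoord (h : ℝ → ℝ) (x : Euc m) : Euc m := toOctahedral (sphereCoord h 0 x)

theorem norm_octahedralCoord_sub_le (hh : IsProfile h) (x y : Euc m) :
    ‖octahedralCoord h x - octahedralCoord h y‖ ≤
      4 * (m + 2) * rdist (profileMetric m hh) x y := by
  calc _ ≤ (m + 2) * ‖sphereCoord h 0 x - sphereCoord h 0 y‖ := norm_toOctahedral_sub_le _ _
    _ ≤ (m + 2) * (4 * rdist (profileMetric m hh) x y) := by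
      gcongr
      exact norm_sphereCoord_sub_le hh 0 x y
    _ = _ := by ring

theorem abs_taxicab_octahedralCoord_sub_le (hh : IsProfile h) (x y : Euc m) :
    |taxicab (octahedralCoord h x) - taxicab (octahedralCoord h y)| ≤
      |radialCoord h x - radialCoord h y| + 2 := by
  rw [octahedralCoord, octahedralCoord, taxicab_toOctahedral, taxicab_toOctahedral]
  have hx := abs_le.1 (abs_norm_sphereCoord_sub_radius_le hh x)
  have hy := abs_le.1 (abs_norm_sphereCoord_sub_radius_le hh y)
  have hradius := abs_le.1 (abs_radius_sub_le_abs_radialCoord_sub hh x y)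
  rw [abs_le]
  constructor <;> linarith

theorem rdist_le_of_coords (hh : IsProfile h) (hm : 3 ≤ m) {i₀ : Fin m} {x y : Euc m} {t : ℝ}
    (hrad : |radialCoord h x - radialCoord h y| ≤ t)
    (hi : ∀ i ≠ i₀, |octahedralCoord h x i - octahedralCoord h y i| ≤ t)
    (hhalf : 0 ≤ octahedralCoord h x i₀ ↔ 0 ≤ octahedralCoord h y i₀) :
    rdist (profileMetric m hh) x y ≤ (2 + 36 * m ^ 2) * t + (36 * m + 216) := by
  have hoct : ‖octahedralCoord h x - octahedralCoord h y‖ ≤ 2 * m * t + 2 := by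
    refine (norm_le_taxicab _).trans ((taxicab_sub_le hi hhalf
      ((abs_taxicab_octahedralCoord_sub_le hh x y).trans (add_le_add_left hrad 2))).trans ?_)
    linarith [(abs_nonneg _).trans hrad]
  have hsphere : ‖sphereCoord h 0 x - sphereCoord h 0 y‖ ≤ 3 * m * (2 * m * t + 2) :=
    (norm_sub_le_norm_toOctahedral_sub _ _).trans (by gcongr; exact hoct)
  calc _ ≤ _ := rdist_le hh hm x y
    _ ≤ 2 * t + 6 * (3 * m * (2 * m * t + 2)) + 216 := by gcongr
    _ = (2 + 36 * m ^ 2) * t + (36 * m + 216) := by ring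

-- The coordinates are the radial coordinate and all but one of the octahedral ones; the sign of
-- the omitted one distinguishes the two halves of a box.
theorem asdimLEWith_profileMetric (hh : IsProfile h) (hm : 3 ≤ m) :
    AsdimLEWith (RiemannianSpace (profileMetric m hh)) m fun r ↦
      (6 * (4 * (m + 2)) * ((2 + 36 * m ^ 2) * (m + 1)) + 2) * r + 2 * (36 * m + 216) := by
  let i₀ : Fin m := ⟨0, by lia⟩
  refine asdimLEWith_of_coordinates (by positivity)
    (fun i (x : Euc m) ↦ if i = i₀ then radialCoord h x else octahedralCoord h x i)
    (fun i (x y : Euc m) ↦ ?_) (fun x : Euc m ↦ decide (0 ≤ octahedralCoord h x i₀))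
    (fun ℓ _ (x y : Euc m) hhalf hi ↦ ?_)
  · change _ ≤ _ * rdist (profileMetric m hh) x y
    push_cast
    split_ifs
    · exact (abs_radialCoord_sub_le hh x y).trans (le_mul_of_one_le_left (rdist_nonneg _ _ _)
        (by linarith [m.cast_nonneg (α := ℝ)]))
    · exact (abs_coord_le_norm (octahedralCoord h x - octahedralCoord h y) i).trans
        (norm_octahedralCoord_sub_le hh x y)
  · change rdist (profileMetric m hh) x y ≤ _
    have hrad := hi i₀
    rw [if_pos rfl, if_pos rfl] at hrad
    refine (rdist_le_of_coords hh hm hrad (fun i hne ↦ ?_) (decide_eq_decide.1 hhalf)).trans_eq ?_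
    · simpa only [if_neg hne] using hi i
    · push_cast
      ring

end AsymptoticDimension

/-! ### Slowly growing profiles -/

section Staircase

/-- A superposition of copies of `φ` that start at the points `a k`, the `k`-th one stretched by
`2 ^ k`. If `φ` rises from `0` to `1`, then `staircase a 1 φ` grows arbitrarily slowly for suitable
`a`, while the stretching keeps its derivatives bounded however close the points `a k` are. The sum
is cut off at `⌈w⌉₊` since for `k ≤ a k` the later summands vanish at `w`. -/
def staircase (a : ℕ → ℝ) (q : ℝ) (φ : ℝ → ℝ) (w : ℝ) : ℝ :=
  ∑ k ∈ Finset.range ⌈w⌉₊, q ^ k * φ ((w - a k) / 2 ^ k)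

variable {a : ℕ → ℝ} {q : ℝ} {φ φ' : ℝ → ℝ} {w : ℝ}

theorem stretch_eq_zero (hφ : ∀ t ≤ 0, φ t = 0) {k : ℕ} (hk : w ≤ a k) :
    φ ((w - a k) / 2 ^ k) = 0 :=
  hφ _ (div_nonpos_of_nonpos_of_nonneg (sub_nonpos.2 hk) (by positivity))

theorem staircase_eq (ha : ∀ k : ℕ, (k : ℝ) ≤ a k) (hφ : ∀ t ≤ 0, φ t = 0) {N : ℕ} (hN : w ≤ N) :
    staircase a q φ w = ∑ k ∈ Finset.range N, q ^ k * φ ((w - a k) / 2 ^ k) := by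
  refine Finset.sum_subset (Finset.range_subset_range.2 (Nat.ceil_le.2 hN)) fun k _ hk ↦ ?_
  have hwk : w ≤ k := Nat.ceil_le.1 (not_lt.1 fun hlt ↦ hk (Finset.mem_range.2 hlt))
  rw [stretch_eq_zero hφ (hwk.trans (ha k)), mul_zero]

theorem staircase_eventuallyEq (ha : ∀ k : ℕ, (k : ℝ) ≤ a k) (hφ : ∀ t ≤ 0, φ t = 0) {N : ℕ}
    (hN : w < N) :
    staircase a q φ =ᶠ[𝓝 w] fun w ↦ ∑ k ∈ Finset.range N, q ^ k * φ ((w - a k) / 2 ^ k) := by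
  filter_upwards [Iio_mem_nhds hN] with v hv
  exact staircase_eq ha hφ (le_of_lt hv)

theorem contDiff_staircase (ha : ∀ k : ℕ, (k : ℝ) ≤ a k) (hφ : ∀ t ≤ 0, φ t = 0)
    (hc : ContDiff ℝ ∞ φ) : ContDiff ℝ ∞ (staircase a q φ) := by
  refine contDiff_iff_contDiffAt.2 fun w ↦ ?_
  obtain ⟨N, hN⟩ := exists_nat_gt w
  refine ContDiffAt.congr_of_eventuallyEq ?_ (staircase_eventuallyEq ha hφ hN)
  fun_prop

theorem hasDerivAt_staircase (ha : ∀ k : ℕ, (k : ℝ) ≤ a k) (hφ : ∀ t ≤ 0, φ t = 0)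
    (hφ' : ∀ t ≤ 0, φ' t = 0) (hd : ∀ t, HasDerivAt φ (φ' t) t) (w : ℝ) :
    HasDerivAt (staircase a q φ) (staircase a (q / 2) φ' w) w := by
  obtain ⟨N, hN⟩ := exists_nat_gt w
  refine HasDerivAt.congr_of_eventuallyEq ?_ (staircase_eventuallyEq ha hφ hN)
  rw [staircase_eq ha hφ' hN.le]
  refine HasDerivAt.fun_sum fun k _ ↦ ?_
  have hstretch : HasDerivAt (fun w ↦ (w - a k) / 2 ^ k) (1 / 2 ^ k) w :=
    ((hasDerivAt_id w).sub_const _).div_const _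
  refine (((hd _).comp w hstretch).const_mul (q ^ k)).congr_deriv ?_
  rw [div_pow]
  ring

theorem abs_staircase_le {C : ℝ} (hC : ∀ t, |φ t| ≤ C) (hq : 0 ≤ q) (hq' : q ≤ 1 / 2) (w : ℝ) :
    |staircase a q φ w| ≤ 2 * C := by
  have hC0 : 0 ≤ C := (abs_nonneg _).trans (hC 0)
  calc |staircase a q φ w| ≤ ∑ k ∈ Finset.range ⌈w⌉₊, |q ^ k * φ ((w - a k) / 2 ^ k)| :=
        Finset.abs_sum_le_sum_abs _ _
    _ ≤ ∑ k ∈ Finset.range ⌈w⌉₊, (1 / 2 : ℝ) ^ k * C := by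
        refine Finset.sum_le_sum fun k _ ↦ ?_
        rw [abs_mul, abs_of_nonneg (pow_nonneg hq k)]
        gcongr
        exact hC _
    _ ≤ 2 * C := by
        rw [← Finset.sum_mul]
        gcongr
        exact sum_geometric_two_le _

theorem staircase_nonneg (hφ : ∀ t, 0 ≤ φ t) (hq : 0 ≤ q) (w : ℝ) : 0 ≤ staircase a q φ w :=
  Finset.sum_nonneg fun _ _ ↦ mul_nonneg (pow_nonneg hq _) (hφ _)

theorem staircase_eq_zero (hw : w ≤ 0) : staircase a q φ w = 0 := by
  rw [staircase, Nat.ceil_eq_zero.2 hw, Finset.range_zero, Finset.sum_empty]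

theorem staircase_eq_zero_or_exists_lt (hφ : ∀ t ≤ 0, φ t = 0) (hφ1 : ∀ t, φ t ≤ 1) (w : ℝ) :
    staircase a 1 φ w = 0 ∨ ∃ k : ℕ, a k < w ∧ staircase a 1 φ w ≤ k + 1 := by
  classical
  set T := (Finset.range ⌈w⌉₊).filter fun k ↦ a k < w
  have hsum : staircase a 1 φ w = ∑ k ∈ T, φ ((w - a k) / 2 ^ k) := by
    simp only [staircase, one_pow, one_mul]
    exact (Finset.sum_filter_of_ne fun k _ hne ↦
      lt_of_not_ge fun hk ↦ hne (stretch_eq_zero hφ hk)).symm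
  rw [hsum]
  rcases T.eq_empty_or_nonempty with hT | hT
  · exact Or.inl (by rw [hT, Finset.sum_empty])
  refine Or.inr ⟨T.max' hT, (Finset.mem_filter.1 (T.max'_mem hT)).2, ?_⟩
  have hcard : T.card ≤ T.max' hT + 1 := by
    rw [← Finset.card_range (T.max' hT + 1)]
    exact Finset.card_le_card fun k hk ↦
      Finset.mem_range.2 (Nat.lt_succ_of_le (T.le_max' k hk))
  calc ∑ k ∈ T, φ ((w - a k) / 2 ^ k) ≤ T.card • (1 : ℝ) :=
        Finset.sum_le_card_nsmul _ _ _ fun k _ ↦ hφ1 _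
    _ ≤ T.max' hT + 1 := by
        rw [nsmul_eq_mul, mul_one]
        exact_mod_cast hcard

theorem tendsto_staircase (ha : ∀ k : ℕ, (k : ℝ) ≤ a k) (hφ : ∀ t ≤ 0, φ t = 0)
    (hφ0 : ∀ t, 0 ≤ φ t) (hφ1 : ∀ t, 1 ≤ t → φ t = 1) :
    Tendsto (staircase a 1 φ) atTop atTop := by
  refine tendsto_atTop.2 fun M ↦ ?_
  obtain ⟨N, hN⟩ := exists_nat_ge M
  have hsteps : ∀ᶠ w : ℝ in atTop, ∀ k ∈ Finset.range N, a k + 2 ^ k ≤ w :=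
    (Finset.eventually_all _).2 fun k _ ↦ eventually_ge_atTop _
  filter_upwards [hsteps] with w hw
  have hceil : w ≤ (max N ⌈w⌉₊ : ℕ) :=
    (Nat.le_ceil w).trans (Nat.cast_le.2 (le_max_right _ _))
  rw [staircase_eq ha hφ hceil]
  simp only [one_pow, one_mul]
  calc M ≤ ∑ _ ∈ Finset.range N, (1 : ℝ) := by simpa using hN
    _ = ∑ k ∈ Finset.range N, φ ((w - a k) / 2 ^ k) :=
        Finset.sum_congr rfl fun k hk ↦
          (hφ1 _ ((one_le_div (by positivity)).2 (le_sub_iff_add_le'.2 (hw k hk)))).symm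
    _ ≤ _ := Finset.sum_le_sum_of_subset_of_nonneg
        (Finset.range_subset_range.2 (le_max_left _ _)) fun k _ _ ↦ hφ0 _

end Staircase

section SlowProfile

theorem deriv_eq_zero_of_nonpos {φ : ℝ → ℝ} (hd : Differentiable ℝ φ) (hφ : ∀ t ≤ 0, φ t = 0) :
    ∀ t ≤ 0, deriv φ t = 0 := fun t ht ↦
  (uniqueDiffWithinAt_Iic t).eq_deriv _ (hd t).hasDerivAt.hasDerivWithinAt
    ((hasDerivWithinAt_const t (Iic t) (0 : ℝ)).congr (fun s hs ↦ hφ s (le_trans hs ht)) (hφ t ht))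

theorem hasCompactSupport_deriv_smoothTransition :
    HasCompactSupport (deriv Real.smoothTransition) := by
  refine HasCompactSupport.intro (isCompact_Icc (a := (0 : ℝ)) (b := 1)) fun t ht ↦ ?_
  rcases lt_or_ge t 0 with ht0 | ht0
  · have hzero : Real.smoothTransition =ᶠ[𝓝 t] fun _ ↦ 0 := by
      filter_upwards [Iio_mem_nhds ht0] with s hs
      exact Real.smoothTransition.zero_of_nonpos (le_of_lt hs)
    rw [hzero.deriv_eq, deriv_const]
  · have hone : Real.smoothTransition =ᶠ[𝓝 t] fun _ ↦ 1 := by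
      filter_upwards [Ioi_mem_nhds (not_le.1 fun ht1 ↦ ht ⟨ht0, ht1⟩)] with s hs
      exact Real.smoothTransition.one_of_one_le (le_of_lt hs)
    rw [hone.deriv_eq, deriv_const]

theorem exists_forall_isProfile_staircase : ∃ δ > 0, ∀ a : ℕ → ℝ, (∀ k : ℕ, (k : ℝ) ≤ a k) →
    IsProfile fun w ↦ δ * staircase a 1 Real.smoothTransition w := by
  set S := Real.smoothTransition
  have hS : ContDiff ℝ ∞ S := Real.smoothTransition.contDiff
  have hS' : ContDiff ℝ ∞ (deriv S) := hS.iterate_deriv 1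
  have hSd : Differentiable ℝ S := hS.differentiable (by simp)
  have hS'd : Differentiable ℝ (deriv S) := hS'.differentiable (by simp)
  have hS_zero : ∀ t ≤ 0, S t = 0 := fun t ↦ Real.smoothTransition.zero_of_nonpos
  have hS'_zero := deriv_eq_zero_of_nonpos hSd hS_zero
  have hS''_zero := deriv_eq_zero_of_nonpos hS'd hS'_zero
  have hsupp : HasCompactSupport (deriv S) := hasCompactSupport_deriv_smoothTransition
  obtain ⟨C₁, hC₁⟩ := hsupp.exists_bound_of_continuous hS'.continuous
  obtain ⟨C₂, hC₂⟩ := hsupp.deriv.exists_bound_of_continuous (hS.iterate_deriv 2).continuous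
  have hC₁0 : 0 ≤ C₁ := (norm_nonneg _).trans (hC₁ 0)
  have hC₂0 : 0 ≤ C₂ := (norm_nonneg _).trans (hC₂ 0)
  set δ : ℝ := 1 / (64 * (C₁ + C₂ + 1)) with hδ
  have hδ0 : 0 < δ := by positivity
  have hδ_mul : ∀ x ≤ 2 * (C₁ + C₂), δ * x ≤ 1 / 32 := fun x hx ↦ by
    rw [hδ, div_mul_eq_mul_div, div_le_div_iff₀ (by positivity) (by norm_num)]
    linarith
  refine ⟨δ, hδ0, fun a ha ↦ ?_⟩
  have hderiv : deriv (fun w ↦ δ * staircase a 1 S w) =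
      fun w ↦ δ * staircase a (1 / 2) (deriv S) w := funext fun w ↦
    ((hasDerivAt_staircase ha hS_zero hS'_zero (fun t ↦ (hSd t).hasDerivAt) w).const_mul δ).deriv
  have hderiv2 (w : ℝ) : deriv (fun w ↦ δ * staircase a (1 / 2) (deriv S) w) w =
      δ * staircase a (1 / 2 / 2) (deriv (deriv S)) w :=
    ((hasDerivAt_staircase ha hS'_zero hS''_zero (fun t ↦ (hS'd t).hasDerivAt) w).const_mul δ).deriv
  refine ⟨contDiff_const.mul (contDiff_staircase ha hS_zero hS), fun t ht ↦ ?_, fun t ↦ ?_,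
    fun t ↦ ?_, fun t ↦ ?_, ?_⟩
  · rw [staircase_eq_zero ht, mul_zero]
  · rw [hderiv]
    exact mul_nonneg hδ0.le (staircase_nonneg
      (fun t ↦ Real.smoothTransition.monotone.deriv_nonneg) (by norm_num) t)
  · have hle := (le_abs_self _).trans (abs_staircase_le (a := a) hC₁ (by norm_num) le_rfl t)
    rw [hderiv]
    exact hδ_mul _ (by linarith)
  · have hle := abs_staircase_le (a := a) (q := 1 / 2 / 2) hC₂ (by norm_num) (by norm_num) t
    rw [hderiv, hderiv2, abs_mul, abs_of_pos hδ0]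
    exact hδ_mul _ (by linarith)
  · exact (tendsto_staircase ha hS_zero Real.smoothTransition.nonneg
      fun t ↦ Real.smoothTransition.one_of_one_le).const_mul_atTop hδ0

theorem exists_isProfile {G : ℝ≥0 → ℝ} (hG : Tendsto G atTop atTop) :
    ∃ h, IsProfile h ∧ ∀ r : ℝ≥0, Real.exp (4 * h (3 * r)) ≤ max 1 (G r) := by
  obtain ⟨δ, hδ, hprofile⟩ := exists_forall_isProfile_staircase
  have hthreshold (k : ℕ) : ∃ ρ : ℝ≥0, (k : ℝ≥0) ≤ ρ ∧
      ∀ r ≥ ρ, Real.exp (4 * (δ * (k + 1))) ≤ G r := by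
    obtain ⟨ρ, hρ⟩ := eventually_atTop.1 (hG.eventually_ge_atTop (Real.exp (4 * (δ * (k + 1)))))
    exact ⟨max k ρ, le_max_left _ _, fun r hr ↦ hρ r ((le_max_right _ _).trans hr)⟩
  choose ρ hρ hρG using hthreshold
  have hρ3 (k : ℕ) : (k : ℝ) ≤ 3 * ρ k := by
    have hk : (k : ℝ) ≤ ρ k := by exact_mod_cast hρ k
    linarith [(ρ k).coe_nonneg]
  refine ⟨_, hprofile (fun k ↦ 3 * ρ k) hρ3, fun r ↦ ?_⟩
  rcases staircase_eq_zero_or_exists_lt (a := fun k ↦ 3 * (ρ k : ℝ))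
    (fun t ↦ Real.smoothTransition.zero_of_nonpos) Real.smoothTransition.le_one (3 * r)
    with hzero | ⟨k, hk, hle⟩
  · rw [hzero, mul_zero, mul_zero, Real.exp_zero]
    exact le_max_left _ _
  · have hkr : ρ k ≤ r := by
      rw [← NNReal.coe_le_coe]
      linarith
    refine le_max_of_le_right (le_trans ?_ (hρG k r hkr))
    gcongr

end SlowProfile

end ScalarDecay

end

open ScalarDecay in
theorem proposition5p11_general (m : ℕ) (hm : 3 ≤ m) :
    ∃ a b : ℝ≥0, ∀ G : ℝ≥0 → ℝ, Tendsto G atTop atTop →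
      ∃ g : SmoothMetric m, CompleteSpace (RiemannianSpace g) ∧ HasBoundedGeometry g ∧
        UniformlyContractible (RiemannianSpace g) ∧
        AsdimLEWith (RiemannianSpace g) m (fun r ↦ a * r + b) ∧
        (∀ x : RiemannianSpace g, 0 < scalarCurvature g x) ∧
        ∀ x₀ : RiemannianSpace g, Tendsto (fun r : ℝ≥0 ↦ G r *
          ⨅ x : Metric.closedBall x₀ (r : ℝ), scalarCurvature g x.1) atTop atTop := by
  refine ⟨6 * (4 * (m + 2)) * ((2 + 36 * m ^ 2) * (m + 1)) + 2, 2 * (36 * m + 216),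
    fun G hG ↦ ?_⟩
  obtain ⟨h, hh, hhG⟩ := exists_isProfile hG
  exact ⟨profileMetric m hh, completeSpace_profileMetric hh, hasBoundedGeometry_profileMetric hh,
    uniformlyContractible_profileMetric hh, asdimLEWith_profileMetric hh hm,
    fun x ↦ (Real.exp_pos _).trans_le (exp_neg_le_scalarCurvature hh hm x),
    tendsto_mul_iInf_scalarCurvature hh hm hG hhG⟩

theorem proposition5p11 (m : ℕ) (hm : 3 ≤ m) :
    ∃ a b : ℝ≥0, ∀ G : ℝ≥0 → ℝ≥0, ScalarDecay.IsControlFunction G →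
      ∃ g : ScalarDecay.SmoothMetric m,
        CompleteSpace (ScalarDecay.RiemannianSpace g) ∧
        ScalarDecay.HasBoundedGeometry g ∧
        ScalarDecay.UniformlyContractible (ScalarDecay.RiemannianSpace g) ∧
        ScalarDecay.AsdimLEWith (ScalarDecay.RiemannianSpace g) m (fun r ↦ a * r + b) ∧
        (∀ x : ScalarDecay.RiemannianSpace g, 0 < ScalarDecay.scalarCurvature g x) ∧
        ∀ x₀ : ScalarDecay.RiemannianSpace g,
          Tendsto (fun r : ℝ≥0 ↦ (G r : ℝ) *
            ⨅ x : Metric.closedBall x₀ (r : ℝ), ScalarDecay.scalarCurvature g x.1) atTop atTop := by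
  obtain ⟨a, b, hab⟩ := proposition5p11_general m hm
  exact ⟨a, b, fun G hG ↦ hab (fun r ↦ G r) (NNReal.tendsto_coe_atTop.2 hG.2)⟩
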